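/- Let $n\ge 3$ and let $M$ be a compact $n$-dimensional orbifold with finitely many isolated singularities. That is, $M$ is a compact Hausdorff space with a finite (possibly empty) subset $\Sigma\subset M$ such that $M\setminus\Sigma$ is a smooth $n$-manifold. Moreover, for each $p\in\Sigma$ there are a nontrivial finite group $\Gamma_p<O(n)$ acting freely on $\mathbb R^n\setminus\{0\}$, a ball $B_p=B_{\tau_p}(0)\subset\mathbb R^n$ with $\tau_p>0$, and a fixed homeomorphism $\phi_p:U_p\to B_p/\Gamma_p$ from an open neighbourhood $U_p$ of $p$, with $\phi_p(p)=[0]$, that restricts to a diffeomorphism $U_p\setminus\{p\}\to (B_p\setminus\{0\})/\Gamma_p$. Let $\pi_p:B_p\to B_p/\Gamma_p$ be the projection. An orbifold metric on $M$ is a smooth Riemannian metric $g$ on $M\setminus\Sigma$ such that, for each $p\in\Sigma$, the pullback $(\phi_p^{-1}\circ\pi_p)^*g$ on $B_p\setminus\{0\}$ extends to a smooth $\Gamma_p$-invariant Riemannian metric on $B_p$. Let $\mathrm{Riem}^{\mathrm{orb}}(M)$ be the set of orbifold metrics, and let $$I(g)=\frac{\int_M R_g\,d\sigma_g}{\mathrm{Vol}_g(M)^{\frac{n-2}{n}}},\qquad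 g\in \mathrm{Riem}^{\mathrm{orb}}(M),$$ be the normalized Einstein–Hilbert functional, where $R_g$ is the scalar curvature and $d\sigma_g$ the Riemannian volume measure (for $M=\emptyset$ put $I=0$). Call $g\in \mathrm{Riem}^{\mathrm{orb}}(M)$ a critical point of $I$ if $\frac{d}{dt}\big|_{t=0}I(g+th)$ exists and equals $0$ for every smooth symmetric $2$-tensor $h$ on $M\setminus\Sigma$ such that, for each $p\in\Sigma$, $(\phi_p^{-1}\circ\pi_p)^*h$ extends to a smooth $\Gamma_p$-invariant symmetric $2$-tensor on $B_p$. Call $g$ an Einstein orbifold metric if $\mathrm{Ric}_g=c\,g$ on $M\setminus\Sigma$ for some constant $c\in\mathbb R$. Then the set of critical points of $I:\mathrm{Riem}^{\mathrm{orb}}(M)\to\mathbb R$ coincides with the set of Einstein orbifold metrics on $M$. -/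

import Mathlib

open scoped Manifold ContDiff Topology Bundle
open MeasureTheory

noncomputable section

namespace EHOrbifold

/-- Euclidean `n`-space, with its Euclidean norm and Lebesgue measure. -/
abbrev Euc (n : ℕ) : Type := EuclideanSpace ℝ (Fin n)

/-! ### Riemannian geometry in coordinates

A metric on an open subset of `ℝⁿ` is given by its matrix `G y = (g_ij(y))`. -/

section Coordinates

/-- The `i`-th partial derivative. -/
def pd {n : ℕ} (i : Fin n) (f : Euc n → ℝ) (y : Euc n) : ℝ :=
  fderiv ℝ f y (EuclideanSpace.single i 1)

/-- The Christoffel symbol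
`Γ^k_ij = 1/2 ∑_l g^{kl} (∂_i g_jl + ∂_j g_il - ∂_l g_ij)` of the Levi-Civita connection. -/
def christoffel {n : ℕ} (G : Euc n → Matrix (Fin n) (Fin n) ℝ) (k i j : Fin n) (y : Euc n) : ℝ :=
  (1 / 2) * ∑ l, (G y)⁻¹ k l *
    (pd i (fun z => G z j l) y + pd j (fun z => G z i l) y - pd l (fun z => G z i j) y)

/-- The Ricci tensor
`R_ij = ∑_k (∂_k Γ^k_ij - ∂_j Γ^k_ik) + ∑_{k,l} (Γ^k_kl Γ^l_ij - Γ^k_jl Γ^l_ik)`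
(positive on round spheres). -/
def coordRicci {n : ℕ} (G : Euc n → Matrix (Fin n) (Fin n) ℝ) (i j : Fin n) (y : Euc n) : ℝ :=
  (∑ k, (pd k (christoffel G k i j) y - pd j (christoffel G k i k) y)) +
    ∑ k, ∑ l, (christoffel G k k l y * christoffel G l i j y
      - christoffel G k j l y * christoffel G l i k y)

/-- The scalar curvature `R = ∑_{i,j} g^{ij} R_ij`. -/
def coordScalar {n : ℕ} (G : Euc n → Matrix (Fin n) (Fin n) ℝ) (y : Euc n) : ℝ :=
  ∑ i, ∑ j, (G y)⁻¹ i j * coordRicci G i j y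

end Coordinates

/-! ### Covariant 2-tensors on manifolds -/

section Manifolds

/-- Covariant 2-tensor fields (no regularity or symmetry required) on an `n`-manifold `X`. -/
abbrev TwoTensor (n : ℕ) (X : Type*) [TopologicalSpace X] [ChartedSpace (Euc n) X] : Type _ :=
  ∀ x : X, TangentSpace 𝓘(ℝ, Euc n) x →L[ℝ] TangentSpace 𝓘(ℝ, Euc n) x →L[ℝ] ℝ

/-- The pullback `(f^* h)_y(u, v) = h_{f(y)}(df_y u, df_y v)` of `h` by a map `f` from `ℝⁿ`. -/
def pullback {n : ℕ} {X : Type*} [TopologicalSpace X] [ChartedSpace (Euc n) X]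
    (f : Euc n → X) (h : TwoTensor n X) (y u v : Euc n) : ℝ :=
  h (f y) (mfderiv 𝓘(ℝ, Euc n) 𝓘(ℝ, Euc n) f y u) (mfderiv 𝓘(ℝ, Euc n) 𝓘(ℝ, Euc n) f y v)

/-- The coordinate matrix `(h_ij)` of `h` in the chart `e`, a function on `e.target`. -/
def chartMatrix {n : ℕ} {X : Type*} [TopologicalSpace X] [ChartedSpace (Euc n) X]
    (h : TwoTensor n X) (e : OpenPartialHomeomorph X (Euc n)) (y : Euc n) :
    Matrix (Fin n) (Fin n) ℝ :=
  Matrix.of fun i j =>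
    pullback e.symm h y (EuclideanSpace.single i 1) (EuclideanSpace.single j 1)

/-- Smoothness of a 2-tensor field, as a section of the bundle of bilinear forms. -/
def SmoothTensor {n : ℕ} {X : Type*} [TopologicalSpace X] [ChartedSpace (Euc n) X]
    [IsManifold 𝓘(ℝ, Euc n) ∞ X] (h : TwoTensor n X) : Prop :=
  ContMDiff 𝓘(ℝ, Euc n) (𝓘(ℝ, Euc n).prod 𝓘(ℝ, Euc n →L[ℝ] Euc n →L[ℝ] ℝ)) ∞
    (fun x => Bundle.TotalSpace.mk' (Euc n →L[ℝ] Euc n →L[ℝ] ℝ)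
      (E := fun x : X => TangentSpace 𝓘(ℝ, Euc n) x →L[ℝ] TangentSpace 𝓘(ℝ, Euc n) x →L[ℝ] ℝ)
      x (h x))

/-- The components `(du^1(w), …, du^n(w))` of a tangent vector `w` at `x`
in the preferred chart at `x`. -/
def components {n : ℕ} {X : Type*} [TopologicalSpace X] [ChartedSpace (Euc n) X]
    (x : X) (w : TangentSpace 𝓘(ℝ, Euc n) x) : Euc n :=
  mfderiv 𝓘(ℝ, Euc n) 𝓘(ℝ, Euc n) (chartAt (Euc n) x) x w

/-- The Ricci curvature `Ric_g(u, v)` at `x`, computed in the preferred chart at `x`. -/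
def ricci {n : ℕ} {X : Type*} [TopologicalSpace X] [ChartedSpace (Euc n) X]
    (g : TwoTensor n X) (x : X) (u v : TangentSpace 𝓘(ℝ, Euc n) x) : ℝ :=
  ∑ i, ∑ j, coordRicci (chartMatrix g (chartAt (Euc n) x)) i j (chartAt (Euc n) x x) *
    components x u i * components x v j

/-- The scalar curvature `R_g(x)`, computed in the preferred chart at `x`. -/
def scalarCurvature {n : ℕ} {X : Type*} [TopologicalSpace X] [ChartedSpace (Euc n) X]
    (g : TwoTensor n X) (x : X) : ℝ :=
  coordScalar (chartMatrix g (chartAt (Euc n) x)) (chartAt (Euc n) x x)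

/-- The Riemannian volume measure on the domain of one chart `e`:
the image under `e.symm` of `√(det (g_ij)) dy` on `e.target`. -/
def chartVolume {n : ℕ} {X : Type*} [TopologicalSpace X] [ChartedSpace (Euc n) X]
    [MeasurableSpace X] (g : TwoTensor n X) (e : OpenPartialHomeomorph X (Euc n)) : Measure X :=
  (((volume : Measure (Euc n)).restrict e.target).withDensity
    (fun y => ENNReal.ofReal (Real.sqrt (chartMatrix g e y).det))).map e.symm

/-- The Riemannian volume measure `dσ_g`. The measures `chartVolume g e` are the restrictions
of the volume measure to the chart domains, and they agree on overlaps; so the volume measure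
is their least upper bound in the lattice of measures. -/
def volumeMeasure {n : ℕ} {X : Type*} [TopologicalSpace X] [ChartedSpace (Euc n) X]
    [MeasurableSpace X] (g : TwoTensor n X) : Measure X :=
  ⨆ e ∈ atlas (Euc n) X, chartVolume g e

end Manifolds

/-! ### Orbifolds with finitely many isolated singularities -/

/-- The structure of an `n`-dimensional orbifold with finitely many isolated singularities
(possibly none) on a space `M`. -/
structure IsolatedOrbifold (n : ℕ) (M : Type*) [TopologicalSpace M] where
  /-- The set `Σ` of singular points. -/
  sing : Finset M
  /-- `M ∖ Σ` is a smooth manifold of dimension `n`, in the topology induced from `M`. -/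
  chartedSpace : ChartedSpace (Euc n) {x : M // x ∉ sing}
  isManifold : IsManifold 𝓘(ℝ, Euc n) ∞ {x : M // x ∉ sing}
  /-- The structure group `Γ_p < O(n)` of a singular point, a nontrivial finite group
  that acts freely on `ℝⁿ ∖ {0}`. -/
  grp : sing → Subgroup (Euc n ≃ₗᵢ[ℝ] Euc n)
  grp_finite : ∀ p, Finite (grp p)
  grp_nontrivial : ∀ p, Nontrivial (grp p)
  grp_free : ∀ p, ∀ γ ∈ grp p, ∀ x : Euc n, x ≠ 0 → γ x = x → γ = 1
  /-- The radius `τ_p` of the uniformizing ball `B = B_{τ_p}(0)`. -/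
  radius : sing → ℝ
  radius_pos : ∀ p, 0 < radius p
  /-- The map `φ⁻¹ ∘ π : B → B/Γ_p → U_p ⊆ M` (values outside `B` are irrelevant), where
  `φ : U_p → B/Γ_p` is the local uniformization of an open neighbourhood `U_p` of `p`. -/
  unif : sing → Euc n → M
  unif_zero : ∀ p, unif p 0 = p
  /-- `φ⁻¹ ∘ π` is continuous and open and its fibres are the `Γ_p`-orbits; that is, it induces
  a homeomorphism from `B/Γ_p` onto an open subset of `M`. -/
  unif_continuousOn : ∀ p, ContinuousOn (unif p) (Metric.ball 0 (radius p))
  unif_open : ∀ p, ∀ V ⊆ Metric.ball (0 : Euc n) (radius p), IsOpen V → IsOpen (unif p '' V)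
  unif_eq_iff : ∀ p, ∀ x ∈ Metric.ball (0 : Euc n) (radius p),
    ∀ y ∈ Metric.ball (0 : Euc n) (radius p), unif p x = unif p y ↔ ∃ γ ∈ grp p, γ x = y
  /-- `φ⁻¹ ∘ π` on `B ∖ {0}`, as a map into the manifold `M ∖ Σ`. -/
  unifReg : sing → Euc n → {x : M // x ∉ sing}
  unifReg_coe : ∀ p, ∀ x ∈ Metric.ball (0 : Euc n) (radius p), x ≠ 0 →
    (unifReg p x : M) = unif p x
  /-- `φ` is a diffeomorphism from `U_p ∖ {p}` onto `(B ∖ {0})/Γ_p`, whose smooth structure is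
  the one for which the projection from `B ∖ {0}` is a local diffeomorphism. -/
  unifReg_diffeo : ∀ p, IsLocalDiffeomorphOn 𝓘(ℝ, Euc n) 𝓘(ℝ, Euc n) ∞ (unifReg p)
    (Metric.ball 0 (radius p) \ {0})

namespace IsolatedOrbifold

/-- The regular part `M ∖ Σ`. -/
abbrev Reg {n : ℕ} {M : Type*} [TopologicalSpace M] (O : IsolatedOrbifold n M) : Type _ :=
  {x : M // x ∉ O.sing}

instance {n : ℕ} {M : Type*} [TopologicalSpace M] (O : IsolatedOrbifold n M) :
    ChartedSpace (Euc n) O.Reg := O.chartedSpace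

instance {n : ℕ} {M : Type*} [TopologicalSpace M] (O : IsolatedOrbifold n M) :
    IsManifold 𝓘(ℝ, Euc n) ∞ O.Reg := O.isManifold

/-- `h'` is a smooth `Γ_p`-invariant 2-tensor on the whole uniformizing ball at `p` that agrees
with the pullback of `h` off the origin. -/
def IsSmoothLift {n : ℕ} {M : Type*} [TopologicalSpace M] (O : IsolatedOrbifold n M)
    (h : TwoTensor n O.Reg) (p : O.sing) (h' : Euc n → Euc n →L[ℝ] Euc n →L[ℝ] ℝ) : Prop :=
  ContDiffOn ℝ ∞ h' (Metric.ball 0 (O.radius p)) ∧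
  (∀ γ ∈ O.grp p, ∀ x ∈ Metric.ball (0 : Euc n) (O.radius p), ∀ u v : Euc n,
    h' (γ x) (γ u) (γ v) = h' x u v) ∧
  ∀ x ∈ Metric.ball (0 : Euc n) (O.radius p), x ≠ 0 → ∀ u v : Euc n,
    pullback (O.unifReg p) h x u v = h' x u v

/-- Symmetric orbifold 2-tensors: smooth symmetric 2-tensors on `M ∖ Σ` whose pullbacks to the
uniformizing balls extend smoothly across the origin. -/
def symTensors {n : ℕ} {M : Type*} [TopologicalSpace M] (O : IsolatedOrbifold n M) :
    Set (TwoTensor n O.Reg) :=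
  {h | SmoothTensor h ∧ (∀ x u v, h x u v = h x v u) ∧ ∀ p, ∃ h', O.IsSmoothLift h p h' ∧
    ∀ x ∈ Metric.ball (0 : Euc n) (O.radius p), ∀ u v : Euc n, h' x u v = h' x v u}

/-- The space `Riem^orb(M)` of orbifold metrics: Riemannian metrics on `M ∖ Σ` whose pullbacks
to the uniformizing balls extend to smooth `Γ_p`-invariant Riemannian metrics on these balls. -/
def metrics {n : ℕ} {M : Type*} [TopologicalSpace M] (O : IsolatedOrbifold n M) :
    Set (TwoTensor n O.Reg) :=
  {g | SmoothTensor g ∧ (∀ x u v, g x u v = g x v u) ∧ (∀ x u, u ≠ 0 → 0 < g x u u) ∧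
    ∀ p, ∃ g', O.IsSmoothLift g p g' ∧
      ∀ x ∈ Metric.ball (0 : Euc n) (O.radius p),
        (∀ u v : Euc n, g' x u v = g' x v u) ∧ ∀ u : Euc n, u ≠ 0 → 0 < g' x u u}

/-- The normalized Einstein–Hilbert functional
`I(g) = (∫_M R_g dσ_g) / Vol_g(M)^{(n-2)/n}`, where the finite set `Σ` does not contribute to
the integrals. The formula is written for all 2-tensors, but is meaningful for metrics only. -/
def einsteinHilbert {n : ℕ} {M : Type*} [TopologicalSpace M] [MeasurableSpace M]
    (O : IsolatedOrbifold n M) (g : TwoTensor n O.Reg) : ℝ :=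
  (∫ x, scalarCurvature g x ∂(volumeMeasure g)) /
    (volumeMeasure g).real Set.univ ^ (((n : ℝ) - 2) / (n : ℝ))

/-- The critical points of `I : Riem^orb(M) → ℝ`: the orbifold metrics `g` at which the derivative
of `I` exists and vanishes in the direction of every symmetric orbifold 2-tensor `h`. (If `M` is
compact then `g + t h` is again an orbifold metric for all small `t`.) -/
def criticalPoints {n : ℕ} {M : Type*} [TopologicalSpace M] [MeasurableSpace M]
    (O : IsolatedOrbifold n M) : Set (TwoTensor n O.Reg) :=
  {g | g ∈ O.metrics ∧
    ∀ h ∈ O.symTensors, HasDerivAt (fun t : ℝ => O.einsteinHilbert (g + t • h)) 0 0}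

/-- The Einstein orbifold metrics: the orbifold metrics with `Ric_g = c g` on `M ∖ Σ` for some
constant `c`. -/
def einsteinMetrics {n : ℕ} {M : Type*} [TopologicalSpace M] (O : IsolatedOrbifold n M) :
    Set (TwoTensor n O.Reg) :=
  {g | g ∈ O.metrics ∧ ∃ c : ℝ, ∀ x u v, ricci g x u v = c * g x u v}

end IsolatedOrbifold

end EHOrbifold

end

open scoped Manifold ContDiff Topology Bundle
open MeasureTheory

noncomputable section

namespace EHOrbifold

/-! In coordinates, the derivative of the density R√det in a direction h is a divergence minus √det
times the pairing of h with the Einstein tensor Ric − (R/2)g (`hasDerivAt_lagrangian`, resting on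
the Palatini identity `sum_invDensity_mul_dRicci`). Once the divergence is known to integrate to
zero, the quotient rule gives, with V the volume and r the mean of R, I'(h) = −V^(−(n−2)/n) ∫ ⟨T, h⟩
dσ, where T = Ric − (R/2)g + ((n−2)/(2n)) r g. This is `hasDerivAt_einsteinHilbert`.

If Ric = cg, then R = r = nc and T = 0. Conversely, a critical metric can be tested against h = φT
with φ smooth and compactly supported in M∖Σ, so ⟨T, T⟩ = 0 and hence T = 0
(`eq_zero_of_trace_pairing_self`). The trace of T = 0 reads (n−2)(R − r) = 0; for n ≥ 3 the scalar
curvature is the constant r, and Ric is a constant multiple of g. The contracted Bianchi identity is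
not needed, because the normalization already places the constant r in the gradient.

The singular points matter for the analysis only, and are treated in the uniformizing balls, where
metric and variation extend smoothly over the origin. There the volume is locally finite, and the
densities of g + th have uniform C¹ bounds in t; compactness of M makes the bounds global
(`uniformlyVaries_univ`) and justifies differentiating under the integral. For the divergence, h is
cut into pieces. A piece near p lifts to the ball, where its integral is |Γ_p| times the integral on
M, and the divergence theorem on ℝⁿ sees nothing special at the origin (`integral_divTerm_cutoff`).
The remaining piece has compact support in M∖Σ and yields to a partition of unity
(`integral_divTerm_of_compact`).

All of this requires R, Ric and dσ, which are defined through charts, to be computable in any local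
diffeomorphism from ℝⁿ, in particular in `unifReg`. Tensoriality of the curvature follows from
uniqueness of the Levi-Civita connection (`chrMat_unique`, `jac_mul_curvMat`), and that of the
volume from the change of variables formula (`volumeMeasure_apply`). -/

/-! ### Calculus of partial derivatives and matrix-valued functions -/

section Calculus

variable {n : ℕ} {F : Type*} [NormedAddCommGroup F] [NormedSpace ℝ F]

/-- The standard basis vectors of `ℝⁿ`. -/
abbrev stdVec (i : Fin n) : Euc n := EuclideanSpace.single i 1

lemma euc_eq_sum (v : Euc n) : v = ∑ a, v a • stdVec a := by
  ext i
  simp [stdVec, Finset.sum_apply, Pi.single_apply]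

lemma clm_apply_eq_sum {V : Type*} [NormedAddCommGroup V] [NormedSpace ℝ V]
    (T : Euc n →L[ℝ] V) (v : Euc n) : T v = ∑ a, v a • T (stdVec a) := by
  conv_lhs => rw [euc_eq_sum v]
  simp

lemma pd_congr {f g : Euc n → ℝ} {y : Euc n} (h : f =ᶠ[𝓝 y] g) (k : Fin n) :
    pd k f y = pd k g y := by
  simp only [pd, h.fderiv_eq]

lemma pd_const (k : Fin n) (c : ℝ) (y : Euc n) : pd k (fun _ => c) y = 0 := by
  simp [pd]

lemma pd_add {f g : Euc n → ℝ} {y : Euc n} (hf : DifferentiableAt ℝ f y)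
    (hg : DifferentiableAt ℝ g y) (k : Fin n) :
    pd k (fun z => f z + g z) y = pd k f y + pd k g y := by
  simp [pd, fderiv_fun_add hf hg]

lemma pd_sub {f g : Euc n → ℝ} {y : Euc n} (hf : DifferentiableAt ℝ f y)
    (hg : DifferentiableAt ℝ g y) (k : Fin n) :
    pd k (fun z => f z - g z) y = pd k f y - pd k g y := by
  simp [pd, fderiv_fun_sub hf hg]

lemma pd_mul {f g : Euc n → ℝ} {y : Euc n} (hf : DifferentiableAt ℝ f y)
    (hg : DifferentiableAt ℝ g y) (k : Fin n) :
    pd k (fun z => f z * g z) y = pd k f y * g y + f y * pd k g y := by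
  simp [pd, fderiv_fun_mul hf hg]; ring

lemma pd_const_mul {f : Euc n → ℝ} {y : Euc n} (hf : DifferentiableAt ℝ f y)
    (c : ℝ) (k : Fin n) : pd k (fun z => c * f z) y = c * pd k f y := by
  rw [pd_mul (differentiableAt_const c) hf, pd_const]; ring

lemma pd_sum {ι : Type*} {s : Finset ι} {f : ι → Euc n → ℝ} {y : Euc n}
    (hf : ∀ i ∈ s, DifferentiableAt ℝ (f i) y) (k : Fin n) :
    pd k (fun z => ∑ i ∈ s, f i z) y = ∑ i ∈ s, pd k (f i) y := by
  simp [pd, fderiv_fun_sum hf]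

lemma pd_comp {f : Euc n → ℝ} {τ : Euc n → Euc n} {y : Euc n}
    (hf : DifferentiableAt ℝ f (τ y)) (hτ : DifferentiableAt ℝ τ y) (k : Fin n) :
    pd k (fun z => f (τ z)) y = ∑ a, pd k (fun z => τ z a) y * pd a f (τ y) := by
  have h1 : fderiv ℝ (fun z => f (τ z)) y = (fderiv ℝ f (τ y)).comp (fderiv ℝ τ y) :=
    fderiv_comp y hf hτ
  have h2 (a : Fin n) : pd k (fun z => τ z a) y = fderiv ℝ τ y (stdVec k) a := by
    have := ((EuclideanSpace.proj (𝕜 := ℝ) a).hasFDerivAt.comp y hτ.hasFDerivAt).fderiv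
    simp only [pd]
    erw [this]
    rfl
  simp only [h2]
  simp only [pd, h1, ContinuousLinearMap.comp_apply]
  rw [clm_apply_eq_sum (fderiv ℝ f (τ y))]
  rfl

lemma ContDiffAt.differentiableAt_top {V : Type*} [NormedAddCommGroup V] [NormedSpace ℝ V]
    {f : F → V} {y : F} (h : ContDiffAt ℝ ∞ f y) :
    DifferentiableAt ℝ f y := h.differentiableAt (by simp)

lemma ContDiffAt.eventually_differentiableAt {V : Type*} [NormedAddCommGroup V]
    [NormedSpace ℝ V] {f : F → V} {y : F} (h : ContDiffAt ℝ ∞ f y) :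
    ∀ᶠ z in 𝓝 y, DifferentiableAt ℝ f z := by
  filter_upwards [(h.of_le (m := 1) (by simp)).eventually (by simp)] with z hz
  exact hz.differentiableAt (by simp)

lemma contDiffAt_pd {f : Euc n → ℝ} {y : Euc n} (h : ContDiffAt ℝ ∞ f y) (k : Fin n) :
    ContDiffAt ℝ ∞ (pd k f) y :=
  (h.fderiv_right (m := ∞) (by simp)).clm_apply contDiffAt_const

lemma two_le_infty : (2 : ℕ∞ω) ≤ ∞ := by
  have h : ((2 : ℕ∞) : ℕ∞ω) ≤ ((⊤ : ℕ∞) : ℕ∞ω) := WithTop.coe_le_coe.2 le_top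
  exact h

lemma pd_comm {f : Euc n → ℝ} {y : Euc n} (h : ContDiffAt ℝ ∞ f y) (i j : Fin n) :
    pd i (pd j f) y = pd j (pd i f) y := by
  have hs : IsSymmSndFDerivAt ℝ f y := h.isSymmSndFDerivAt (by simpa using two_le_infty)
  have key (i j : Fin n) : pd i (pd j f) y = fderiv ℝ (fderiv ℝ f) y (stdVec i) (stdVec j) := by
    have hd : DifferentiableAt ℝ (fderiv ℝ f) y :=
      ContDiffAt.differentiableAt_top (h.fderiv_right (m := ∞) (by simp))
    have := fderiv_clm_apply hd (differentiableAt_const (stdVec j))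
    change fderiv ℝ (fun z => fderiv ℝ f z (stdVec j)) y (stdVec i) = _
    rw [this]
    simp
  rw [key, key, hs.eq]

/-! Functions of a real parameter and a point. -/

lemma pd_slice {f : ℝ × Euc n → ℝ} {t : ℝ} {y : Euc n} (h : DifferentiableAt ℝ f (t, y))
    (k : Fin n) : pd k (fun z => f (t, z)) y = fderiv ℝ f (t, y) (0, stdVec k) := by
  have h1 : HasFDerivAt (fun z : Euc n => (t, z)) (ContinuousLinearMap.inr ℝ ℝ (Euc n)) y :=
    hasFDerivAt_prodMk_right t y
  have := (HasFDerivAt.comp y h.hasFDerivAt h1).fderiv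
  simp only [pd]
  erw [this]
  simp

lemma hasDerivAt_slice {f : ℝ × Euc n → ℝ} {t : ℝ} {y : Euc n}
    (h : DifferentiableAt ℝ f (t, y)) :
    HasDerivAt (fun s => f (s, y)) (fderiv ℝ f (t, y) (1, 0)) t := by
  have h1 : HasDerivAt (fun s : ℝ => (s, y)) ((1 : ℝ), (0 : Euc n)) t :=
    (hasDerivAt_id t).prodMk (hasDerivAt_const t y)
  exact h.hasFDerivAt.comp_hasDerivAt t h1

lemma contDiffAt_pd_slice {f : ℝ × Euc n → ℝ} {q : ℝ × Euc n} (h : ContDiffAt ℝ ∞ f q)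
    (k : Fin n) : ContDiffAt ℝ ∞ (fun p : ℝ × Euc n => pd k (fun z => f (p.1, z)) p.2) q := by
  have : (fun p : ℝ × Euc n => pd k (fun z => f (p.1, z)) p.2) =ᶠ[𝓝 q]
      fun p => fderiv ℝ f p (0, stdVec k) := by
    filter_upwards [ContDiffAt.eventually_differentiableAt h] with p hp
    exact pd_slice hp k
  exact ((h.fderiv_right (m := ∞) (by simp)).clm_apply contDiffAt_const).congr_of_eventuallyEq this

/-- Symmetry of the second derivative on ℝ × ℝⁿ, in the directions (1, 0) and (0, e_k). It lets the
variation in t pass through the spatial derivatives in the curvature formula. -/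
lemma hasDerivAt_pd_slice {f : ℝ × Euc n → ℝ} {t : ℝ} {y : Euc n}
    (h : ContDiffAt ℝ ∞ f (t, y)) (k : Fin n) :
    HasDerivAt (fun s => pd k (fun z => f (s, z)) y)
      (pd k (fun z => deriv (fun s => f (s, z)) t) y) t := by
  have hs : IsSymmSndFDerivAt ℝ f (t, y) := h.isSymmSndFDerivAt (by simpa using two_le_infty)
  have hd : DifferentiableAt ℝ (fderiv ℝ f) (t, y) :=
    ContDiffAt.differentiableAt_top (h.fderiv_right (m := ∞) (by simp))
  have h1 := hasDerivAt_slice (ContDiffAt.differentiableAt_top (contDiffAt_pd_slice h k))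
  convert h1 using 1
  have e1 : (fun p : ℝ × Euc n => pd k (fun z => f (p.1, z)) p.2) =ᶠ[𝓝 (t, y)]
      fun p => fderiv ℝ f p (0, stdVec k) := by
    filter_upwards [ContDiffAt.eventually_differentiableAt h] with p hp
    exact pd_slice hp k
  have e2 : (fun z => deriv (fun s => f (s, z)) t) =ᶠ[𝓝 y] fun z => fderiv ℝ f (t, z) (1, 0) := by
    have hc : Filter.Tendsto (fun z : Euc n => (t, z)) (𝓝 y) (𝓝 (t, y)) :=
      (Continuous.prodMk_right t).tendsto y
    filter_upwards [hc.eventually (ContDiffAt.eventually_differentiableAt h)] with z hz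
    exact (hasDerivAt_slice hz).deriv
  rw [e1.fderiv_eq, pd_congr e2, fderiv_clm_apply hd (differentiableAt_const _)]
  have hd' : DifferentiableAt ℝ (fun p => fderiv ℝ f p (1, 0)) (t, y) :=
    hd.clm_apply (differentiableAt_const _)
  rw [pd_slice (f := fun p => fderiv ℝ f p (1, 0)) hd', fderiv_clm_apply hd (differentiableAt_const _)]
  simp [hs.eq (0, stdVec k)]

end Calculus

/-! ### Smooth matrix-valued functions; derivatives of determinants and inverses. -/

section MatrixCalculus

variable {n : ℕ} {F : Type*} [NormedAddCommGroup F] [NormedSpace ℝ F]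

/-- A matrix-valued function whose entries are smooth at a point. -/
def MatSmoothAt (A : F → Matrix (Fin n) (Fin n) ℝ) (x : F) : Prop :=
  ∀ i j, ContDiffAt ℝ ∞ (fun z => A z i j) x

namespace MatSmoothAt

variable {A B : F → Matrix (Fin n) (Fin n) ℝ} {x : F}

lemma congr (h : MatSmoothAt A x) (hAB : B =ᶠ[𝓝 x] A) : MatSmoothAt B x := fun i j =>
  (h i j).congr_of_eventuallyEq (hAB.mono fun z hz => by simp [hz])

lemma const (M : Matrix (Fin n) (Fin n) ℝ) : MatSmoothAt (fun _ : F => M) x :=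
  fun _ _ => contDiffAt_const

lemma add (hA : MatSmoothAt A x) (hB : MatSmoothAt B x) :
    MatSmoothAt (fun z => A z + B z) x := fun i j => (hA i j).add (hB i j)

lemma smul {φ : F → ℝ} (hφ : ContDiffAt ℝ ∞ φ x) (hA : MatSmoothAt A x) :
    MatSmoothAt (fun z => φ z • A z) x := fun i j => hφ.mul (hA i j)

lemma mul (hA : MatSmoothAt A x) (hB : MatSmoothAt B x) :
    MatSmoothAt (fun z => A z * B z) x := fun i j => by
  simp only [Matrix.mul_apply]
  exact ContDiffAt.sum fun k _ => (hA i k).mul (hB k j)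

lemma transpose (hA : MatSmoothAt A x) : MatSmoothAt (fun z => (A z).transpose) x :=
  fun i j => hA j i

lemma comp {V : Type*} [NormedAddCommGroup V] [NormedSpace ℝ V] {τ : V → F} {y : V}
    (hA : MatSmoothAt A (τ y)) (hτ : ContDiffAt ℝ ∞ τ y) : MatSmoothAt (fun z => A (τ z)) y :=
  fun i j => (hA i j).comp y hτ

lemma trace (hA : MatSmoothAt A x) : ContDiffAt ℝ ∞ (fun z => (A z).trace) x := by
  simp only [Matrix.trace, Matrix.diag]
  exact ContDiffAt.sum fun i _ => hA i i

lemma det (hA : MatSmoothAt A x) : ContDiffAt ℝ ∞ (fun z => (A z).det) x := by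
  simp only [Matrix.det_apply']
  exact ContDiffAt.sum fun σ _ => contDiffAt_const.mul (contDiffAt_prod fun i _ => hA _ _)

lemma inv (hA : MatSmoothAt A x) (hx : (A x).det ≠ 0) : MatSmoothAt (fun z => (A z)⁻¹) x := by
  intro i j
  simp only [Matrix.inv_def, Ring.inverse_eq_inv', Matrix.smul_apply, smul_eq_mul,
    Matrix.adjugate_apply]
  refine (hA.det.inv hx).mul (MatSmoothAt.det ?_)
  intro a b
  simp only [Matrix.updateRow_apply]
  split_ifs
  · exact contDiffAt_const
  · exact hA a b

lemma sqrt_det (hA : MatSmoothAt A x) (hx : (A x).det ≠ 0) :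
    ContDiffAt ℝ ∞ (fun z => √(A z).det) x := hA.det.sqrt hx

lemma eventually_det_ne (hA : MatSmoothAt A x) (hx : (A x).det ≠ 0) :
    ∀ᶠ z in 𝓝 x, (A z).det ≠ 0 := hA.det.continuousAt.eventually_ne hx

end MatSmoothAt

/-- Jacobi's formula. -/
lemma hasDerivAt_det {A : ℝ → Matrix (Fin n) (Fin n) ℝ} {A' : Matrix (Fin n) (Fin n) ℝ} {t : ℝ}
    (h : ∀ i j, HasDerivAt (fun s => A s i j) (A' i j) t) :
    HasDerivAt (fun s => (A s).det) (((A t).adjugate * A').trace) t := by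
  have h1 : HasDerivAt (fun s => (A s).det)
      (∑ σ : Equiv.Perm (Fin n), ((Equiv.Perm.sign σ : ℤ) : ℝ) *
        ∑ j, (∏ i ∈ Finset.univ.erase j, A t (σ i) i) • A' (σ j) j) t := by
    simp only [Matrix.det_apply']
    exact HasDerivAt.fun_sum fun σ _ =>
      (HasDerivAt.fun_finsetProd fun i _ => h (σ i) i).const_mul _
  convert h1 using 1
  -- Cramer's rule: the j-th diagonal entry is the determinant with column j replaced by that of A',
  -- which is what the Leibniz expansion of the derivative produces for each j.
  have h2 (j : Fin n) : ((A t).adjugate * A') j j = ((A t).updateCol j (fun i => A' i j)).det := by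
    rw [← Matrix.cramer_apply, Matrix.cramer_eq_adjugate_mulVec]
    rfl
  simp only [Matrix.trace, Matrix.diag, h2, Matrix.det_apply', Finset.mul_sum]
  rw [Finset.sum_comm]
  refine Finset.sum_congr rfl fun σ _ => Finset.sum_congr rfl fun j _ => ?_
  rw [← Finset.mul_prod_erase _ _ (Finset.mem_univ j), Matrix.updateCol_self, smul_eq_mul,
    mul_comm (A' (σ j) j)]
  congr 2
  refine Finset.prod_congr rfl fun i hi => ?_
  rw [Matrix.updateCol_ne (Finset.ne_of_mem_erase hi)]

lemma trace_adjugate_mul {A B : Matrix (Fin n) (Fin n) ℝ} (hA : A.det ≠ 0) :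
    (A.adjugate * B).trace = A.det * (A⁻¹ * B).trace := by
  rw [Matrix.inv_def, Ring.inverse_eq_inv', Matrix.smul_mul, Matrix.trace_smul, smul_eq_mul,
    ← mul_assoc, mul_inv_cancel₀ hA, one_mul]

/-- The derivative of `√det`. -/
lemma hasDerivAt_sqrt_det {A : ℝ → Matrix (Fin n) (Fin n) ℝ} {A' : Matrix (Fin n) (Fin n) ℝ}
    {t : ℝ} (h : ∀ i j, HasDerivAt (fun s => A s i j) (A' i j) t) (hA : 0 < (A t).det) :
    HasDerivAt (fun s => √(A s).det) (1 / 2 * √(A t).det * ((A t)⁻¹ * A').trace) t := by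
  convert (hasDerivAt_det h).sqrt hA.ne' using 1
  rw [trace_adjugate_mul hA.ne']
  have hs : √(A t).det ≠ 0 := (Real.sqrt_pos.2 hA).ne'
  field_simp
  rw [Real.sq_sqrt hA.le, mul_comm]

/-- The derivative of the inverse matrix. -/
lemma hasDerivAt_inv {A : ℝ → Matrix (Fin n) (Fin n) ℝ} {A' : Matrix (Fin n) (Fin n) ℝ} {t : ℝ}
    (h : ∀ i j, HasDerivAt (fun s => A s i j) (A' i j) t) (hA : (A t).det ≠ 0) (i j : Fin n) :
    HasDerivAt (fun s => (A s)⁻¹ i j) (-((A t)⁻¹ * A' * (A t)⁻¹) i j) t := by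
  have hdet := hasDerivAt_det h
  -- The cofactor formula shows only that the entries are differentiable; the value of the
  -- derivative then comes from differentiating A A⁻¹ = 1.
  have hex : ∀ i j, ∃ d, HasDerivAt (fun s => (A s)⁻¹ i j) d t := by
    intro i j
    simp only [Matrix.inv_def, Ring.inverse_eq_inv', Matrix.smul_apply, smul_eq_mul,
      Matrix.adjugate_apply]
    -- A cofactor is the determinant of A with row j replaced by a constant basis vector, so row j
    -- of the derivative is 0.
    refine ⟨_, (hdet.inv hA).mul (hasDerivAt_det
      (A' := A'.updateRow j 0) ?_)⟩
    intro a b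
    simp only [Matrix.updateRow_apply]
    split_ifs
    · exact hasDerivAt_const _ _
    · exact h a b
  choose D hD using hex
  have hne : ∀ᶠ s in 𝓝 t, (A s).det ≠ 0 := hdet.continuousAt.eventually_ne hA
  have key : A' * (A t)⁻¹ + A t * Matrix.of D = 0 := by
    ext a b
    have h1 : HasDerivAt (fun s => (A s * (A s)⁻¹) a b)
        ((A' * (A t)⁻¹ + A t * Matrix.of D) a b) t := by
      simp only [Matrix.mul_apply, Matrix.add_apply, ← Finset.sum_add_distrib]
      exact HasDerivAt.fun_sum fun k _ => (h a k).mul (hD k b)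
    have h2 : (fun s => (A s * (A s)⁻¹) a b) =ᶠ[𝓝 t] fun _ => (1 : Matrix (Fin n) (Fin n) ℝ) a b := by
      filter_upwards [hne] with s hs
      rw [Matrix.mul_nonsing_inv _ (isUnit_iff_ne_zero.2 hs)]
    exact h1.unique ((hasDerivAt_const t _).congr_of_eventuallyEq h2)
  have hD' : Matrix.of D = -((A t)⁻¹ * A' * (A t)⁻¹) := by
    have := congrArg ((A t)⁻¹ * ·) key
    simp only [mul_add, Matrix.mul_zero] at this
    rw [← mul_assoc, ← mul_assoc, Matrix.nonsing_inv_mul _ (isUnit_iff_ne_zero.2 hA), one_mul] at this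
    exact eq_neg_of_add_eq_zero_right this
  have := congrFun (congrFun hD' i) j
  simp only [Matrix.of_apply, Matrix.neg_apply] at this
  rw [← this]
  exact hD i j

end MatrixCalculus

/-! ### Christoffel symbols and curvature in coordinates -/

section CoordinateGeometry

variable {n : ℕ} {A B : Euc n → Matrix (Fin n) (Fin n) ℝ} {y : Euc n}

/-- The entrywise partial derivative of a matrix-valued function. -/
def matPd (k : Fin n) (A : Euc n → Matrix (Fin n) (Fin n) ℝ) (y : Euc n) :
    Matrix (Fin n) (Fin n) ℝ :=
  Matrix.of fun i j => pd k (fun z => A z i j) y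

/-- The Jacobian matrix. -/
def jac (τ : Euc n → Euc n) (y : Euc n) : Matrix (Fin n) (Fin n) ℝ :=
  Matrix.of fun a i => pd i (fun z => τ z a) y

lemma matPd_congr (h : A =ᶠ[𝓝 y] B) (k : Fin n) : matPd k A y = matPd k B y := by
  ext i j
  exact pd_congr (h.mono fun z hz => by simp [hz]) k

lemma MatSmoothAt.matPd (hA : MatSmoothAt A y) (k : Fin n) : MatSmoothAt (matPd k A) y :=
  fun i j => contDiffAt_pd (hA i j) k

lemma MatSmoothAt.diff (hA : MatSmoothAt A y) (i j : Fin n) :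
    DifferentiableAt ℝ (fun z => A z i j) y := ContDiffAt.differentiableAt_top (hA i j)

lemma MatSmoothAt.sum {ι : Type*} {s : Finset ι} {f : ι → Euc n → Matrix (Fin n) (Fin n) ℝ}
    (h : ∀ a ∈ s, MatSmoothAt (f a) y) : MatSmoothAt (fun z => ∑ a ∈ s, f a z) y := fun i j => by
  simp only [Matrix.sum_apply]
  exact ContDiffAt.sum fun a ha => h a ha i j

lemma matPd_add (hA : MatSmoothAt A y) (hB : MatSmoothAt B y) (k : Fin n) :
    matPd k (fun z => A z + B z) y = matPd k A y + matPd k B y := by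
  ext i j
  exact pd_add (hA.diff i j) (hB.diff i j) k

lemma matPd_mul (hA : MatSmoothAt A y) (hB : MatSmoothAt B y) (k : Fin n) :
    matPd k (fun z => A z * B z) y = matPd k A y * B y + A y * matPd k B y := by
  ext i j
  simp only [matPd, Matrix.of_apply, Matrix.mul_apply, Matrix.add_apply, ← Finset.sum_add_distrib]
  rw [pd_sum (f := fun l z => A z i l * B z l j) fun l _ => (hA.diff i l).mul (hB.diff l j)]
  exact Finset.sum_congr rfl fun l _ => pd_mul (hA.diff i l) (hB.diff l j) k

lemma matPd_smul {φ : Euc n → ℝ} (hφ : DifferentiableAt ℝ φ y) (hA : MatSmoothAt A y)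
    (k : Fin n) : matPd k (fun z => φ z • A z) y = pd k φ y • A y + φ y • matPd k A y := by
  ext i j
  exact pd_mul hφ (hA.diff i j) k

lemma matPd_sum {ι : Type*} {s : Finset ι} {f : ι → Euc n → Matrix (Fin n) (Fin n) ℝ}
    (h : ∀ a ∈ s, MatSmoothAt (f a) y) (k : Fin n) :
    matPd k (fun z => ∑ a ∈ s, f a z) y = ∑ a ∈ s, matPd k (f a) y := by
  ext i j
  simp only [matPd, Matrix.of_apply, Matrix.sum_apply]
  exact pd_sum (fun a ha => (h a ha).diff i j) k

lemma matPd_transpose (k : Fin n) :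
    matPd k (fun z => (A z).transpose) y = (matPd k A y).transpose := rfl

lemma matPd_comp {τ : Euc n → Euc n} (hA : MatSmoothAt A (τ y)) (hτ : DifferentiableAt ℝ τ y)
    (k : Fin n) : matPd k (fun z => A (τ z)) y = ∑ a, jac τ y a k • matPd a A (τ y) := by
  ext i j
  simp only [matPd, jac, Matrix.of_apply, Matrix.sum_apply, Matrix.smul_apply, smul_eq_mul]
  exact pd_comp (hA.diff i j) hτ k

lemma hasDerivAt_line {f : Euc n → ℝ} (hf : DifferentiableAt ℝ f y) (k : Fin n) :
    HasDerivAt (fun s : ℝ => f (y + s • stdVec k)) (pd k f y) 0 :=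
  hf.hasFDerivAt.hasLineDerivAt (stdVec k)

/-- `G` is the coordinate matrix of a (nondegenerate) metric near `y`. -/
structure MetricAt (G : Euc n → Matrix (Fin n) (Fin n) ℝ) (y : Euc n) : Prop where
  smooth : ∀ᶠ z in 𝓝 y, MatSmoothAt G z
  symm : ∀ᶠ z in 𝓝 y, (G z).IsSymm
  det_pos : 0 < (G y).det

/-- The matrix `(Γ^a_kb)_{ab}` of the connection in the direction `k`. -/
def chrMat (G : Euc n → Matrix (Fin n) (Fin n) ℝ) (k : Fin n) (y : Euc n) :
    Matrix (Fin n) (Fin n) ℝ :=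
  Matrix.of fun a b => christoffel G a k b y

/-- The Ricci tensor as a matrix. -/
def ricMat (G : Euc n → Matrix (Fin n) (Fin n) ℝ) (y : Euc n) : Matrix (Fin n) (Fin n) ℝ :=
  Matrix.of fun i j => coordRicci G i j y

/-- The curvature endomorphism of the connection in the directions `i`, `j`. -/
def curvMat (G : Euc n → Matrix (Fin n) (Fin n) ℝ) (i j : Fin n) (y : Euc n) :
    Matrix (Fin n) (Fin n) ℝ :=
  matPd i (chrMat G j) y - matPd j (chrMat G i) y + chrMat G i y * chrMat G j y
    - chrMat G j y * chrMat G i y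

variable {G G' : Euc n → Matrix (Fin n) (Fin n) ℝ}

lemma christoffel_congr (h : G =ᶠ[𝓝 y] G') (k i j : Fin n) :
    christoffel G k i j y = christoffel G' k i j y := by
  have e (a b : Fin n) : (fun z => G z a b) =ᶠ[𝓝 y] fun z => G' z a b :=
    h.mono fun z hz => by simp [hz]
  simp only [christoffel, h.self_of_nhds, pd_congr (e _ _)]

lemma christoffel_eventuallyEq (h : G =ᶠ[𝓝 y] G') (k i j : Fin n) :
    christoffel G k i j =ᶠ[𝓝 y] christoffel G' k i j :=
  h.eventuallyEq_nhds.mono fun _ hz => christoffel_congr hz k i j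

lemma coordRicci_congr (h : G =ᶠ[𝓝 y] G') (i j : Fin n) :
    coordRicci G i j y = coordRicci G' i j y := by
  simp only [coordRicci, christoffel_congr h, pd_congr (christoffel_eventuallyEq h _ _ _)]

lemma coordScalar_congr (h : G =ᶠ[𝓝 y] G') : coordScalar G y = coordScalar G' y := by
  simp only [coordScalar, coordRicci_congr h, h.self_of_nhds]

lemma ricMat_congr (h : G =ᶠ[𝓝 y] G') : ricMat G y = ricMat G' y := by
  ext i j
  exact coordRicci_congr h i j

namespace MetricAt

lemma congr (hG : MetricAt G y) (h : G' =ᶠ[𝓝 y] G) : MetricAt G' y where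
  smooth := by
    filter_upwards [hG.smooth, h.eventuallyEq_nhds] with z hz hz' using hz.congr hz'
  symm := by
    filter_upwards [hG.symm, h] with z hz hz'
    rwa [hz']
  det_pos := by rw [h.self_of_nhds]; exact hG.det_pos

lemma smoothAt (hG : MetricAt G y) : MatSmoothAt G y := hG.smooth.self_of_nhds

lemma symmAt (hG : MetricAt G y) : (G y).IsSymm := hG.symm.self_of_nhds

lemma det_ne (hG : MetricAt G y) : (G y).det ≠ 0 := hG.det_pos.ne'

lemma isUnit (hG : MetricAt G y) : IsUnit (G y).det := isUnit_iff_ne_zero.2 hG.det_ne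

lemma eventually (hG : MetricAt G y) : ∀ᶠ z in 𝓝 y, MetricAt G z := by
  filter_upwards [hG.smooth.eventually_nhds, hG.symm.eventually_nhds,
    hG.smoothAt.det.continuousAt.eventually (lt_mem_nhds hG.det_pos)] with z h1 h2 h3
  exact ⟨h1, h2, h3⟩

lemma inv_mul (hG : MetricAt G y) : (G y)⁻¹ * G y = 1 := Matrix.nonsing_inv_mul _ hG.isUnit

lemma mul_inv (hG : MetricAt G y) : G y * (G y)⁻¹ = 1 := Matrix.mul_nonsing_inv _ hG.isUnit

lemma inv_symm (hG : MetricAt G y) : ((G y)⁻¹).IsSymm := by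
  rw [Matrix.IsSymm, Matrix.transpose_nonsing_inv, hG.symmAt.eq]

lemma pd_symm (hG : MetricAt G y) (k i j : Fin n) :
    pd k (fun z => G z i j) y = pd k (fun z => G z j i) y :=
  pd_congr (hG.symm.mono fun _ hz => hz.apply j i) k

lemma christoffel_symm (hG : MetricAt G y) (k i j : Fin n) :
    christoffel G k i j y = christoffel G k j i y := by
  simp only [christoffel]
  refine congrArg _ (Finset.sum_congr rfl fun l _ => ?_)
  rw [hG.pd_symm l i j]
  ring

lemma contDiffAt_christoffel (hG : MetricAt G y) (k i j : Fin n) :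
    ContDiffAt ℝ ∞ (christoffel G k i j) y := by
  refine contDiffAt_const.mul (ContDiffAt.sum fun l _ => ?_)
  exact (hG.smoothAt.inv hG.det_ne k l).mul
    (((contDiffAt_pd (hG.smoothAt _ _) _).add (contDiffAt_pd (hG.smoothAt _ _) _)).sub
      (contDiffAt_pd (hG.smoothAt _ _) _))

lemma smooth_chrMat (hG : MetricAt G y) (k : Fin n) : MatSmoothAt (chrMat G k) y :=
  fun a b => hG.contDiffAt_christoffel a k b

lemma contDiffAt_coordRicci (hG : MetricAt G y) (i j : Fin n) :
    ContDiffAt ℝ ∞ (coordRicci G i j) y := by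
  have h := hG.contDiffAt_christoffel
  refine ContDiffAt.add (ContDiffAt.sum fun k _ => ?_)
    (ContDiffAt.sum fun k _ => ContDiffAt.sum fun l _ => ?_)
  · exact (contDiffAt_pd (h _ _ _) _).sub (contDiffAt_pd (h _ _ _) _)
  · exact ((h _ _ _).mul (h _ _ _)).sub ((h _ _ _).mul (h _ _ _))

lemma smooth_ricMat (hG : MetricAt G y) : MatSmoothAt (ricMat G) y :=
  hG.contDiffAt_coordRicci

lemma contDiffAt_coordScalar (hG : MetricAt G y) : ContDiffAt ℝ ∞ (coordScalar G) y :=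
  ContDiffAt.sum fun _ _ => ContDiffAt.sum fun _ _ =>
    (hG.smoothAt.inv hG.det_ne _ _).mul (hG.contDiffAt_coordRicci _ _)

/-- The Christoffel symbols of the first kind. -/
lemma mul_chrMat (hG : MetricAt G y) (k i j : Fin n) :
    (G y * chrMat G k y) i j = 1 / 2 * (pd k (fun z => G z j i) y + pd j (fun z => G z k i) y
      - pd i (fun z => G z k j) y) := by
  set v : Fin n → ℝ := fun l => 1 / 2 * (pd k (fun z => G z j l) y + pd j (fun z => G z k l) y
      - pd l (fun z => G z k j) y) with hv
  have h1 : (fun a => chrMat G k y a j) = (G y)⁻¹.mulVec v := by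
    ext a
    simp only [chrMat, Matrix.of_apply, christoffel, Matrix.mulVec, dotProduct, Finset.mul_sum, hv]
    exact Finset.sum_congr rfl fun l _ => by ring
  have h2 : (G y * chrMat G k y) i j = (G y).mulVec (fun a => chrMat G k y a j) i := rfl
  rw [h2, h1, Matrix.mulVec_mulVec, hG.mul_inv, Matrix.one_mulVec]

/-- The Levi-Civita connection is metric. -/
lemma matPd_eq (hG : MetricAt G y) (k : Fin n) :
    matPd k G y = (chrMat G k y).transpose * G y + G y * chrMat G k y := by
  have h1 : (chrMat G k y).transpose * G y = (G y * chrMat G k y).transpose := by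
    rw [Matrix.transpose_mul, hG.symmAt.eq]
  rw [h1]
  ext i j
  rw [Matrix.add_apply, Matrix.transpose_apply, hG.mul_chrMat, hG.mul_chrMat]
  simp only [matPd, Matrix.of_apply]
  rw [hG.pd_symm k j i, hG.pd_symm j k i, hG.pd_symm i k j]
  ring_nf

/-- Uniqueness of the Levi-Civita connection. -/
lemma chrMat_unique (hG : MetricAt G y) {γ : Fin n → Matrix (Fin n) (Fin n) ℝ}
    (hs : ∀ k a b, γ k a b = γ b a k)
    (hm : ∀ k, matPd k G y = (γ k).transpose * G y + G y * γ k) (k : Fin n) :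
    γ k = chrMat G k y := by
  have hL (k i j : Fin n) : (G y * γ k) i j = (G y * γ j) i k := by
    simp only [Matrix.mul_apply]
    exact Finset.sum_congr rfl fun l _ => by rw [hs]
  have hd (k i j : Fin n) :
      pd k (fun z => G z i j) y = (G y * γ k) j i + (G y * γ k) i j := by
    have := congrFun (congrFun (hm k) i) j
    have h1 : (γ k).transpose * G y = (G y * γ k).transpose := by
      rw [Matrix.transpose_mul, hG.symmAt.eq]
    rw [h1] at this
    exact this
  -- Koszul's argument: by `hd` each derivative of G is a sum of two lowered symbols, and by the
  -- symmetry `hL` the combination in `mul_chrMat` keeps twice one of them.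
  have key : G y * γ k = G y * chrMat G k y := by
    ext i j
    rw [hG.mul_chrMat, hd, hd, hd, hL j k i, hL j i k, hL k j i]
    ring
  have := congrArg ((G y)⁻¹ * ·) key
  simpa only [← mul_assoc, hG.inv_mul, one_mul] using this

/-- Jacobi's formula gives half the trace of G⁻¹∂_kG, and metric compatibility turns that trace into
2 tr Γ_k. -/
lemma pd_sqrt_det (hG : MetricAt G y) (k : Fin n) :
    pd k (fun z => √(G z).det) y = √(G y).det * (chrMat G k y).trace := by
  have h1 := hasDerivAt_line (ContDiffAt.differentiableAt_top
    (hG.smoothAt.sqrt_det hG.det_ne)) k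
  have h2 := hasDerivAt_sqrt_det (A := fun s : ℝ => G (y + s • stdVec k)) (A' := matPd k G y)
    (t := 0) (fun i j => hasDerivAt_line (hG.smoothAt.diff i j) k) (by simpa using hG.det_pos)
  rw [h1.unique h2]
  simp only [zero_smul, add_zero]
  rw [hG.matPd_eq, mul_add, Matrix.trace_add, ← mul_assoc, ← mul_assoc, hG.inv_mul, one_mul,
    Matrix.trace_mul_comm, ← mul_assoc, hG.mul_inv, one_mul, Matrix.trace_transpose]
  ring

/-- The inverse metric is parallel too: metric compatibility is substituted into −G⁻¹(∂_kG)G⁻¹. -/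
lemma matPd_inv (hG : MetricAt G y) (k : Fin n) :
    matPd k (fun z => (G z)⁻¹) y
      = -((G y)⁻¹ * (chrMat G k y).transpose + chrMat G k y * (G y)⁻¹) := by
  have h0 : matPd k (fun z => (G z)⁻¹) y = -((G y)⁻¹ * matPd k G y * (G y)⁻¹) := by
    ext i j
    have h1 := hasDerivAt_line ((hG.smoothAt.inv hG.det_ne).diff i j) k
    have h2 := hasDerivAt_inv (A := fun s : ℝ => G (y + s • stdVec k)) (A' := matPd k G y)
      (t := 0) (fun i j => hasDerivAt_line (hG.smoothAt.diff i j) k)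
      (by simpa using hG.det_ne) i j
    have := h1.unique h2
    simp only [zero_smul, add_zero] at this
    exact this
  rw [h0, hG.matPd_eq, mul_add, add_mul, mul_assoc, mul_assoc, hG.mul_inv, mul_one,
    ← mul_assoc (G y)⁻¹ (G y), hG.inv_mul, one_mul]

/-- The derivative of the density `√det G • G⁻¹`. -/
lemma matPd_density (hG : MetricAt G y) (k : Fin n) :
    matPd k (fun z => √(G z).det • (G z)⁻¹) y
      = √(G y).det • ((chrMat G k y).trace • (G y)⁻¹
        - (G y)⁻¹ * (chrMat G k y).transpose - chrMat G k y * (G y)⁻¹) := by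
  rw [matPd_smul (ContDiffAt.differentiableAt_top (hG.smoothAt.sqrt_det hG.det_ne))
    (hG.smoothAt.inv hG.det_ne), hG.pd_sqrt_det, hG.matPd_inv]
  module

/-- Ricci is a trace of the curvature endomorphism, so its transformation law can be read off from
that of `curvMat`, where the computation is one with matrices. -/
lemma ricMat_eq_curvMat (hG : MetricAt G y) (i j : Fin n) :
    ricMat G y i j = ∑ k, curvMat G k j y k i := by
  have hs : ∀ a b c, pd a (christoffel G b c i) y = pd a (christoffel G b i c) y := fun a b c =>
    pd_congr (hG.eventually.mono fun z hz => hz.christoffel_symm b c i) a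
  simp only [ricMat, Matrix.of_apply, coordRicci, curvMat, Matrix.sub_apply, Matrix.add_apply,
    Matrix.mul_apply, matPd, chrMat, ← Finset.sum_add_distrib]
  refine Finset.sum_congr rfl fun k _ => ?_
  rw [add_sub_assoc, ← Finset.sum_sub_distrib]
  congr 1
  · rw [← hs k k j, ← hs j k k]
  · refine Finset.sum_congr rfl fun l _ => ?_
    rw [hG.christoffel_symm l j i, hG.christoffel_symm l k i]

/-- Being a gradient, the traced connection has a symmetric derivative; this is the nontrivial
ingredient in the symmetry of Ricci. -/
lemma trace_chrMat_eq (hG : MetricAt G y) (k : Fin n) :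
    (chrMat G k y).trace = pd k (fun z => Real.log √(G z).det) y := by
  have hs := ContDiffAt.differentiableAt_top (hG.smoothAt.sqrt_det hG.det_ne)
  have hne : √(G y).det ≠ 0 := (Real.sqrt_pos.2 hG.det_pos).ne'
  have h1 := hasDerivAt_line (hs.log hne) k
  have h2 := (hasDerivAt_line hs k).log (by simpa using hne)
  rw [h1.unique h2, hG.pd_sqrt_det]
  simp only [zero_smul, add_zero]
  field_simp

/-- The term ∂_jΓ^k_ik is a Hessian of log √det, hence symmetric; the other terms are symmetric
because Γ is symmetric in its lower indices. -/
lemma ricMat_symm (hG : MetricAt G y) : (ricMat G y).IsSymm := by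
  refine Matrix.IsSymm.ext fun i j => ?_
  have hlog : ContDiffAt ℝ ∞ (fun z => Real.log √(G z).det) y :=
    (hG.smoothAt.sqrt_det hG.det_ne).log (Real.sqrt_pos.2 hG.det_pos).ne'
  have h1 (i j : Fin n) : ∑ k, pd j (christoffel G k i k) y
      = pd j (pd i (fun z => Real.log √(G z).det)) y := by
    rw [← pd_sum fun k _ => ContDiffAt.differentiableAt_top (hG.contDiffAt_christoffel k i k)]
    exact pd_congr (hG.eventually.mono fun z hz => hz.trace_chrMat_eq i) j
  have h2 (k : Fin n) : pd k (christoffel G k j i) y = pd k (christoffel G k i j) y :=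
    pd_congr (hG.eventually.mono fun z hz => hz.christoffel_symm k j i) k
  simp only [ricMat, Matrix.of_apply, coordRicci, Finset.sum_sub_distrib, h1, h2]
  rw [pd_comm hlog j i]
  congr 2
  · refine Finset.sum_congr rfl fun k _ => Finset.sum_congr rfl fun l _ => ?_
    rw [hG.christoffel_symm l j i]
  · rw [Finset.sum_comm]
    refine Finset.sum_congr rfl fun k _ => Finset.sum_congr rfl fun l _ => ?_
    ring

lemma coordScalar_eq_trace (hG : MetricAt G y) :
    coordScalar G y = ((G y)⁻¹ * ricMat G y).trace := by
  simp only [coordScalar, Matrix.trace, Matrix.diag, Matrix.mul_apply]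
  refine Finset.sum_congr rfl fun i _ => Finset.sum_congr rfl fun j _ => ?_
  rw [hG.ricMat_symm.apply i j]
  rfl

end MetricAt

end CoordinateGeometry

/-! ### Behaviour under coordinate changes -/

section CoordinateChange

variable {n : ℕ} {G : Euc n → Matrix (Fin n) (Fin n) ℝ} {y : Euc n} {τ : Euc n → Euc n}

/-- `τ` is smooth near `y` with invertible derivative at `y`. -/
structure CoordChangeAt (τ : Euc n → Euc n) (y : Euc n) : Prop where
  smooth : ∀ᶠ z in 𝓝 y, ContDiffAt ℝ ∞ τ z
  det_ne : (jac τ y).det ≠ 0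

lemma contDiffAt_coord (h : ContDiffAt ℝ ∞ τ y) (a : Fin n) :
    ContDiffAt ℝ ∞ (fun z => τ z a) y := (contDiffAt_euclidean.1 h) a

lemma smooth_jac (h : ContDiffAt ℝ ∞ τ y) : MatSmoothAt (jac τ) y :=
  fun a i => contDiffAt_pd (contDiffAt_coord h a) i

lemma matPd_jac_symm (h : ContDiffAt ℝ ∞ τ y) (i k a : Fin n) :
    matPd k (jac τ) y a i = matPd i (jac τ) y a k :=
  pd_comm (contDiffAt_coord h a) k i

/-- The pullback of the coordinate matrix of a metric by `τ`. -/
def pullMat (τ : Euc n → Euc n) (G : Euc n → Matrix (Fin n) (Fin n) ℝ) (y : Euc n) :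
    Matrix (Fin n) (Fin n) ℝ := (jac τ y).transpose * G (τ y) * jac τ y

/-- The pullback of the connection form by `τ`. -/
def pullConn (τ : Euc n → Euc n) (G : Euc n → Matrix (Fin n) (Fin n) ℝ) (i : Fin n) (y : Euc n) :
    Matrix (Fin n) (Fin n) ℝ := ∑ a, jac τ y a i • chrMat G a (τ y)

namespace CoordChangeAt

lemma smoothAt (h : CoordChangeAt τ y) : ContDiffAt ℝ ∞ τ y := h.smooth.self_of_nhds

lemma diff (h : CoordChangeAt τ y) : DifferentiableAt ℝ τ y :=
  ContDiffAt.differentiableAt_top h.smoothAt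

lemma eventually (h : CoordChangeAt τ y) : ∀ᶠ z in 𝓝 y, CoordChangeAt τ z := by
  filter_upwards [h.smooth.eventually_nhds,
    (smooth_jac h.smoothAt).eventually_det_ne h.det_ne] with z h1 h2
  exact ⟨h1, h2⟩

lemma inv_mul (h : CoordChangeAt τ y) : (jac τ y)⁻¹ * jac τ y = 1 :=
  Matrix.nonsing_inv_mul _ (isUnit_iff_ne_zero.2 h.det_ne)

lemma mul_inv (h : CoordChangeAt τ y) : jac τ y * (jac τ y)⁻¹ = 1 :=
  Matrix.mul_nonsing_inv _ (isUnit_iff_ne_zero.2 h.det_ne)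

lemma tendsto (h : CoordChangeAt τ y) : Filter.Tendsto τ (𝓝 y) (𝓝 (τ y)) :=
  h.smoothAt.continuousAt

lemma metricAt (h : CoordChangeAt τ y) (hG : MetricAt G (τ y)) : MetricAt (pullMat τ G) y where
  smooth := by
    filter_upwards [h.smooth, h.tendsto.eventually hG.smooth] with z h1 h2
    exact ((smooth_jac h1).transpose.mul (h2.comp h1)).mul (smooth_jac h1)
  symm := by
    filter_upwards [h.tendsto.eventually hG.symm] with z hz
    simp only [Matrix.IsSymm, pullMat, Matrix.transpose_mul, Matrix.transpose_transpose, hz.eq,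
      mul_assoc]
  det_pos := by
    simp only [pullMat, Matrix.det_mul, Matrix.det_transpose]
    have := mul_pos hG.det_pos (mul_self_pos.2 h.det_ne)
    linarith [this, mul_comm ((jac τ y).det * (G (τ y)).det) (jac τ y).det]

lemma smooth_pullConn (h : CoordChangeAt τ y) (hG : MetricAt G (τ y)) (i : Fin n) :
    MatSmoothAt (pullConn τ G i) y :=
  MatSmoothAt.sum fun a _ => MatSmoothAt.smul (smooth_jac h.smoothAt a i)
    ((hG.smooth_chrMat a).comp h.smoothAt)

/-- The transformation rule of the Levi-Civita connection. -/
lemma jac_mul_chrMat (h : CoordChangeAt τ y) (hG : MetricAt G (τ y)) (i : Fin n) :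
    jac τ y * chrMat (pullMat τ G) i y
      = pullConn τ G i y * jac τ y + matPd i (jac τ) y := by
  set J := jac τ y with hJ
  -- The expected connection J⁻¹(NJ + ∂J), with N the pulled-back connection form, is shown to be
  -- torsion-free and metric for the pulled-back metric; uniqueness identifies it.
  have hu := (h.metricAt hG).chrMat_unique
    (γ := fun i => J⁻¹ * (pullConn τ G i y * J + matPd i (jac τ) y)) ?_ ?_ i
  · rw [← hu, ← mul_assoc, h.mul_inv, one_mul]
  · intro k a b
    have : ∀ c, (pullConn τ G k y * J + matPd k (jac τ) y) c b
        = (pullConn τ G b y * J + matPd b (jac τ) y) c k := by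
      intro c
      rw [Matrix.add_apply, Matrix.add_apply, matPd_jac_symm h.smoothAt]
      congr 1
      simp only [pullConn, Matrix.mul_apply, Matrix.sum_apply, Matrix.smul_apply, smul_eq_mul,
        Finset.sum_mul]
      rw [Finset.sum_comm]
      refine Finset.sum_congr rfl fun d _ => Finset.sum_congr rfl fun e _ => ?_
      have := hG.christoffel_symm c d e
      simp only [chrMat, Matrix.of_apply, this]
      ring
    change (J⁻¹ * (pullConn τ G k y * J + matPd k (jac τ) y)) a b
      = (J⁻¹ * (pullConn τ G b y * J + matPd b (jac τ) y)) a k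
    rw [Matrix.mul_apply, Matrix.mul_apply]
    exact Finset.sum_congr rfl fun c _ => by rw [this]
  · intro k
    have hsm := smooth_jac h.smoothAt
    have hGτ := hG.smoothAt.comp h.smoothAt
    have h1 : matPd k (pullMat τ G) y = (matPd k (jac τ) y).transpose * G (τ y) * J
        + J.transpose * (∑ a, J a k • matPd a G (τ y)) * J
        + J.transpose * G (τ y) * matPd k (jac τ) y := by
      have e1 := matPd_mul (hsm.transpose.mul hGτ) hsm k
      have e2 := matPd_mul hsm.transpose hGτ k
      rw [matPd_comp hG.smoothAt h.diff, matPd_transpose] at e2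
      rw [e2, add_mul] at e1
      exact e1
    have h2 : (∑ a, J a k • matPd a G (τ y)) = (pullConn τ G k y).transpose * G (τ y)
        + G (τ y) * pullConn τ G k y := by
      simp only [pullConn, Matrix.transpose_sum, Matrix.transpose_smul, Finset.sum_mul,
        Finset.mul_sum, ← Finset.sum_add_distrib, Matrix.smul_mul, Matrix.mul_smul, ← smul_add,
        hG.matPd_eq]
      rfl
    have h3 : ∀ X : Matrix (Fin n) (Fin n) ℝ, pullMat τ G y * (J⁻¹ * X)
        = J.transpose * G (τ y) * X := by
      intro X
      rw [pullMat, ← mul_assoc, mul_assoc (_ * _) _ (J⁻¹), h.mul_inv, mul_one]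
    have h4 : ∀ X : Matrix (Fin n) (Fin n) ℝ, (J⁻¹ * X).transpose * pullMat τ G y
        = X.transpose * G (τ y) * J := by
      intro X
      rw [Matrix.transpose_mul, pullMat, ← mul_assoc, ← mul_assoc, mul_assoc _ (J⁻¹).transpose,
        ← Matrix.transpose_mul, h.mul_inv, Matrix.transpose_one, mul_one]
    rw [h1, h2, h3, h4, Matrix.transpose_add, Matrix.transpose_mul]
    noncomm_ring

/-- The curvature transforms as a tensor. -/
lemma jac_mul_curvMat (h : CoordChangeAt τ y) (hG : MetricAt G (τ y)) (i j : Fin n) :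
    jac τ y * curvMat (pullMat τ G) i j y
      = (∑ a, ∑ b, (jac τ y a i * jac τ y b j) • curvMat G a b (τ y)) * jac τ y := by
  have hsm := smooth_jac h.smoothAt
  have hG' := h.metricAt hG
  have hN := h.smooth_pullConn hG
  set J := jac τ y with hJ
  -- The transformation rule holds near y and can be differentiated. Antisymmetrizing in i and j
  -- removes the second derivatives of J by `hsym`.
  have hev (j : Fin n) : (fun z => jac τ z * chrMat (pullMat τ G) j z) =ᶠ[𝓝 y]
      fun z => pullConn τ G j z * jac τ z + matPd j (jac τ) z := by
    filter_upwards [h.eventually, h.tendsto.eventually hG.eventually] with z h1 h2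
    exact h1.jac_mul_chrMat h2 j
  have hd (i j : Fin n) : matPd i (jac τ) y * chrMat (pullMat τ G) j y
      + J * matPd i (chrMat (pullMat τ G) j) y
      = matPd i (pullConn τ G j) y * J + pullConn τ G j y * matPd i (jac τ) y
        + matPd i (matPd j (jac τ)) y := by
    have e := matPd_congr (hev j) i
    rw [matPd_mul hsm (hG'.smooth_chrMat j), matPd_add ((hN j).mul hsm) (hsm.matPd j),
      matPd_mul (hN j) hsm] at e
    exact e
  have hsym : matPd i (matPd j (jac τ)) y = matPd j (matPd i (jac τ)) y := by
    ext a b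
    exact pd_comm (hsm a b) i j
  have hc (i : Fin n) : matPd i (jac τ) y = J * chrMat (pullMat τ G) i y - pullConn τ G i y * J := by
    rw [h.jac_mul_chrMat hG]; abel
  have hNd (i j : Fin n) : matPd i (pullConn τ G j) y
      = (∑ a, matPd i (jac τ) y a j • chrMat G a (τ y))
        + ∑ a, ∑ b, (J b i * J a j) • matPd b (chrMat G a) (τ y) := by
    have e := matPd_sum (s := Finset.univ) (f := fun a z => jac τ z a j • chrMat G a (τ z)) (y := y)
      (fun a _ => MatSmoothAt.smul (hsm a j) ((hG.smooth_chrMat a).comp h.smoothAt)) i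
    have e' : ∀ a, matPd i (fun z => jac τ z a j • chrMat G a (τ z)) y
        = matPd i (jac τ) y a j • chrMat G a (τ y)
          + ∑ b, (J b i * J a j) • matPd b (chrMat G a) (τ y) := by
      intro a
      rw [matPd_smul (hsm.diff a j) ((hG.smooth_chrMat a).comp h.smoothAt),
        matPd_comp (hG.smooth_chrMat a) h.diff, Finset.smul_sum]
      simp only [smul_smul, mul_comm (jac τ y a j)]
      rfl
    simp only [e', Finset.sum_add_distrib] at e
    exact e
  -- The terms of ∂_iN_j in which the Jacobian is differentiated are symmetric in i and j, so they
  -- drop out of the difference.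
  have hNasym : matPd i (pullConn τ G j) y - matPd j (pullConn τ G i) y
      = ∑ a, ∑ b, (J a i * J b j) •
        (matPd a (chrMat G b) (τ y) - matPd b (chrMat G a) (τ y)) := by
    rw [hNd, hNd]
    simp only [matPd_jac_symm h.smoothAt j i, smul_sub, Finset.sum_sub_distrib]
    rw [Finset.sum_comm (f := fun a b => (J b i * J a j) • matPd b (chrMat G a) (τ y))]
    simp only [mul_comm (J _ j)]
    abel
  have hNN : ∀ i j, pullConn τ G i y * pullConn τ G j y
      = ∑ a, ∑ b, (J a i * J b j) • (chrMat G a (τ y) * chrMat G b (τ y)) := by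
    intro i j
    simp only [pullConn, Finset.sum_mul, Finset.mul_sum, Matrix.smul_mul, Matrix.mul_smul,
      smul_smul]
    rw [Finset.sum_comm]
    exact Finset.sum_congr rfl fun a _ => Finset.sum_congr rfl fun b _ => by
      rw [mul_comm (jac τ y b j)]
  -- The pulled-back curvature is the curvature dN + N ∧ N of the pulled-back connection form.
  have hR : (∑ a, ∑ b, (J a i * J b j) • curvMat G a b (τ y))
      = matPd i (pullConn τ G j) y - matPd j (pullConn τ G i) y
        + pullConn τ G i y * pullConn τ G j y - pullConn τ G j y * pullConn τ G i y := by
    rw [hNasym, hNN i j, hNN j i,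
      Finset.sum_comm (f := fun a b => (J a j * J b i) • (chrMat G a (τ y) * chrMat G b (τ y)))]
    simp only [← Finset.sum_add_distrib, ← Finset.sum_sub_distrib]
    refine Finset.sum_congr rfl fun a _ => Finset.sum_congr rfl fun b _ => ?_
    rw [curvMat, mul_comm (J b j)]
    simp only [smul_sub, smul_add]
  rw [hR]
  have e1 := hd i j
  have e2 := hd j i
  rw [← hsym] at e2
  have e3 : J * matPd i (chrMat (pullMat τ G) j) y - J * matPd j (chrMat (pullMat τ G) i) y
      = matPd i (pullConn τ G j) y * J - matPd j (pullConn τ G i) y * J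
        + (pullConn τ G j y * matPd i (jac τ) y - pullConn τ G i y * matPd j (jac τ) y)
        - (matPd i (jac τ) y * chrMat (pullMat τ G) j y
          - matPd j (jac τ) y * chrMat (pullMat τ G) i y) := by
    rw [← sub_eq_zero]
    have := sub_eq_zero.2 (congrArg₂ (· - ·) e1 e2)
    rw [← this]
    abel
  -- Eliminating ∂J through the transformation rule leaves a noncommutative polynomial identity in
  -- J, N and the new connection.
  rw [hc i, hc j] at e3
  rw [curvMat, mul_sub, mul_add, mul_sub, e3]
  noncomm_ring

/-- The Ricci tensor transforms as a tensor. -/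
lemma ricMat_pullMat (h : CoordChangeAt τ y) (hG : MetricAt G (τ y)) :
    ricMat (pullMat τ G) y = (jac τ y).transpose * ricMat G (τ y) * jac τ y := by
  set J := jac τ y with hJ
  have hc (i j : Fin n) : curvMat (pullMat τ G) i j y
      = J⁻¹ * ((∑ a, ∑ b, (J a i * J b j) • curvMat G a b (τ y)) * J) := by
    rw [← h.jac_mul_curvMat hG, ← mul_assoc, h.inv_mul, one_mul]
  -- The trace over the endomorphism index pairs a factor J with the J⁻¹ of the conjugation, and the
  -- two cancel.
  have hk (M : Matrix (Fin n) (Fin n) ℝ) (a i : Fin n) :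
      ∑ k, J a k * (J⁻¹ * M) k i = M a i := by
    rw [← Matrix.mul_apply, ← mul_assoc, h.mul_inv, one_mul]
  ext i j
  rw [(h.metricAt hG).ricMat_eq_curvMat]
  have h1 (k : Fin n) : curvMat (pullMat τ G) k j y k i
      = ∑ a, ∑ b, J b j * (J a k * (J⁻¹ * (curvMat G a b (τ y) * J)) k i) := by
    rw [hc]
    simp only [Finset.sum_mul, Finset.mul_sum, Matrix.sum_apply, Matrix.smul_mul, Matrix.mul_smul,
      Matrix.smul_apply, smul_eq_mul]
    exact Finset.sum_congr rfl fun a _ => Finset.sum_congr rfl fun b _ => by ring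
  simp only [h1]
  rw [Finset.sum_comm]
  have h2 (a : Fin n) : ∑ k, ∑ b, J b j * (J a k * (J⁻¹ * (curvMat G a b (τ y) * J)) k i)
      = ∑ b, J b j * (curvMat G a b (τ y) * J) a i := by
    rw [Finset.sum_comm]
    simp only [← Finset.mul_sum, hk]
  simp only [h2]
  simp only [Matrix.mul_apply, Finset.mul_sum, hG.ricMat_eq_curvMat, Matrix.transpose_apply,
    Finset.sum_mul]
  rw [Finset.sum_comm]
  refine Finset.sum_congr rfl fun b _ => ?_
  rw [Finset.sum_comm]
  exact Finset.sum_congr rfl fun d _ => Finset.sum_congr rfl fun a _ => by ring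

lemma _root_.EHOrbifold.inv_pullMat :
    (pullMat τ G y)⁻¹ = (jac τ y)⁻¹ * (G (τ y))⁻¹ * ((jac τ y)⁻¹).transpose := by
  rw [pullMat, Matrix.mul_inv_rev, Matrix.mul_inv_rev, Matrix.transpose_nonsing_inv, mul_assoc]

/-- Raising an index commutes with coordinate changes. -/
lemma inv_pullMat_mul (h : CoordChangeAt τ y) (S : Euc n → Matrix (Fin n) (Fin n) ℝ) :
    (pullMat τ G y)⁻¹ * pullMat τ S y = (jac τ y)⁻¹ * ((G (τ y))⁻¹ * S (τ y)) * jac τ y := by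
  have : ((jac τ y)⁻¹).transpose * (jac τ y).transpose = 1 := by
    rw [← Matrix.transpose_mul, h.mul_inv, Matrix.transpose_one]
  rw [inv_pullMat, pullMat]
  calc _ = (jac τ y)⁻¹ * (G (τ y))⁻¹ * (((jac τ y)⁻¹).transpose * (jac τ y).transpose) * S (τ y)
        * jac τ y := by noncomm_ring
    _ = _ := by rw [this]; noncomm_ring

lemma trace_inv_pullMat_mul (h : CoordChangeAt τ y) (S : Euc n → Matrix (Fin n) (Fin n) ℝ) :
    ((pullMat τ G y)⁻¹ * pullMat τ S y).trace = ((G (τ y))⁻¹ * S (τ y)).trace := by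
  rw [h.inv_pullMat_mul, Matrix.trace_mul_comm, ← mul_assoc, h.mul_inv, one_mul]

lemma trace_pairing_pullMat (h : CoordChangeAt τ y) (S T : Euc n → Matrix (Fin n) (Fin n) ℝ) :
    ((pullMat τ G y)⁻¹ * pullMat τ S y * ((pullMat τ G y)⁻¹ * pullMat τ T y)).trace
      = ((G (τ y))⁻¹ * S (τ y) * ((G (τ y))⁻¹ * T (τ y))).trace := by
  rw [h.inv_pullMat_mul, h.inv_pullMat_mul]
  calc _ = ((jac τ y)⁻¹ * ((G (τ y))⁻¹ * S (τ y) * (jac τ y * (jac τ y)⁻¹) *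
        ((G (τ y))⁻¹ * T (τ y)) * jac τ y)).trace := by congr 1; noncomm_ring
    _ = _ := by
      rw [h.mul_inv, mul_one, Matrix.trace_mul_comm, mul_assoc _ (jac τ y), h.mul_inv, mul_one]

lemma ricMat_pullMat' (h : CoordChangeAt τ y) (hG : MetricAt G (τ y)) :
    ricMat (pullMat τ G) y = pullMat τ (ricMat G) y := h.ricMat_pullMat hG

lemma coordScalar_pullMat (h : CoordChangeAt τ y) (hG : MetricAt G (τ y)) :
    coordScalar (pullMat τ G) y = coordScalar G (τ y) := by
  rw [(h.metricAt hG).coordScalar_eq_trace, hG.coordScalar_eq_trace, h.ricMat_pullMat' hG,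
    h.trace_inv_pullMat_mul]

end CoordChangeAt

/-- The factor (det J)² is nonnegative, so it leaves the square root whatever the sign of det S. The
formula thus applies to arbitrary tensors, such as g + th for large t. -/
lemma sqrt_det_pullMat (τ : Euc n → Euc n) (S : Euc n → Matrix (Fin n) (Fin n) ℝ) :
    √(pullMat τ S y).det = |(jac τ y).det| * √(S (τ y)).det := by
  rw [pullMat, Matrix.det_mul, Matrix.det_mul, Matrix.det_transpose, mul_right_comm,
    Real.sqrt_mul (mul_self_nonneg _), Real.sqrt_mul_self_eq_abs]

end CoordinateChange

/-! ### The first variation of the Einstein–Hilbert Lagrangian in coordinates -/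

section Palatini

variable {n : ℕ}

lemma sum_perm_kjli (g : Fin n → Fin n → Fin n → Fin n → ℝ) :
    ∑ k, ∑ j, ∑ l, ∑ i, g i j k l = ∑ i, ∑ j, ∑ k, ∑ l, g i j k l := by
  calc _ = ∑ k, ∑ j, ∑ i, ∑ l, g i j k l := Finset.sum_congr rfl fun k _ =>
        Finset.sum_congr rfl fun j _ => Finset.sum_comm
    _ = ∑ k, ∑ i, ∑ j, ∑ l, g i j k l := Finset.sum_congr rfl fun k _ => Finset.sum_comm
    _ = ∑ i, ∑ k, ∑ j, ∑ l, g i j k l := Finset.sum_comm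
    _ = _ := Finset.sum_congr rfl fun i _ => Finset.sum_comm

lemma sum_perm_lkij (g : Fin n → Fin n → Fin n → Fin n → ℝ) :
    ∑ l, ∑ k, ∑ i, ∑ j, g i j k l = ∑ i, ∑ j, ∑ k, ∑ l, g i j k l := by
  calc _ = ∑ k, ∑ l, ∑ i, ∑ j, g i j k l := Finset.sum_comm
    _ = ∑ k, ∑ i, ∑ l, ∑ j, g i j k l := Finset.sum_congr rfl fun k _ => Finset.sum_comm
    _ = ∑ k, ∑ i, ∑ j, ∑ l, g i j k l := Finset.sum_congr rfl fun k _ =>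
        Finset.sum_congr rfl fun i _ => Finset.sum_comm
    _ = ∑ i, ∑ k, ∑ j, ∑ l, g i j k l := Finset.sum_comm
    _ = _ := Finset.sum_congr rfl fun i _ => Finset.sum_comm

lemma sum_perm_kij (g : Fin n → Fin n → Fin n → ℝ) :
    ∑ k, ∑ i, ∑ j, g i j k = ∑ i, ∑ j, ∑ k, g i j k := by
  calc _ = ∑ i, ∑ k, ∑ j, g i j k := Finset.sum_comm
    _ = _ := Finset.sum_congr rfl fun i _ => Finset.sum_comm

/-- The algebraic identity behind the Palatini formula. -/
lemma palatini_algebra {Q : Fin n → Fin n → ℝ} {Γ C : Fin n → Fin n → Fin n → ℝ}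
    (hQ : ∀ i j, Q i j = Q j i) (hΓ : ∀ k i j, Γ k i j = Γ k j i) (hC : ∀ k i j, C k i j = C k j i) :
    ∑ i, ∑ j, Q i j * ∑ k, ∑ l, (C k k l * Γ l i j + Γ k k l * C l i j
        - C k j l * Γ l i k - Γ k j l * C l i k)
      = ∑ k, ∑ i, ∑ j, ((∑ l, Γ l k l) * Q i j - ∑ l, Q i l * Γ j k l - ∑ l, Γ i k l * Q l j)
          * C k i j
        - ∑ k, ∑ i, ((∑ l, Γ l k l) * Q i k - ∑ l, Q i l * Γ k k l - ∑ l, Γ i k l * Q l k)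
          * ∑ l, C l i l := by
  -- Here Q stands for the density √det G⁻¹, Γ for the connection and C for its variation. Each of
  -- the four products on the left is matched with a term on the right by renaming indices and using
  -- the three symmetries.
  have ha : ∑ i, ∑ j, ∑ k, ∑ l, Q i j * (C k k l * Γ l i j)
      = ∑ k, ∑ i, ∑ l, Γ i k l * Q l k * ∑ m, C m i m := by
    calc _ = ∑ i, ∑ j, ∑ l, ∑ k, Q i j * (C k k l * Γ l i j) :=
          Finset.sum_congr rfl fun i _ => Finset.sum_congr rfl fun j _ => Finset.sum_comm
      _ = ∑ i, ∑ l, ∑ j, ∑ k, Q i j * (C k k l * Γ l i j) :=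
          Finset.sum_congr rfl fun i _ => Finset.sum_comm
      _ = _ := by
        refine Finset.sum_congr rfl fun i _ => Finset.sum_congr rfl fun l _ =>
          Finset.sum_congr rfl fun j _ => ?_
        rw [Finset.mul_sum]
        refine Finset.sum_congr rfl fun k _ => ?_
        rw [hQ i j, hC k k l]; ring
  have hb : ∑ i, ∑ j, ∑ k, ∑ l, Q i j * (Γ k k l * C l i j)
      = ∑ k, ∑ i, ∑ j, (∑ l, Γ l k l) * Q i j * C k i j := by
    rw [sum_perm_kij (fun i j k => (∑ l, Γ l k l) * Q i j * C k i j)]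
    refine Finset.sum_congr rfl fun i _ => Finset.sum_congr rfl fun j _ => ?_
    rw [Finset.sum_comm]
    refine Finset.sum_congr rfl fun k _ => ?_
    rw [Finset.sum_mul, Finset.sum_mul]
    refine Finset.sum_congr rfl fun l _ => ?_
    rw [hΓ l l k]; ring
  have hc : ∑ i, ∑ j, ∑ k, ∑ l, Q i j * (C k j l * Γ l i k)
      = ∑ k, ∑ i, ∑ j, ∑ l, Q i l * Γ j k l * C k i j := by
    rw [← sum_perm_kjli]
    refine Finset.sum_congr rfl fun k _ => Finset.sum_congr rfl fun i _ =>
      Finset.sum_congr rfl fun j _ => Finset.sum_congr rfl fun l _ => ?_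
    rw [hQ l i, hΓ j l k]; ring
  have hd : ∑ i, ∑ j, ∑ k, ∑ l, Q i j * (Γ k j l * C l i k)
      = ∑ k, ∑ i, ∑ j, ∑ l, Γ i k l * Q l j * C k i j := by
    rw [← sum_perm_lkij]
    refine Finset.sum_congr rfl fun k _ => Finset.sum_congr rfl fun i _ =>
      Finset.sum_congr rfl fun j _ => Finset.sum_congr rfl fun l _ => ?_
    rw [hQ j l, hΓ i l k, hC k j i]; ring
  -- Two terms of the second sum on the right cancel each other; only the one matched by `ha`
  -- survives.
  have he : ∑ k, ∑ i, (∑ l, Γ l k l) * Q i k * ∑ m, C m i m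
      = ∑ k, ∑ i, ∑ l, Q i l * Γ k k l * ∑ m, C m i m := by
    calc _ = ∑ k, ∑ i, ∑ l, Γ l k l * Q i k * ∑ m, C m i m := by
          simp only [Finset.sum_mul]
      _ = ∑ k, ∑ l, ∑ i, Γ l k l * Q i k * ∑ m, C m i m :=
          Finset.sum_congr rfl fun k _ => Finset.sum_comm
      _ = ∑ l, ∑ k, ∑ i, Γ l k l * Q i k * ∑ m, C m i m := Finset.sum_comm
      _ = ∑ l, ∑ i, ∑ k, Γ l k l * Q i k * ∑ m, C m i m :=
          Finset.sum_congr rfl fun k _ => Finset.sum_comm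
      _ = _ := by
        refine Finset.sum_congr rfl fun l _ => Finset.sum_congr rfl fun i _ =>
          Finset.sum_congr rfl fun k _ => ?_
        rw [hΓ l k l]; ring
  have hl (i j : Fin n) : Q i j * ∑ k, ∑ l, (C k k l * Γ l i j + Γ k k l * C l i j
        - C k j l * Γ l i k - Γ k j l * C l i k)
      = ∑ k, ∑ l, Q i j * (C k k l * Γ l i j) + ∑ k, ∑ l, Q i j * (Γ k k l * C l i j)
        - ∑ k, ∑ l, Q i j * (C k j l * Γ l i k) - ∑ k, ∑ l, Q i j * (Γ k j l * C l i k) := by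
    simp only [Finset.mul_sum, mul_sub, mul_add, Finset.sum_sub_distrib, Finset.sum_add_distrib]
  rw [Finset.sum_congr rfl fun i _ => Finset.sum_congr rfl fun j _ => hl i j]
  simp only [sub_mul, Finset.sum_sub_distrib, Finset.sum_add_distrib]
  rw [ha, hb, hc, hd, he]
  simp only [← Finset.sum_mul]
  ring

end Palatini

/-! ### Variation of the Christoffel symbols, the Ricci tensor and the Lagrangian along G + tH. -/

section Variation

variable {n : ℕ} {y : Euc n}

/-- Smoothness jointly in the parameter and the point is what `hasDerivAt_pd_slice` asks for, and is
the source of the uniform bounds near t = 0. -/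
lemma joint_christoffel {𝒢 : ℝ × Euc n → Matrix (Fin n) (Fin n) ℝ} {p : ℝ × Euc n}
    (h : MatSmoothAt 𝒢 p) (hd : (𝒢 p).det ≠ 0) (k i j : Fin n) :
    ContDiffAt ℝ ∞ (fun q : ℝ × Euc n => christoffel (fun w => 𝒢 (q.1, w)) k i j q.2) p := by
  refine contDiffAt_const.mul (ContDiffAt.sum fun l _ => ?_)
  exact (h.inv hd k l).mul (((contDiffAt_pd_slice (h _ _) _).add
    (contDiffAt_pd_slice (h _ _) _)).sub (contDiffAt_pd_slice (h _ _) _))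

lemma joint_coordRicci {𝒢 : ℝ × Euc n → Matrix (Fin n) (Fin n) ℝ} {p : ℝ × Euc n}
    (h : MatSmoothAt 𝒢 p) (hd : (𝒢 p).det ≠ 0) (i j : Fin n) :
    ContDiffAt ℝ ∞ (fun q : ℝ × Euc n => coordRicci (fun w => 𝒢 (q.1, w)) i j q.2) p := by
  have hc := joint_christoffel h hd
  refine ContDiffAt.add (ContDiffAt.sum fun k _ => ?_)
    (ContDiffAt.sum fun k _ => ContDiffAt.sum fun l _ => ?_)
  · exact (contDiffAt_pd_slice (hc _ _ _) _).sub (contDiffAt_pd_slice (hc _ _ _) _)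
  · exact ((hc _ _ _).mul (hc _ _ _)).sub ((hc _ _ _).mul (hc _ _ _))

/-- The Lagrangian density `R √det G` of the Einstein–Hilbert functional. -/
def lagrangian (G : Euc n → Matrix (Fin n) (Fin n) ℝ) (y : Euc n) : ℝ :=
  coordScalar G y * √(G y).det

lemma joint_lagrangian {𝒢 : ℝ × Euc n → Matrix (Fin n) (Fin n) ℝ} {p : ℝ × Euc n}
    (h : MatSmoothAt 𝒢 p) (hd : (𝒢 p).det ≠ 0) :
    ContDiffAt ℝ ∞ (fun q : ℝ × Euc n => lagrangian (fun w => 𝒢 (q.1, w)) q.2) p :=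
  ContDiffAt.mul (ContDiffAt.sum fun _ _ => ContDiffAt.sum fun _ _ =>
    (h.inv hd _ _).mul (joint_coordRicci h hd _ _)) (h.sqrt_det hd)

/-- The variation of the Christoffel symbols of `G` in the direction `H`. -/
def dChristoffel (G H : Euc n → Matrix (Fin n) (Fin n) ℝ) (k i j : Fin n) (y : Euc n) : ℝ :=
  (1 / 2) * ∑ l, (-((G y)⁻¹ * H y * (G y)⁻¹) k l *
      (pd i (fun z => G z j l) y + pd j (fun z => G z i l) y - pd l (fun z => G z i j) y)
    + (G y)⁻¹ k l *
      (pd i (fun z => H z j l) y + pd j (fun z => H z i l) y - pd l (fun z => H z i j) y))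

/-- The density `√det G • G⁻¹`. -/
def invDensity (G : Euc n → Matrix (Fin n) (Fin n) ℝ) (y : Euc n) : Matrix (Fin n) (Fin n) ℝ :=
  √(G y).det • (G y)⁻¹

/-- The vector density whose divergence is the exact part of the first variation of the
Lagrangian. -/
def varField (G H : Euc n → Matrix (Fin n) (Fin n) ℝ) (k : Fin n) (y : Euc n) : ℝ :=
  ∑ i, ∑ j, invDensity G y i j * dChristoffel G H k i j y
    - ∑ i, invDensity G y i k * ∑ l, dChristoffel G H l i l y

/-- The exact part of the first variation of the Lagrangian. -/
def varDiv (G H : Euc n → Matrix (Fin n) (Fin n) ℝ) (y : Euc n) : ℝ :=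
  ∑ k, pd k (varField G H k) y

/-- The pairing of the gradient of the Lagrangian with a variation. -/
def gradPairing (G H : Euc n → Matrix (Fin n) (Fin n) ℝ) (y : Euc n) : ℝ :=
  ((G y)⁻¹ * ricMat G y * ((G y)⁻¹ * H y)).trace - 1 / 2 * coordScalar G y * ((G y)⁻¹ * H y).trace

/-- `H` is a smooth symmetric matrix-valued function near `y`. -/
structure SymAt (H : Euc n → Matrix (Fin n) (Fin n) ℝ) (y : Euc n) : Prop where
  smooth : ∀ᶠ z in 𝓝 y, MatSmoothAt H z
  symm : ∀ᶠ z in 𝓝 y, (H z).IsSymm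

variable {G H K : Euc n → Matrix (Fin n) (Fin n) ℝ}

lemma SymAt.eventually (h : SymAt H y) : ∀ᶠ z in 𝓝 y, SymAt H z := by
  filter_upwards [h.smooth.eventually_nhds, h.symm.eventually_nhds] with z h1 h2
  exact ⟨h1, h2⟩

lemma SymAt.smoothAt (h : SymAt H y) : MatSmoothAt H y := h.smooth.self_of_nhds

/-- The affine family `G + t H`. -/
def fam (G H : Euc n → Matrix (Fin n) (Fin n) ℝ) (p : ℝ × Euc n) : Matrix (Fin n) (Fin n) ℝ :=
  G p.2 + p.1 • H p.2

lemma smooth_fam {p : ℝ × Euc n} (hG : MatSmoothAt G p.2) (hH : MatSmoothAt H p.2) :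
    MatSmoothAt (fam G H) p :=
  (hG.comp contDiffAt_snd).add (MatSmoothAt.smul contDiffAt_fst (hH.comp contDiffAt_snd))

lemma fam_zero : (fun w => fam G H (0, w)) = G := by
  ext w
  simp [fam]

lemma hasDerivAt_fam (y : Euc n) (t : ℝ) (i j : Fin n) :
    HasDerivAt (fun s => fam G H (s, y) i j) (H y i j) t := by
  have := ((hasDerivAt_id t).mul_const (H y i j)).const_add (G y i j)
  rw [one_mul] at this
  exact this

lemma hasDerivAt_pd_fam (hG : MatSmoothAt G y) (hH : MatSmoothAt H y) (k i j : Fin n) :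
    HasDerivAt (fun s => pd k (fun z => fam G H (s, z) i j) y) (pd k (fun z => H z i j) y) 0 := by
  have : (fun s => pd k (fun z => fam G H (s, z) i j) y)
      = fun s => pd k (fun z => G z i j) y + s * pd k (fun z => H z i j) y := by
    ext s
    rw [← pd_const_mul (hH.diff i j), ← pd_add (hG.diff i j) ((hH.diff i j).const_mul s)]
    rfl
  rw [this]
  simpa using ((hasDerivAt_id (0 : ℝ)).mul_const (pd k (fun z => H z i j) y)).const_add
    (pd k (fun z => G z i j) y)

lemma hasDerivAt_christoffel (hG : MetricAt G y) (hH : MatSmoothAt H y) (k i j : Fin n) :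
    HasDerivAt (fun s => christoffel (fun z => fam G H (s, z)) k i j y)
      (dChristoffel G H k i j y) 0 := by
  have hp := hasDerivAt_pd_fam hG.smoothAt hH
  have hinv := hasDerivAt_inv (A := fun s => fam G H (s, y)) (A' := H y) (t := 0)
    (hasDerivAt_fam y 0) (by simpa [fam] using hG.det_ne)
  have := (HasDerivAt.fun_sum (u := Finset.univ) fun l _ => (hinv k l).mul
    (((hp i j l).add (hp j i l)).sub (hp l i j))).const_mul (1 / 2 : ℝ)
  refine this.congr_deriv ?_
  simp only [dChristoffel, fam, zero_smul, add_zero, Pi.add_apply, Pi.sub_apply]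

lemma contDiffAt_dChristoffel (hG : MetricAt G y) (hH : MatSmoothAt H y) (k i j : Fin n) :
    ContDiffAt ℝ ∞ (dChristoffel G H k i j) y := by
  have hi := hG.smoothAt.inv hG.det_ne
  refine contDiffAt_const.mul (ContDiffAt.sum fun l _ => ContDiffAt.add ?_ ?_)
  · exact ((hi.mul hH).mul hi k l).neg.mul (((contDiffAt_pd (hG.smoothAt _ _) _).add
      (contDiffAt_pd (hG.smoothAt _ _) _)).sub (contDiffAt_pd (hG.smoothAt _ _) _))
  · exact (hi k l).mul (((contDiffAt_pd (hH _ _) _).add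
      (contDiffAt_pd (hH _ _) _)).sub (contDiffAt_pd (hH _ _) _))

lemma MetricAt.dChristoffel_symm (hG : MetricAt G y) (hH : SymAt H y) (k i j : Fin n) :
    dChristoffel G H k i j y = dChristoffel G H k j i y := by
  simp only [dChristoffel]
  refine congrArg _ (Finset.sum_congr rfl fun l _ => ?_)
  rw [hG.pd_symm l i j, pd_congr (hH.symm.mono fun _ hz => hz.apply j i) l]
  ring

/-- The t-derivative and the spatial derivative are exchanged by `hasDerivAt_pd_slice`. -/
lemma hasDerivAt_pd_christoffel (hG : MetricAt G y) (hH : SymAt H y) (a k i j : Fin n) :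
    HasDerivAt (fun s => pd a (christoffel (fun z => fam G H (s, z)) k i j) y)
      (pd a (dChristoffel G H k i j) y) 0 := by
  have h := hasDerivAt_pd_slice (f := fun q : ℝ × Euc n =>
    christoffel (fun z => fam G H (q.1, z)) k i j q.2) (t := 0) (y := y)
    (joint_christoffel (smooth_fam hG.smoothAt hH.smoothAt)
      (by simpa [fam] using hG.det_ne) k i j) a
  convert h using 1
  refine pd_congr ?_ a
  filter_upwards [hG.eventually, hH.eventually] with z h1 h2
  exact (hasDerivAt_christoffel h1 h2.smoothAt k i j).deriv.symm

/-- The variation of the Ricci tensor of `G` in the direction `H`. -/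
def dRicci (G H : Euc n → Matrix (Fin n) (Fin n) ℝ) (i j : Fin n) (y : Euc n) : ℝ :=
  (∑ k, (pd k (dChristoffel G H k i j) y - pd j (dChristoffel G H k i k) y)) +
    ∑ k, ∑ l, (dChristoffel G H k k l y * christoffel G l i j y
      + christoffel G k k l y * dChristoffel G H l i j y
      - dChristoffel G H k j l y * christoffel G l i k y
      - christoffel G k j l y * dChristoffel G H l i k y)

lemma hasDerivAt_coordRicci (hG : MetricAt G y) (hH : SymAt H y) (i j : Fin n) :
    HasDerivAt (fun s => coordRicci (fun z => fam G H (s, z)) i j y) (dRicci G H i j y) 0 := by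
  have hp := hasDerivAt_pd_christoffel hG hH
  have hc := hasDerivAt_christoffel hG hH.smoothAt
  have := (HasDerivAt.fun_sum (u := Finset.univ) fun k _ => (hp k k i j).sub (hp j k i k)).add
    (HasDerivAt.fun_sum (u := Finset.univ) fun k _ => HasDerivAt.fun_sum (u := Finset.univ)
      fun l _ => ((hc k k l).mul (hc l i j)).sub ((hc k j l).mul (hc l i k)))
  refine this.congr_deriv ?_
  simp only [dRicci, fam_zero]
  refine congrArg _ (Finset.sum_congr rfl fun k _ => Finset.sum_congr rfl fun l _ => ?_)
  ring

lemma smooth_invDensity (hG : MetricAt G y) : MatSmoothAt (invDensity G) y :=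
  MatSmoothAt.smul (hG.smoothAt.sqrt_det hG.det_ne) (hG.smoothAt.inv hG.det_ne)

lemma contDiffAt_varField (hG : MetricAt G y) (hH : MatSmoothAt H y) (k : Fin n) :
    ContDiffAt ℝ ∞ (varField G H k) y :=
  (ContDiffAt.sum fun _ _ => ContDiffAt.sum fun _ _ => (smooth_invDensity hG _ _).mul
    (contDiffAt_dChristoffel hG hH _ _ _)).sub (ContDiffAt.sum fun _ _ =>
      (smooth_invDensity hG _ _).mul (ContDiffAt.sum fun _ _ => contDiffAt_dChristoffel hG hH _ _ _))

lemma pd_invDensity (hG : MetricAt G y) (k i j : Fin n) :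
    pd k (fun z => invDensity G z i j) y = √(G y).det * ((∑ l, christoffel G l k l y) * (G y)⁻¹ i j
      - ∑ l, (G y)⁻¹ i l * christoffel G j k l y - ∑ l, christoffel G i k l y * (G y)⁻¹ l j) := by
  have := congrFun (congrFun (hG.matPd_density k) i) j
  simp only [Matrix.smul_apply, Matrix.sub_apply, Matrix.mul_apply, Matrix.transpose_apply,
    chrMat, Matrix.of_apply, smul_eq_mul, Matrix.trace, Matrix.diag] at this
  exact this

/-- The Palatini identity. -/
lemma sum_invDensity_mul_dRicci (hG : MetricAt G y) (hH : SymAt H y) :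
    ∑ i, ∑ j, invDensity G y i j * dRicci G H i j y = varDiv G H y := by
  have hPd (i j : Fin n) := (smooth_invDensity hG).diff i j
  have hCd (k i j : Fin n) :=
    ContDiffAt.differentiableAt_top (contDiffAt_dChristoffel hG hH.smoothAt k i j)
  have hW (k : Fin n) : pd k (varField G H k) y
      = ∑ i, ∑ j, (pd k (fun z => invDensity G z i j) y * dChristoffel G H k i j y
          + invDensity G y i j * pd k (dChristoffel G H k i j) y)
        - ∑ i, (pd k (fun z => invDensity G z i k) y * ∑ l, dChristoffel G H l i l y
          + invDensity G y i k * ∑ l, pd k (dChristoffel G H l i l) y) := by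
    have hCs (i : Fin n) : DifferentiableAt ℝ (fun z => ∑ l, dChristoffel G H l i l z) y :=
      DifferentiableAt.fun_sum fun l _ => hCd l i l
    unfold varField
    rw [pd_sub (f := fun z => ∑ i, ∑ j, invDensity G z i j * dChristoffel G H k i j z)
      (g := fun z => ∑ i, invDensity G z i k * ∑ l, dChristoffel G H l i l z)
      (DifferentiableAt.fun_sum fun i _ => DifferentiableAt.fun_sum fun j _ =>
      (hPd i j).mul (hCd k i j)) (DifferentiableAt.fun_sum fun i _ => (hPd i k).mul (hCs i))]
    congr 1
    · rw [pd_sum (f := fun i z => ∑ j, invDensity G z i j * dChristoffel G H k i j z)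
        fun i _ => DifferentiableAt.fun_sum fun j _ => (hPd i j).mul (hCd k i j)]
      refine Finset.sum_congr rfl fun i _ => ?_
      rw [pd_sum (f := fun j z => invDensity G z i j * dChristoffel G H k i j z)
        fun j _ => (hPd i j).mul (hCd k i j)]
      exact Finset.sum_congr rfl fun j _ => pd_mul (hPd i j) (hCd k i j) k
    · rw [pd_sum (f := fun i z => invDensity G z i k * ∑ l, dChristoffel G H l i l z)
        fun i _ => (hPd i k).mul (hCs i)]
      refine Finset.sum_congr rfl fun i _ => ?_
      rw [pd_mul (hPd i k) (hCs i), pd_sum fun l _ => hCd l i l]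
  -- By `pd_invDensity`, the derivatives of the density in the product rule `hW` are the
  -- coefficients in `palatini_algebra`. Hence the undifferentiated terms of the Ricci variation
  -- complete the derivative terms to a divergence.
  have halg := palatini_algebra (Q := fun i j => invDensity G y i j)
    (Γ := fun k i j => christoffel G k i j y) (C := fun k i j => dChristoffel G H k i j y)
    (fun i j => by simp only [invDensity, Matrix.smul_apply, hG.inv_symm.apply j i])
    hG.christoffel_symm (hG.dChristoffel_symm hH)
  have hP' (k i j : Fin n) : pd k (fun z => invDensity G z i j) y
      = (∑ l, christoffel G l k l y) * invDensity G y i j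
        - ∑ l, invDensity G y i l * christoffel G j k l y
        - ∑ l, christoffel G i k l y * invDensity G y l j := by
    rw [pd_invDensity hG]
    simp only [invDensity, Matrix.smul_apply, smul_eq_mul, mul_sub, Finset.mul_sum]
    congr 1
    · congr 1
      · rw [Finset.sum_mul, Finset.sum_mul, Finset.mul_sum]
        exact Finset.sum_congr rfl fun l _ => by ring
      · exact Finset.sum_congr rfl fun l _ => by ring
    · exact Finset.sum_congr rfl fun l _ => by ring
  simp only [← hP'] at halg
  have hS1 : ∑ i, ∑ j, invDensity G y i j * ∑ k, pd k (dChristoffel G H k i j) y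
      = ∑ k, ∑ i, ∑ j, invDensity G y i j * pd k (dChristoffel G H k i j) y := by
    rw [sum_perm_kij (fun i j k => invDensity G y i j * pd k (dChristoffel G H k i j) y)]
    simp only [Finset.mul_sum]
  have hS2 : ∑ i, ∑ j, invDensity G y i j * ∑ k, pd j (dChristoffel G H k i k) y
      = ∑ k, ∑ i, invDensity G y i k * ∑ l, pd k (dChristoffel G H l i l) y := Finset.sum_comm
  have hr (i j : Fin n) : invDensity G y i j * dRicci G H i j y
      = invDensity G y i j * (∑ k, pd k (dChristoffel G H k i j) y)
        - invDensity G y i j * (∑ k, pd j (dChristoffel G H k i k) y)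
        + invDensity G y i j * ∑ k, ∑ l, (dChristoffel G H k k l y * christoffel G l i j y
          + christoffel G k k l y * dChristoffel G H l i j y
          - dChristoffel G H k j l y * christoffel G l i k y
          - christoffel G k j l y * dChristoffel G H l i k y) := by
    rw [dRicci, Finset.sum_sub_distrib]
    ring
  have hsplit (A B C : Fin n → Fin n → ℝ) : ∑ i, ∑ j, (A i j - B i j + C i j)
      = ∑ i, ∑ j, A i j - ∑ i, ∑ j, B i j + ∑ i, ∑ j, C i j := by
    simp only [Finset.sum_add_distrib, Finset.sum_sub_distrib]
  rw [Finset.sum_congr rfl fun i _ => Finset.sum_congr rfl fun j _ => hr i j, hsplit, halg, hS1,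
    hS2]
  simp only [varDiv, hW, Finset.sum_add_distrib, Finset.sum_sub_distrib]
  ring

/-- The first variation of the Lagrangian. -/
lemma hasDerivAt_lagrangian (hG : MetricAt G y) (hH : SymAt H y) :
    HasDerivAt (fun s => lagrangian (fun z => fam G H (s, z)) y)
      (varDiv G H y - √(G y).det * gradPairing G H y) 0 := by
  have hfam := hasDerivAt_fam (G := G) (H := H) y 0
  have h0 : fam G H (0, y) = G y := by simp [fam]
  have hs := hasDerivAt_sqrt_det hfam (by rw [h0]; exact hG.det_pos)
  have hinv := hasDerivAt_inv hfam (by rw [h0]; exact hG.det_ne)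
  rw [h0] at hs hinv
  have h1 := HasDerivAt.mul (HasDerivAt.fun_sum (u := Finset.univ) fun i _ =>
    HasDerivAt.fun_sum (u := Finset.univ) fun j _ =>
      (hinv i j).mul (hasDerivAt_coordRicci hG hH i j)) hs
  refine h1.congr_deriv ?_
  -- The product rule has three parts: the variation of G⁻¹ gives −⟨Ric, H⟩, the variation of Ricci
  -- is the divergence, and the variation of √det gives half of R tr H.
  rw [← sum_invDensity_mul_dRicci hG hH, gradPairing]
  simp only [h0, fam_zero, Pi.mul_apply]
  have e1 : ((G y)⁻¹ * ricMat G y * ((G y)⁻¹ * H y)).trace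
      = ∑ i, ∑ j, ((G y)⁻¹ * H y * (G y)⁻¹) i j * coordRicci G i j y := by
    rw [Matrix.trace_mul_comm, ← mul_assoc]
    refine Finset.sum_congr rfl fun i _ => ?_
    rw [Matrix.diag_apply, Matrix.mul_apply]
    refine Finset.sum_congr rfl fun j _ => ?_
    rw [hG.ricMat_symm.apply i j]
    rfl
  have e2 : coordScalar G y = ∑ i, ∑ j, (G y)⁻¹ i j * coordRicci G i j y := rfl
  rw [e1, e2]
  simp only [invDensity, Matrix.smul_apply, smul_eq_mul, Finset.sum_add_distrib, neg_mul,
    Finset.sum_neg_distrib, mul_assoc, ← Finset.mul_sum, add_mul, mul_sub]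
  ring

lemma dChristoffel_add (hH : MatSmoothAt H y) (hK : MatSmoothAt K y) (k i j : Fin n) :
    dChristoffel G (fun z => H z + K z) k i j y
      = dChristoffel G H k i j y + dChristoffel G K k i j y := by
  have hp (k i j : Fin n) : pd k (fun z => (H z + K z) i j) y
      = pd k (fun z => H z i j) y + pd k (fun z => K z i j) y := pd_add (hH.diff i j) (hK.diff i j) k
  simp only [dChristoffel, hp]
  rw [← mul_add, ← Finset.sum_add_distrib]
  refine congrArg _ (Finset.sum_congr rfl fun l _ => ?_)
  rw [mul_add (G y)⁻¹, add_mul _ _ (G y)⁻¹, Matrix.add_apply]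
  ring

/-- Additivity in the variation allows h to be split by cutoff functions before the divergence is
integrated. -/
lemma varDiv_add (hG : MetricAt G y) (hH : SymAt H y) (hK : SymAt K y) :
    varDiv G (fun z => H z + K z) y = varDiv G H y + varDiv G K y := by
  simp only [varDiv, ← Finset.sum_add_distrib]
  refine Finset.sum_congr rfl fun k _ => ?_
  rw [← pd_add (ContDiffAt.differentiableAt_top (contDiffAt_varField hG hH.smoothAt k))
    (ContDiffAt.differentiableAt_top (contDiffAt_varField hG hK.smoothAt k))]
  refine pd_congr ?_ k
  filter_upwards [hH.smooth, hK.smooth] with z h1 h2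
  simp only [varField, dChristoffel_add h1 h2, mul_add, Finset.sum_add_distrib]
  ring

lemma varField_eq_zero (h : H =ᶠ[𝓝 y] 0) (k : Fin n) : varField G H k y = 0 := by
  have hp (k i j : Fin n) : pd k (fun z => H z i j) y = 0 := by
    rw [pd_congr (h.mono fun z hz => by simp [hz] : (fun z => H z i j) =ᶠ[𝓝 y] fun _ => 0),
      pd_const]
  have h0 : H y = 0 := h.self_of_nhds
  simp [varField, dChristoffel, hp, h0]

lemma varDiv_congr {G' H' : Euc n → Matrix (Fin n) (Fin n) ℝ} (hG : G =ᶠ[𝓝 y] G')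
    (hH : H =ᶠ[𝓝 y] H') : varDiv G H y = varDiv G' H' y := by
  refine Finset.sum_congr rfl fun k _ => pd_congr ?_ k
  filter_upwards [hG.eventuallyEq_nhds, hH.eventuallyEq_nhds] with z h1 h2
  have e (a b : Fin n) : (fun z => G z a b) =ᶠ[𝓝 z] fun z => G' z a b :=
    h1.mono fun z hz => by simp [hz]
  have e' (a b : Fin n) : (fun z => H z a b) =ᶠ[𝓝 z] fun z => H' z a b :=
    h2.mono fun z hz => by simp [hz]
  simp only [varField, dChristoffel, invDensity, pd_congr (e _ _), pd_congr (e' _ _),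
    h1.self_of_nhds, h2.self_of_nhds]

lemma contDiffAt_varDiv (hG : MetricAt G y) (hH : SymAt H y) :
    ContDiffAt ℝ ∞ (varDiv G H) y :=
  ContDiffAt.sum fun k _ => contDiffAt_pd (contDiffAt_varField hG hH.smoothAt k) k

end Variation

/-! ### Parametrizations of manifolds and coordinate matrices of tensors -/

section Parametrizations

variable {n : ℕ} {X : Type*} [TopologicalSpace X] [ChartedSpace (Euc n) X]

/-- The matrix of the pullback of a tensor by a map from `ℝⁿ`. -/
def paramMatrix (f : Euc n → X) (h : TwoTensor n X) (y : Euc n) : Matrix (Fin n) (Fin n) ℝ :=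
  Matrix.of fun i j => pullback f h y (stdVec i) (stdVec j)

/-- `f` is a local diffeomorphism at `y`. -/
abbrev IsParam (f : Euc n → X) (y : Euc n) : Prop :=
  IsLocalDiffeomorphAt 𝓘(ℝ, Euc n) 𝓘(ℝ, Euc n) ∞ f y

lemma infty_ne_zero : (∞ : ℕ∞ω) ≠ 0 := by simp

lemma IsParam.eventually {f : Euc n → X} {y : Euc n} (hf : IsParam f y) :
    ∀ᶠ z in 𝓝 y, IsParam f z := by
  obtain ⟨Φ, hy, he⟩ := hf
  filter_upwards [Φ.open_source.mem_nhds hy] with z hz using ⟨Φ, hz, he⟩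

lemma IsParam.mdiff {f : Euc n → X} {y : Euc n} (hf : IsParam f y) :
    MDifferentiableAt 𝓘(ℝ, Euc n) 𝓘(ℝ, Euc n) f y := hf.mdifferentiableAt infty_ne_zero

lemma tensor_congr (h : TwoTensor n X) {x x' : X} (hx : x = x') (u v : Euc n) :
    h x u v = h x' u v := by subst hx; rfl

lemma pullback_congr {f f' : Euc n → X} {y : Euc n} (hf : f =ᶠ[𝓝 y] f') (h : TwoTensor n X)
    (u v : Euc n) : pullback f h y u v = pullback f' h y u v := by
  simp only [pullback]
  rw [hf.mfderiv_eq]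
  exact tensor_congr h hf.self_of_nhds _ _

lemma pullback_comp {f : Euc n → X} {τ : Euc n → Euc n} {y : Euc n}
    (hf : MDifferentiableAt 𝓘(ℝ, Euc n) 𝓘(ℝ, Euc n) f (τ y)) (hτ : DifferentiableAt ℝ τ y)
    (h : TwoTensor n X) (u v : Euc n) :
    pullback (f ∘ τ) h y u v = pullback f h (τ y) (fderiv ℝ τ y u) (fderiv ℝ τ y v) := by
  simp only [pullback]
  rw [mfderiv_comp y hf hτ.mdifferentiableAt, mfderiv_eq_fderiv]
  rfl

lemma fderiv_eq_jac {τ : Euc n → Euc n} {y : Euc n} (hτ : DifferentiableAt ℝ τ y) (a i : Fin n) :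
    fderiv ℝ τ y (stdVec i) a = jac τ y a i := by
  have := ((EuclideanSpace.proj (𝕜 := ℝ) a).hasFDerivAt.comp y hτ.hasFDerivAt).fderiv
  simp only [jac, Matrix.of_apply, pd]
  erw [this]
  rfl

lemma det_fderiv {τ : Euc n → Euc n} {y : Euc n} (hτ : DifferentiableAt ℝ τ y) :
    (fderiv ℝ τ y).det = (jac τ y).det := by
  rw [ContinuousLinearMap.det, ← LinearMap.det_toMatrix (EuclideanSpace.basisFun (Fin n) ℝ).toBasis]
  congr 1
  ext a i
  rw [LinearMap.toMatrix_apply, ← fderiv_eq_jac hτ]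
  simp [stdVec]

/-- A tangent-space valued bilinear form is determined by its matrix. -/
lemma pullback_eq_sum (f : Euc n → X) (h : TwoTensor n X) (y u v : Euc n) :
    pullback f h y u v = ∑ i, ∑ j, u i * v j * paramMatrix f h y i j := by
  let B : Euc n →L[ℝ] Euc n →L[ℝ] ℝ := h (f y)
  let D : Euc n →L[ℝ] Euc n := mfderiv 𝓘(ℝ, Euc n) 𝓘(ℝ, Euc n) f y
  change B (D u) (D v) = ∑ i, ∑ j, u i * v j * B (D (stdVec i)) (D (stdVec j))
  rw [clm_apply_eq_sum D u, clm_apply_eq_sum D v]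
  simp only [map_sum, map_smul, sum_apply, smul_apply,
    smul_eq_mul, Finset.mul_sum]
  rw [Finset.sum_comm]
  exact Finset.sum_congr rfl fun i _ => Finset.sum_congr rfl fun j _ => by ring

lemma paramMatrix_comp {f f' : Euc n → X} {τ : Euc n → Euc n} {y : Euc n}
    (hff' : f =ᶠ[𝓝 y] f' ∘ τ) (hf : MDifferentiableAt 𝓘(ℝ, Euc n) 𝓘(ℝ, Euc n) f' (τ y))
    (hτ : DifferentiableAt ℝ τ y) (h : TwoTensor n X) :
    paramMatrix f h y = pullMat τ (paramMatrix f' h) y := by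
  ext i j
  simp only [paramMatrix, Matrix.of_apply, pullback_congr hff', pullback_comp hf hτ]
  rw [pullback_eq_sum]
  simp only [fderiv_eq_jac hτ, pullMat, Matrix.mul_apply, Matrix.transpose_apply, Finset.sum_mul]
  rw [Finset.sum_comm]
  exact Finset.sum_congr rfl fun a _ => Finset.sum_congr rfl fun b _ => by
    simp only [paramMatrix, Matrix.of_apply]; ring

lemma paramMatrix_add (f : Euc n → X) (h k : TwoTensor n X) (y : Euc n) :
    paramMatrix f (h + k) y = paramMatrix f h y + paramMatrix f k y := by
  ext i j; rfl

lemma paramMatrix_smul (f : Euc n → X) (h : TwoTensor n X) (c : ℝ) (y : Euc n) :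
    paramMatrix f (c • h) y = c • paramMatrix f h y := by
  ext i j; rfl

/-- Two parametrizations of the same point differ by a coordinate change. -/
lemma IsParam.exists_coordChange {f f' : Euc n → X} {y y' : Euc n} (hf : IsParam f y)
    (hf' : IsParam f' y') (h : f y = f' y') :
    ∃ τ : Euc n → Euc n, CoordChangeAt τ y ∧ τ y = y' ∧ f =ᶠ[𝓝 y] f' ∘ τ := by
  obtain ⟨Φ, hy, he⟩ := hf
  obtain ⟨Φ', hy', he'⟩ := hf'
  have hΦy : Φ y = Φ' y' := by rw [← he hy, ← he' hy', h]
  let Θ := Φ.trans Φ'.symm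
  have hmem : y ∈ Θ.source := by
    refine ⟨hy, ?_⟩
    change Φ y ∈ Φ'.target
    rw [hΦy]
    exact Φ'.map_source hy'
  have hΘy : Θ y = y' := by
    change Φ'.symm (Φ y) = y'
    rw [hΦy]
    exact Φ'.left_inv hy'
  have hsm (z) (hz : z ∈ Θ.source) : ContDiffAt ℝ ∞ Θ z :=
    (Θ.contMDiffOn.contMDiffAt (Θ.open_source.mem_nhds hz)).contDiffAt
  refine ⟨Θ, ⟨?_, ?_⟩, hΘy, ?_⟩
  · filter_upwards [Θ.open_source.mem_nhds hmem] with z hz using hsm z hz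
  -- The chain rule for Θ⁻¹ ∘ Θ = id, read on determinants, shows that the Jacobian is invertible.
  · have h1 : DifferentiableAt ℝ Θ y := ContDiffAt.differentiableAt_top (hsm y hmem)
    have ht : Θ y ∈ Θ.target := Θ.map_source hmem
    have h2 : DifferentiableAt ℝ Θ.symm (Θ y) := ContDiffAt.differentiableAt_top
      (Θ.symm.contMDiffOn.contMDiffAt (Θ.open_target.mem_nhds ht)).contDiffAt
    have h3 : (Θ.symm ∘ Θ) =ᶠ[𝓝 y] id := by
      filter_upwards [Θ.open_source.mem_nhds hmem] with z hz using Θ.left_inv hz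
    have h4 := fderiv_comp y h2 h1
    rw [h3.fderiv_eq, fderiv_id] at h4
    have h5 := congrArg ContinuousLinearMap.det h4
    intro h0
    rw [← det_fderiv h1] at h0
    have h6 : ((fderiv ℝ Θ.symm (Θ y)).comp (fderiv ℝ Θ y)).det
        = (fderiv ℝ Θ.symm (Θ y)).det * (fderiv ℝ Θ y).det := by
      simp only [ContinuousLinearMap.det, ContinuousLinearMap.toLinearMap_comp]
      exact LinearMap.det_comp _ _
    rw [h6, h0, mul_zero] at h5
    simp [ContinuousLinearMap.det] at h5
  · filter_upwards [Θ.open_source.mem_nhds hmem] with z hz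
    have hz1 : z ∈ Φ.source := hz.1
    have hz2 : Φ z ∈ Φ'.target := hz.2
    have hz3 : Φ'.symm (Φ z) ∈ Φ'.source := Φ'.map_target hz2
    rw [he hz1]
    change _ = f' (Φ'.symm (Φ z))
    rw [he' hz3]
    exact (Φ'.right_inv hz2).symm

/-- This is the bridge from coordinate formulas to the manifold: one transition map serves all
tensors at once, and on a whole neighbourhood, so expressions containing derivatives transfer as
well. -/
lemma IsParam.exists_pullMat {f f' : Euc n → X} {y y' : Euc n} (hf : IsParam f y)
    (hf' : IsParam f' y') (h : f y = f' y') :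
    ∃ τ : Euc n → Euc n, CoordChangeAt τ y ∧ τ y = y' ∧ f =ᶠ[𝓝 y] f' ∘ τ ∧
      ∀ k : TwoTensor n X, paramMatrix f k =ᶠ[𝓝 y] pullMat τ (paramMatrix f' k) := by
  obtain ⟨τ, h1, h2, h3⟩ := hf.exists_coordChange hf' h
  refine ⟨τ, h1, h2, h3, fun k => ?_⟩
  subst h2
  filter_upwards [h1.eventually, h3.eventuallyEq_nhds, h1.tendsto.eventually hf'.eventually]
    with z hz1 hz2 hz3
  exact paramMatrix_comp hz2 hz3.mdiff hz1.diff k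

/-- The bilinear form with a given matrix. -/
def bilinOfMatrix (m : Matrix (Fin n) (Fin n) ℝ) : Euc n →L[ℝ] Euc n →L[ℝ] ℝ :=
  ∑ i, ∑ j, m i j • (EuclideanSpace.proj (𝕜 := ℝ) i).smulRight (EuclideanSpace.proj (𝕜 := ℝ) j)

lemma bilinOfMatrix_apply (m : Matrix (Fin n) (Fin n) ℝ) (u v : Euc n) :
    bilinOfMatrix m u v = ∑ i, ∑ j, u i * v j * m i j := by
  simp only [bilinOfMatrix, sum_apply, smul_apply, ContinuousLinearMap.smulRight_apply, smul_eq_mul]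
  exact Finset.sum_congr rfl fun i _ => Finset.sum_congr rfl fun j _ => by
    change m i j * (u i * v j) = _
    ring

lemma contDiffAt_bilinOfMatrix {F : Type*} [NormedAddCommGroup F] [NormedSpace ℝ F]
    {A : F → Matrix (Fin n) (Fin n) ℝ} {y : F} (hA : MatSmoothAt A y) :
    ContDiffAt ℝ ∞ (fun z => bilinOfMatrix (A z)) y :=
  ContDiffAt.sum fun i _ => ContDiffAt.sum fun j _ => ((ContinuousLinearMap.id ℝ ℝ).smulRight _).contDiff.contDiffAt.comp y (hA i j)

lemma bilin_eq_ofMatrix (f : Euc n → X) (h : TwoTensor n X) (y u v : Euc n) :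
    pullback f h y u v = bilinOfMatrix (paramMatrix f h y) u v := by
  rw [pullback_eq_sum, bilinOfMatrix_apply]

lemma posDef_ofBilin {B : Euc n →L[ℝ] Euc n →L[ℝ] ℝ} (hs : ∀ u v, B u v = B v u)
    (hB : ∀ u, u ≠ 0 → 0 < B u u) :
    (Matrix.of fun i j => B (stdVec i) (stdVec j) : Matrix (Fin n) (Fin n) ℝ).PosDef := by
  refine Matrix.PosDef.of_dotProduct_mulVec_pos (Matrix.IsHermitian.ext fun i j => ?_) fun w hw => ?_
  · exact hs _ _
  · have h1 := hB (WithLp.toLp 2 w) (by simpa using hw)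
    have h2 (u : Euc n) : B u u = ∑ i, u i * ∑ j, B (stdVec i) (stdVec j) * u j := by
      rw [clm_apply_eq_sum B u]
      simp only [sum_apply, smul_apply, smul_eq_mul]
      refine Finset.sum_congr rfl fun i _ => congrArg _ ?_
      rw [clm_apply_eq_sum (B (stdVec i)) u]
      exact Finset.sum_congr rfl fun j _ => by rw [smul_eq_mul, mul_comm]
    rw [h2] at h1
    exact h1

lemma posDef_paramMatrix {g : TwoTensor n X} (hs : ∀ x u v, g x u v = g x v u) {f : Euc n → X}
    {y : Euc n} (hg : ∀ u : Euc n, u ≠ 0 → 0 < pullback f g y u u) :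
    (paramMatrix f g y).PosDef := by
  let B : Euc n →L[ℝ] Euc n →L[ℝ] ℝ := g (f y)
  let D : Euc n →L[ℝ] Euc n := mfderiv 𝓘(ℝ, Euc n) 𝓘(ℝ, Euc n) f y
  exact posDef_ofBilin (B := B.bilinearComp D D) (fun _ _ => hs _ _ _) hg

lemma IsParam.mfderiv_ne_zero {f : Euc n → X} {y : Euc n} (hf : IsParam f y) {u : Euc n} (hu : u ≠ 0) :
    mfderiv 𝓘(ℝ, Euc n) 𝓘(ℝ, Euc n) f y u ≠ 0 := by
  intro h0
  refine hu ((hf.mfderivToContinuousLinearEquiv infty_ne_zero).injective ?_)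
  exact h0.trans (map_zero (mfderiv 𝓘(ℝ, Euc n) 𝓘(ℝ, Euc n) f y)).symm

variable [IsManifold 𝓘(ℝ, Euc n) ∞ X]

lemma isParam_symm {e : OpenPartialHomeomorph X (Euc n)} (he : e ∈ atlas (Euc n) X) {y : Euc n}
    (hy : y ∈ e.target) : IsParam e.symm y := by
  have hm : e ∈ IsManifold.maximalAtlas 𝓘(ℝ, Euc n) ∞ X := IsManifold.subset_maximalAtlas he
  refine ⟨⟨e.symm.toPartialEquiv, e.open_target, e.open_source, ?_, ?_⟩, hy, fun _ _ => rfl⟩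
  · exact contMDiffOn_symm_of_mem_maximalAtlas hm
  · exact contMDiffOn_of_mem_maximalAtlas hm

lemma isParam_chart (x : X) : IsParam (chartAt (Euc n) x).symm (chartAt (Euc n) x x) :=
  isParam_symm (chart_mem_atlas _ x) (mem_chart_target _ x)

end Parametrizations

/-! ### Smoothness of tensor fields in terms of coordinate matrices. -/

section SmoothTensors

variable {n : ℕ} {X : Type*} [TopologicalSpace X] [ChartedSpace (Euc n) X]
  [IsManifold 𝓘(ℝ, Euc n) ∞ X]

/-- Smoothness of a tensor at a point. -/
def SmoothTensorAt (h : TwoTensor n X) (x : X) : Prop :=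
  ContMDiffAt 𝓘(ℝ, Euc n) (𝓘(ℝ, Euc n).prod 𝓘(ℝ, Euc n →L[ℝ] Euc n →L[ℝ] ℝ)) ∞
    (fun x => Bundle.TotalSpace.mk' (Euc n →L[ℝ] Euc n →L[ℝ] ℝ)
      (E := fun x : X => TangentSpace 𝓘(ℝ, Euc n) x →L[ℝ] TangentSpace 𝓘(ℝ, Euc n) x →L[ℝ] ℝ)
      x (h x)) x

lemma smoothTensor_iff (h : TwoTensor n X) : SmoothTensor h ↔ ∀ x, SmoothTensorAt h x := Iff.rfl

/-- In the preferred chart the trivialization of the tangent bundle is the derivative of the inverse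
chart, so the trivialized tensor is the pullback. -/
lemma inCoordinates_tensor (h : TwoTensor n X) {x₀ x : X}
    (hx : x ∈ (chartAt (Euc n) x₀).source) (u v : Euc n) :
    ContinuousLinearMap.inCoordinates (Euc n) (TangentSpace 𝓘(ℝ, Euc n)) (Euc n →L[ℝ] ℝ)
      (fun x : X => TangentSpace 𝓘(ℝ, Euc n) x →L[ℝ] ℝ) x₀ x x₀ x (h x) u v
      = pullback (chartAt (Euc n) x₀).symm h (chartAt (Euc n) x₀ x) u v := by
  have : IsManifold 𝓘(ℝ, Euc n) 1 X := IsManifold.of_le (n := ∞) (by simp)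
  have hb : x ∈ (trivializationAt (Euc n) (TangentSpace 𝓘(ℝ, Euc n)) x₀).baseSet := by simpa using hx
  erw [inCoordinates_apply_eq₂ (E₃ := Bundle.Trivial X ℝ) hb hb (Set.mem_univ _)]
  have hs := TangentBundle.symmL_trivializationAt (𝕜 := ℝ) (I := 𝓘(ℝ, Euc n)) hx
  have hs' (u : Euc n) : (trivializationAt (Euc n) (TangentSpace 𝓘(ℝ, Euc n)) x₀).symm x u
      = mfderiv 𝓘(ℝ, Euc n) 𝓘(ℝ, Euc n) (chartAt (Euc n) x₀).symm (chartAt (Euc n) x₀ x) u := by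
    have := congrArg (fun T => T u) hs
    simp only [mfld_simps, Bundle.Trivialization.symmL_apply _ hb] at this
    exact this
  rw [hs' u, hs' v]
  refine Eq.trans ?_ (tensor_congr h ((chartAt (Euc n) x₀).left_inv hx).symm _ _)
  simp

/-- A bilinear form depends linearly on its matrix and conversely, so bundle smoothness amounts to
smoothness of the entries in the preferred chart. -/
lemma smoothTensorAt_iff (h : TwoTensor n X) (x : X) : SmoothTensorAt h x ↔
    MatSmoothAt (paramMatrix (chartAt (Euc n) x).symm h) (chartAt (Euc n) x x) := by
  set e := chartAt (Euc n) x with he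
  set y := e x with hy
  have hx : x ∈ e.source := mem_chart_source _ x
  have hyt : y ∈ e.target := e.map_source hx
  have hsy : e.symm y = x := e.left_inv hx
  have hm : e ∈ IsManifold.maximalAtlas 𝓘(ℝ, Euc n) ∞ X :=
    IsManifold.subset_maximalAtlas (chart_mem_atlas _ x)
  have h1 : ContMDiffAt 𝓘(ℝ, Euc n) 𝓘(ℝ, Euc n) ∞ e.symm y :=
    (contMDiffOn_symm_of_mem_maximalAtlas hm).contMDiffAt (e.open_target.mem_nhds hyt)
  have h2 : ContMDiffAt 𝓘(ℝ, Euc n) 𝓘(ℝ, Euc n) ∞ e x :=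
    (contMDiffOn_of_mem_maximalAtlas hm).contMDiffAt (e.open_source.mem_nhds hx)
  have key : SmoothTensorAt h x ↔
      ContMDiffAt 𝓘(ℝ, Euc n) 𝓘(ℝ, Euc n →L[ℝ] Euc n →L[ℝ] ℝ) ∞
        (fun x' => bilinOfMatrix (paramMatrix e.symm h (e x'))) x := by
    unfold SmoothTensorAt
    rw [contMDiffAt_hom_bundle]
    have h3 : (fun x' : X => ContinuousLinearMap.inCoordinates (Euc n) (TangentSpace 𝓘(ℝ, Euc n))
        (Euc n →L[ℝ] ℝ) (fun x : X => TangentSpace 𝓘(ℝ, Euc n) x →L[ℝ] ℝ) x x' x x' (h x'))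
        =ᶠ[𝓝 x] fun x' => bilinOfMatrix (paramMatrix e.symm h (e x')) := by
      filter_upwards [e.open_source.mem_nhds hx] with x' hx'
      ext u v
      rw [inCoordinates_tensor h hx', bilin_eq_ofMatrix]
    constructor
    · rintro ⟨-, h4⟩
      exact h4.congr_of_eventuallyEq h3.symm
    · intro h4
      exact ⟨contMDiffAt_id, h4.congr_of_eventuallyEq h3⟩
  rw [key]
  constructor
  · intro h3 i j
    have h4 : ContDiffAt ℝ ∞ (fun z => bilinOfMatrix (paramMatrix e.symm h (e (e.symm z)))) y := by
      rw [← hsy] at h3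
      exact (h3.comp y h1).contDiffAt
    have h5 := (h4.clm_apply (contDiffAt_const (c := stdVec i))).clm_apply
      (contDiffAt_const (c := stdVec j))
    refine h5.congr_of_eventuallyEq ?_
    filter_upwards [e.open_target.mem_nhds hyt] with z hz
    rw [e.right_inv hz, ← bilin_eq_ofMatrix]
    rfl
  · intro h3
    exact (contDiffAt_bilinOfMatrix h3).contMDiffAt.comp x h2

lemma SmoothTensorAt.param {h : TwoTensor n X} {f : Euc n → X} {y : Euc n} (hf : IsParam f y)
    (hh : SmoothTensorAt h (f y)) : MatSmoothAt (paramMatrix f h) y := by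
  obtain ⟨τ, h1, h2, -, h4⟩ := hf.exists_pullMat (isParam_chart (f y))
    (((chartAt (Euc n) (f y)).left_inv (mem_chart_source _ _)).symm)
  rw [smoothTensorAt_iff, ← h2] at hh
  exact (((smooth_jac h1.smoothAt).transpose.mul (hh.comp h1.smoothAt)).mul
    (smooth_jac h1.smoothAt)).congr (h4 h)

lemma smoothTensorAt_of_param {h : TwoTensor n X} {f : Euc n → X} {y : Euc n} (hf : IsParam f y)
    (hh : MatSmoothAt (paramMatrix f h) y) : SmoothTensorAt h (f y) := by
  obtain ⟨τ, h1, h2, -, h4⟩ := (isParam_chart (f y)).exists_pullMat hf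
    ((chartAt (Euc n) (f y)).left_inv (mem_chart_source _ _))
  rw [smoothTensorAt_iff]
  rw [← h2] at hh
  exact (((smooth_jac h1.smoothAt).transpose.mul (hh.comp h1.smoothAt)).mul
    (smooth_jac h1.smoothAt)).congr (h4 h)

/-- Smooth symmetric tensors. -/
structure SmoothSym (h : TwoTensor n X) : Prop where
  smooth : ∀ x, SmoothTensorAt h x
  symm : ∀ x u v, h x u v = h x v u

/-- Riemannian metrics. -/
structure IsRiemannian (g : TwoTensor n X) : Prop extends SmoothSym g where
  pos : ∀ x u, u ≠ 0 → 0 < g x u u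

lemma SmoothSym.symAt {h : TwoTensor n X} (hh : SmoothSym h) {f : Euc n → X} {y : Euc n}
    (hf : IsParam f y) : SymAt (paramMatrix f h) y where
  smooth := hf.eventually.mono fun z hz => (hh.smooth (f z)).param hz
  symm := Filter.Eventually.of_forall fun z => Matrix.IsSymm.ext fun _ _ => hh.symm (f z) _ _

lemma IsRiemannian.posDef {g : TwoTensor n X} (hg : IsRiemannian g) {f : Euc n → X} {y : Euc n}
    (hf : IsParam f y) : (paramMatrix f g y).PosDef :=
  posDef_paramMatrix hg.symm fun _ hu => hg.pos _ _ (hf.mfderiv_ne_zero hu)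

lemma IsRiemannian.metricAt {g : TwoTensor n X} (hg : IsRiemannian g) {f : Euc n → X} {y : Euc n}
    (hf : IsParam f y) : MetricAt (paramMatrix f g) y where
  smooth := (hg.toSmoothSym.symAt hf).smooth
  symm := (hg.toSmoothSym.symAt hf).symm
  det_pos := (hg.posDef hf).det_pos

end SmoothTensors

/-! ### Invariants of tensors, evaluated in arbitrary parametrizations -/

section Invariants

variable {n : ℕ} {X : Type*} [TopologicalSpace X] [ChartedSpace (Euc n) X]

/-- The coordinate matrix of a tensor at `x` in the preferred chart at `x`. -/
def matAt (h : TwoTensor n X) (x : X) : Matrix (Fin n) (Fin n) ℝ :=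
  paramMatrix (chartAt (Euc n) x).symm h (chartAt (Euc n) x x)

/-- The trace `g^{ij} h_ij`. -/
def trPair (g h : TwoTensor n X) (x : X) : ℝ := ((matAt g x)⁻¹ * matAt h x).trace

/-- The pairing `g^{ik} g^{jl} s_ij h_kl`. -/
def tensorPair (g s h : TwoTensor n X) (x : X) : ℝ :=
  ((matAt g x)⁻¹ * matAt s x * ((matAt g x)⁻¹ * matAt h x)).trace

/-- The ratio of the volume densities of `k` and `g`. -/
def volRatio (g k : TwoTensor n X) (x : X) : ℝ := √(matAt k x).det / √(matAt g x).det

/-- The Ricci tensor as a tensor field. -/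
def ricTensor (g : TwoTensor n X) : TwoTensor n X := fun x =>
  let D : Euc n →L[ℝ] Euc n := mfderiv 𝓘(ℝ, Euc n) 𝓘(ℝ, Euc n) (chartAt (Euc n) x) x
  (bilinOfMatrix (ricMat (paramMatrix (chartAt (Euc n) x).symm g) (chartAt (Euc n) x x))).bilinearComp
    D D

lemma ricTensor_apply (g : TwoTensor n X) (x : X) (u v : TangentSpace 𝓘(ℝ, Euc n) x) :
    ricTensor g x u v = ricci g x u v := by
  have : ricTensor g x u v
      = bilinOfMatrix (ricMat (paramMatrix (chartAt (Euc n) x).symm g) (chartAt (Euc n) x x))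
        (components x u) (components x v) := rfl
  rw [this, bilinOfMatrix_apply]
  refine Finset.sum_congr rfl fun i _ => Finset.sum_congr rfl fun j _ => ?_
  simp only [ricMat, Matrix.of_apply]
  change _ * _ * coordRicci (chartMatrix g _) i j _ = _
  ring

/-- A function that is continuous in the preferred chart at every point is continuous. -/
lemma continuous_of_param {Y : Type*} [TopologicalSpace Y] {ψ : X → Y}
    (h : ∀ x, ContinuousAt (fun z => ψ ((chartAt (Euc n) x).symm z)) (chartAt (Euc n) x x)) :
    Continuous ψ := by
  rw [continuous_iff_continuousAt]
  intro x
  have h1 : ContinuousAt (fun x' => ψ ((chartAt (Euc n) x).symm (chartAt (Euc n) x x'))) x :=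
    ContinuousAt.comp (f := chartAt (Euc n) x) (h x)
      ((chartAt (Euc n) x).continuousAt (mem_chart_source _ x))
  refine h1.congr ?_
  filter_upwards [(chartAt (Euc n) x).open_source.mem_nhds (mem_chart_source _ x)] with x' hx'
  rw [(chartAt (Euc n) x).left_inv hx']

variable [IsManifold 𝓘(ℝ, Euc n) ∞ X] {f : Euc n → X} {y : Euc n} {g h k : TwoTensor n X}

lemma IsParam.exists_chart_pullMat (hf : IsParam f y) :
    ∃ τ : Euc n → Euc n, CoordChangeAt τ (chartAt (Euc n) (f y) (f y)) ∧
      τ (chartAt (Euc n) (f y) (f y)) = y ∧ ∀ k : TwoTensor n X,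
        paramMatrix (chartAt (Euc n) (f y)).symm k
          =ᶠ[𝓝 (chartAt (Euc n) (f y) (f y))] pullMat τ (paramMatrix f k) := by
  obtain ⟨τ, h1, h2, -, h4⟩ := (isParam_chart (f y)).exists_pullMat hf
    ((chartAt (Euc n) (f y)).left_inv (mem_chart_source _ _))
  exact ⟨τ, h1, h2, h4⟩

/-- Only a positive determinant is required, and not definiteness, so that the formula can be used
along g + th with no more than control of the determinant. -/
lemma scalarCurvature_param (hf : IsParam f y) (hk : MetricAt (paramMatrix f k) y) :
    scalarCurvature k (f y) = coordScalar (paramMatrix f k) y := by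
  obtain ⟨τ, h1, h2, h3⟩ := hf.exists_chart_pullMat
  have : scalarCurvature k (f y) = coordScalar (paramMatrix (chartAt (Euc n) (f y)).symm k)
    (chartAt (Euc n) (f y) (f y)) := rfl
  rw [this, coordScalar_congr (h3 k), h1.coordScalar_pullMat (by rwa [h2]), h2]

lemma trPair_param (hf : IsParam f y) :
    trPair g h (f y) = ((paramMatrix f g y)⁻¹ * paramMatrix f h y).trace := by
  obtain ⟨τ, h1, h2, h3⟩ := hf.exists_chart_pullMat
  rw [trPair, matAt, matAt, (h3 g).self_of_nhds, (h3 h).self_of_nhds, h1.trace_inv_pullMat_mul, h2]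

lemma tensorPair_param (s : TwoTensor n X) (hf : IsParam f y) : tensorPair g s h (f y)
    = ((paramMatrix f g y)⁻¹ * paramMatrix f s y
      * ((paramMatrix f g y)⁻¹ * paramMatrix f h y)).trace := by
  obtain ⟨τ, h1, h2, h3⟩ := hf.exists_chart_pullMat
  rw [tensorPair, matAt, matAt, matAt, (h3 g).self_of_nhds, (h3 h).self_of_nhds,
    (h3 s).self_of_nhds, h1.trace_pairing_pullMat, h2]

lemma volRatio_param (hf : IsParam f y) :
    volRatio g k (f y) = √(paramMatrix f k y).det / √(paramMatrix f g y).det := by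
  obtain ⟨τ, h1, h2, h3⟩ := hf.exists_chart_pullMat
  rw [volRatio, matAt, matAt, (h3 g).self_of_nhds, (h3 k).self_of_nhds, sqrt_det_pullMat,
    sqrt_det_pullMat, h2, mul_div_mul_left _ _ (abs_ne_zero.2 h1.det_ne)]

lemma det_pos_param (hf : IsParam f y) (hk : 0 < (matAt k (f y)).det) :
    0 < (paramMatrix f k y).det := by
  obtain ⟨τ, h1, h2, h3⟩ := hf.exists_chart_pullMat
  rw [matAt, (h3 k).self_of_nhds] at hk
  simp only [pullMat, Matrix.det_mul, Matrix.det_transpose, h2] at hk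
  have := mul_self_pos.2 h1.det_ne
  rw [mul_right_comm] at hk
  exact (mul_pos_iff_of_pos_left this).1 hk

lemma det_matAt_pos (hf : IsParam f y) (hk : 0 < (paramMatrix f k y).det) :
    0 < (matAt k (f y)).det := by
  obtain ⟨τ, h1, h2, h3⟩ := hf.exists_chart_pullMat
  rw [matAt, (h3 k).self_of_nhds]
  simp only [pullMat, Matrix.det_mul, Matrix.det_transpose, h2]
  rw [mul_right_comm]
  exact mul_pos (mul_self_pos.2 h1.det_ne) hk

lemma paramMatrix_ricTensor (hf : IsParam f y) (hg : MetricAt (paramMatrix f g) y) :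
    paramMatrix f (ricTensor g) y = ricMat (paramMatrix f g) y := by
  set x := f y with hx
  set e := chartAt (Euc n) x with he
  have hxs : x ∈ e.source := mem_chart_source _ x
  have hle : e.symm (e x) = x := e.left_inv hxs
  have hpc : IsParam e.symm (e x) := isParam_chart x
  have hmd : e.MDifferentiable 𝓘(ℝ, Euc n) 𝓘(ℝ, Euc n) :=
    have : IsManifold 𝓘(ℝ, Euc n) 1 X := IsManifold.of_le (n := ∞) (by simp)
    mdifferentiable_chart x
  -- In the preferred chart the derivatives of the chart and of its inverse cancel. Other
  -- parametrizations are then reached by the transformation law of Ricci.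
  have h0 : paramMatrix e.symm (ricTensor g) (e x) = ricMat (paramMatrix e.symm g) (e x) := by
    have hcomp := hmd.comp_symm_deriv (e.map_source hxs)
    have hD (u : Euc n) : mfderiv 𝓘(ℝ, Euc n) 𝓘(ℝ, Euc n) e x
        (mfderiv 𝓘(ℝ, Euc n) 𝓘(ℝ, Euc n) e.symm (e x) u) = u := by
      have := congrArg (fun T => T u) hcomp
      rw [hle] at this
      exact this
    ext i j
    simp only [paramMatrix, Matrix.of_apply, pullback]
    refine (tensor_congr (ricTensor g) hle _ _).trans ?_
    have : ∀ u v : Euc n, ricTensor g x u v = bilinOfMatrix (ricMat (paramMatrix e.symm g) (e x))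
        (mfderiv 𝓘(ℝ, Euc n) 𝓘(ℝ, Euc n) e x u) (mfderiv 𝓘(ℝ, Euc n) 𝓘(ℝ, Euc n) e x v) :=
      fun _ _ => rfl
    refine (this _ _).trans ?_
    refine (congrArg₂ (fun a b : Euc n => bilinOfMatrix (ricMat (paramMatrix e.symm g) (e x)) a b)
      (hD _) (hD _)).trans ?_
    simp [bilinOfMatrix_apply, stdVec]
  obtain ⟨τ, h1, h2, -, h4⟩ := hf.exists_pullMat hpc hle.symm
  have hm : MetricAt (paramMatrix e.symm g) (e x) := by
    obtain ⟨τ', h1', h2', h3'⟩ := hf.exists_chart_pullMat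
    exact (h1'.metricAt (by rwa [h2'])).congr (h3' g)
  rw [(h4 (ricTensor g)).self_of_nhds, ricMat_congr (h4 g), h1.ricMat_pullMat (by rwa [h2]), pullMat,
    h2, h0]

lemma IsRiemannian.smoothSym_ricTensor (hg : IsRiemannian g) : SmoothSym (ricTensor g) where
  smooth x := by
    have hp := isParam_chart (n := n) x
    have hx : (chartAt (Euc n) x).symm (chartAt (Euc n) x x) = x :=
      (chartAt (Euc n) x).left_inv (mem_chart_source _ x)
    rw [← hx]
    refine smoothTensorAt_of_param hp ((hg.metricAt hp).smooth_ricMat.congr ?_)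
    filter_upwards [hp.eventually] with z hz using paramMatrix_ricTensor hz (hg.metricAt hz)
  symm x u v := by
    have hp := isParam_chart (n := n) x
    have hs := (hg.metricAt hp).ricMat_symm
    have : ∀ u v : Euc n, bilinOfMatrix (ricMat (paramMatrix (chartAt (Euc n) x).symm g)
        (chartAt (Euc n) x x)) u v = bilinOfMatrix (ricMat (paramMatrix (chartAt (Euc n) x).symm g)
        (chartAt (Euc n) x x)) v u := by
      intro u v
      simp only [bilinOfMatrix_apply]
      rw [Finset.sum_comm]
      exact Finset.sum_congr rfl fun i _ => Finset.sum_congr rfl fun j _ => by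
        rw [hs.apply i j]; ring
    exact this _ _

lemma IsRiemannian.continuous_trPair (hg : IsRiemannian g) (hh : SmoothSym h) :
    Continuous (trPair g h) := by
  refine continuous_of_param (n := n) fun x => ?_
  have hp := isParam_chart (n := n) x
  have hm := hg.metricAt hp
  refine ((hm.smoothAt.inv hm.det_ne).mul (hh.symAt hp).smoothAt).trace.continuousAt.congr ?_
  filter_upwards [hp.eventually] with z hz using (trPair_param hz).symm

lemma IsRiemannian.continuous_tensorPair {s : TwoTensor n X} (hg : IsRiemannian g)
    (hs : SmoothSym s) (hh : SmoothSym h) : Continuous (tensorPair g s h) := by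
  refine continuous_of_param (n := n) fun x => ?_
  have hp := isParam_chart (n := n) x
  have hm := hg.metricAt hp
  have hi := hm.smoothAt.inv hm.det_ne
  refine ((hi.mul (hs.symAt hp).smoothAt).mul
    (hi.mul (hh.symAt hp).smoothAt)).trace.continuousAt.congr ?_
  filter_upwards [hp.eventually] with z hz using (tensorPair_param s hz).symm

lemma IsRiemannian.continuous_volRatio (hg : IsRiemannian g) (hk : SmoothSym k) :
    Continuous (volRatio g k) := by
  refine continuous_of_param (n := n) fun x => ?_
  have hp := isParam_chart (n := n) x
  have hm := hg.metricAt hp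
  have h1 : ContinuousAt (fun z => √(paramMatrix (chartAt (Euc n) x).symm k z).det
      / √(paramMatrix (chartAt (Euc n) x).symm g z).det) (chartAt (Euc n) x x) :=
    (Real.continuous_sqrt.continuousAt.comp (hk.symAt hp).smoothAt.det.continuousAt).div
      (hm.smoothAt.sqrt_det hm.det_ne).continuousAt (Real.sqrt_pos.2 hm.det_pos).ne'
  refine h1.congr ?_
  filter_upwards [hp.eventually] with z hz using (volRatio_param hz).symm

/-- Stated for positive determinant because this is what `UniformlyVaries` supplies for g + th. -/
lemma SmoothSym.continuous_scalarCurvature (hk : SmoothSym k)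
    (hd : ∀ x, 0 < (matAt k x).det) : Continuous (scalarCurvature k) := by
  refine continuous_of_param (n := n) fun x => ?_
  have hp := isParam_chart (n := n) x
  have hm : ∀ {z}, IsParam (chartAt (Euc n) x).symm z →
      MetricAt (paramMatrix (chartAt (Euc n) x).symm k) z := fun hz =>
    ⟨(hk.symAt hz).smooth, (hk.symAt hz).symm, det_pos_param hz (hd _)⟩
  refine (hm hp).contDiffAt_coordScalar.continuousAt.congr ?_
  filter_upwards [hp.eventually] with z hz using (scalarCurvature_param hz (hm hz)).symm

lemma IsRiemannian.continuous_scalarCurvature (hg : IsRiemannian g) :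
    Continuous (scalarCurvature g) :=
  hg.toSmoothSym.continuous_scalarCurvature fun x => (hg.metricAt (isParam_chart x)).det_pos

end Invariants

/-! ### The Riemannian volume measure in parametrizations -/

section Volume

variable {n : ℕ} {X : Type*} [TopologicalSpace X] [ChartedSpace (Euc n) X]

/-- `f` is a local diffeomorphism on the open set `W`. -/
structure ParamOn (f : Euc n → X) (W : Set (Euc n)) : Prop where
  isOpen : IsOpen W
  param : ∀ y ∈ W, IsParam f y

lemma ParamOn.mono {f : Euc n → X} {W V : Set (Euc n)} (h : ParamOn f W) (hV : V ⊆ W)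
    (ho : IsOpen V) : ParamOn f V := ⟨ho, fun y hy => h.param y (hV hy)⟩

lemma ParamOn.continuousOn {f : Euc n → X} {W : Set (Euc n)} (h : ParamOn f W) :
    ContinuousOn f W := fun y hy => (h.param y hy).contMDiffAt.continuousAt.continuousWithinAt

lemma IsParam.map_nhds {f : Euc n → X} {y : Euc n} (hf : IsParam f y) :
    Filter.map f (𝓝 y) = 𝓝 (f y) := by
  obtain ⟨Φ, hy, he⟩ := hf
  have h1 : f =ᶠ[𝓝 y] Φ := by
    filter_upwards [Φ.open_source.mem_nhds hy] with z hz using he hz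
  rw [Filter.map_congr h1, he hy]
  exact Φ.toOpenPartialHomeomorph.map_nhds_eq hy

lemma ParamOn.isOpen_image {f : Euc n → X} {W : Set (Euc n)} (h : ParamOn f W) :
    IsOpen (f '' W) := by
  rw [isOpen_iff_mem_nhds]
  rintro _ ⟨y, hy, rfl⟩
  rw [← (h.param y hy).map_nhds]
  exact Filter.image_mem_map (h.isOpen.mem_nhds hy)

lemma paramOn_symm [IsManifold 𝓘(ℝ, Euc n) ∞ X]
    {e : OpenPartialHomeomorph X (Euc n)} (he : e ∈ atlas (Euc n) X) :
    ParamOn e.symm e.target := ⟨e.open_target, fun _ hy => isParam_symm he hy⟩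

lemma ParamOn.continuousOn_density [IsManifold 𝓘(ℝ, Euc n) ∞ X]
    {g : TwoTensor n X} {f : Euc n → X} {W : Set (Euc n)} (h : ParamOn f W)
    (hg : SmoothSym g) : ContinuousOn (fun y => √(paramMatrix f g y).det) W := fun y hy =>
  (Real.continuous_sqrt.continuousAt.comp
    (hg.symAt (h.param y hy)).smoothAt.det.continuousAt).continuousWithinAt

variable [MeasurableSpace X]

/-- The image under `f` of the density `√det` on `W`. -/
def paramVolume (g : TwoTensor n X) (f : Euc n → X) (W : Set (Euc n)) : Measure X :=
  (((volume : Measure (Euc n)).restrict W).withDensity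
    (fun y => ENNReal.ofReal (√(paramMatrix f g y).det))).map f

variable [BorelSpace X]

lemma ParamOn.measurableSet_inter_preimage {f : Euc n → X} {W : Set (Euc n)} (h : ParamOn f W)
    {A : Set X} (hA : MeasurableSet A) : MeasurableSet (W ∩ f ⁻¹' A) := by
  have h1 : Measurable (W.domRestrict f) :=
    (continuousOn_iff_continuous_domRestrict.1 h.continuousOn).measurable
  have h2 := MeasurableSet.subtype_image h.isOpen.measurableSet (h1 hA)
  convert h2 using 1
  ext y
  simp [and_comm]

lemma ParamOn.aemeasurable {f : Euc n → X} {W : Set (Euc n)} (h : ParamOn f W) (D : Euc n → ENNReal) :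
    AEMeasurable f (((volume : Measure (Euc n)).restrict W).withDensity D) :=
  (h.continuousOn.aemeasurable h.isOpen.measurableSet).mono_ac (withDensity_absolutelyContinuous _ _)

lemma paramVolume_apply {f : Euc n → X} {W : Set (Euc n)} (h : ParamOn f W) (g : TwoTensor n X)
    {A : Set X} (hA : MeasurableSet A) : paramVolume g f W A
      = ∫⁻ y in W ∩ f ⁻¹' A, ENNReal.ofReal (√(paramMatrix f g y).det) := by
  rw [paramVolume, Measure.map_apply_of_aemeasurable (h.aemeasurable _) hA, withDensity_apply',
    Measure.restrict_restrict' h.isOpen.measurableSet, Set.inter_comm]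

lemma paramVolume_inter {f : Euc n → X} {W : Set (Euc n)} (h : ParamOn f W) (g : TwoTensor n X)
    {A : Set X} (hA : MeasurableSet A) :
    paramVolume g f W (A ∩ f '' W) = paramVolume g f W A := by
  rw [paramVolume_apply h g hA, paramVolume_apply h g (hA.inter h.isOpen_image.measurableSet)]
  congr 2
  ext y
  constructor
  · exact fun hy => ⟨hy.1, hy.2.1⟩
  · exact fun hy => ⟨hy.1, hy.2, y, hy.1, rfl⟩

/-- The volume measures of two parametrizations agree. -/
lemma paramVolume_eq {f f' : Euc n → X} {W W' : Set (Euc n)} (h : ParamOn f W) (hi : W.InjOn f)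
    (h' : ParamOn f' W') (hi' : W'.InjOn f') (g : TwoTensor n X) {A : Set X} (hA : MeasurableSet A)
    (hAW : A ⊆ f '' W) (hAW' : A ⊆ f' '' W') : paramVolume g f W A = paramVolume g f' W' A := by
  rw [paramVolume_apply h g hA, paramVolume_apply h' g hA]
  set S := W ∩ f ⁻¹' A with hS
  set S' := W' ∩ f' ⁻¹' A with hS'
  have hSm : MeasurableSet S := h.measurableSet_inter_preimage hA
  -- The transition map f'⁻¹ ∘ f, for which the change of variables formula is applied.
  let θ : Euc n → Euc n := fun y => Function.invFunOn f' W' (f y)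
  have hθ (y) (hy : y ∈ S) : θ y ∈ W' ∧ f' (θ y) = f y := by
    have hex : ∃ a ∈ W', f' a = f y := hAW' hy.2
    exact ⟨Function.invFunOn_mem hex, Function.invFunOn_eq hex⟩
  have himg : θ '' S = S' := by
    ext z
    constructor
    · rintro ⟨y, hy, rfl⟩
      obtain ⟨h1, h2⟩ := hθ y hy
      exact ⟨h1, by simpa [h2] using hy.2⟩
    · rintro ⟨hz, hzA⟩
      obtain ⟨y, hy, hyz⟩ := hAW hzA
      have hyS : y ∈ S := ⟨hy, by simpa [hyz] using hzA⟩
      exact ⟨y, hyS, hi' (hθ y hyS).1 hz ((hθ y hyS).2.trans hyz)⟩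
  have hinj : S.InjOn θ := by
    intro a ha b hb hab
    refine hi ha.1 hb.1 ?_
    rw [← (hθ a ha).2, ← (hθ b hb).2, hab]
  -- The choice function θ agrees near each point with a smooth coordinate change, by injectivity of
  -- f' on W'; so it is differentiable, and its Jacobian relates the two densities.
  have hloc (y) (hy : y ∈ S) : ∃ τ, CoordChangeAt τ y ∧ τ y = θ y ∧ θ =ᶠ[𝓝 y] τ ∧
      paramMatrix f g y = pullMat τ (paramMatrix f' g) y := by
    obtain ⟨h1, h2⟩ := hθ y hy
    obtain ⟨τ, t1, t2, t3, t4⟩ := (h.param y hy.1).exists_pullMat (h'.param _ h1) h2.symm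
    refine ⟨τ, t1, t2, ?_, (t4 g).self_of_nhds⟩
    have hW' : ∀ᶠ z in 𝓝 y, τ z ∈ W' :=
      t1.tendsto.eventually (h'.isOpen.mem_nhds (by rwa [t2]))
    filter_upwards [t3, hW'] with z hz hzW
    have hex : ∃ a ∈ W', f' a = f z := ⟨τ z, hzW, hz.symm⟩
    exact hi' (Function.invFunOn_mem hex) hzW ((Function.invFunOn_eq hex).trans hz)
  have hder (y) (hy : y ∈ S) : HasFDerivWithinAt θ (fderiv ℝ θ y) S y := by
    obtain ⟨τ, t1, -, t3, -⟩ := hloc y hy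
    exact (t1.diff.congr_of_eventuallyEq t3).hasFDerivAt.hasFDerivWithinAt
  rw [← himg, lintegral_image_eq_lintegral_abs_det_fderiv_mul _ hSm hder hinj]
  refine setLIntegral_congr_fun hSm fun y hy => ?_
  obtain ⟨τ, t1, t2, t3, t4⟩ := hloc y hy
  simp only [t4, sqrt_det_pullMat, t3.fderiv_eq, det_fderiv t1.diff, t2]
  rw [ENNReal.ofReal_mul (abs_nonneg _)]


variable [IsManifold 𝓘(ℝ, Euc n) ∞ X]

lemma integral_paramVolume {g : TwoTensor n X} {f : Euc n → X} {W : Set (Euc n)} (h : ParamOn f W)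
    (hg : SmoothSym g) {ψ : X → ℝ} (hψ : Continuous ψ) :
    ∫ x, ψ x ∂(paramVolume g f W) = ∫ y in W, √(paramMatrix f g y).det * ψ (f y) := by
  rw [paramVolume, integral_map (h.aemeasurable _) hψ.aestronglyMeasurable,
    integral_withDensity_eq_integral_toReal_smul₀
      ((h.continuousOn_density hg).aemeasurable h.isOpen.measurableSet).ennreal_ofReal
      (Filter.Eventually.of_forall fun _ => ENNReal.ofReal_lt_top)]
  refine integral_congr_ae (Filter.Eventually.of_forall fun y => ?_)
  simp only [ENNReal.toReal_ofReal (Real.sqrt_nonneg _), smul_eq_mul]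

variable [SecondCountableTopology X]

/-- The volume measure in a parametrization. -/
lemma volumeMeasure_apply {f : Euc n → X} {W : Set (Euc n)} (h : ParamOn f W) (hi : W.InjOn f)
    (g : TwoTensor n X) {A : Set X} (hA : MeasurableSet A) (hAW : A ⊆ f '' W) :
    volumeMeasure g A = paramVolume g f W A := by
  rcases isEmpty_or_nonempty X with hX | hX
  · rw [Set.eq_empty_of_isEmpty A]; simp
  obtain ⟨s, hsc, hs⟩ := TopologicalSpace.countable_cover_nhds
    (f := fun x : X => (chartAt (Euc n) x).source)
    fun x => (chartAt (Euc n) x).open_source.mem_nhds (mem_chart_source _ x)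
  have hsne : s.Nonempty := by
    obtain ⟨x⟩ := hX
    have : x ∈ ⋃ x ∈ s, (chartAt (Euc n) x).source := by rw [hs]; trivial
    simp only [Set.mem_iUnion] at this
    exact ⟨this.choose, this.choose_spec.choose⟩
  obtain ⟨c, rfl⟩ := hsc.exists_eq_range hsne
  let U : ℕ → Set X := fun i => (chartAt (Euc n) (c i)).source
  have hU : ⋃ i, U i = Set.univ := by
    rw [← hs, Set.biUnion_range]
  have hUm (i) : MeasurableSet (U i) := (chartAt (Euc n) (c i)).open_source.measurableSet
  let D := disjointed U
  have hDm (i) : MeasurableSet (D i) := MeasurableSet.disjointed hUm i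
  have hDU (i) : D i ⊆ U i := disjointed_subset U i
  have hDd : Pairwise (Function.onFun Disjoint D) := disjoint_disjointed U
  have hDun : ⋃ i, D i = Set.univ := by rw [iUnion_disjointed, hU]
  -- The measure glued from countably many charts along a disjoint partition. By `paramVolume_eq` it
  -- agrees with every injective parametrization, so it remains to compare it with the supremum.
  let ρ : Measure X := Measure.sum fun i => (chartVolume g (chartAt (Euc n) (c i))).restrict (D i)
  have hsplit (μ : Measure X) (B : Set X) (hB : MeasurableSet B) : μ B = ∑' i, μ (B ∩ D i) := by
    rw [← measure_iUnion (fun i j hij => ((hDd hij).mono Set.inter_subset_right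
      Set.inter_subset_right)) fun i => hB.inter (hDm i), ← Set.inter_iUnion, hDun, Set.inter_univ]
  have hρ_apply (B : Set X) (hB : MeasurableSet B) :
      ρ B = ∑' i, chartVolume g (chartAt (Euc n) (c i)) (B ∩ D i) := by
    rw [Measure.sum_apply _ hB]
    exact tsum_congr fun i => Measure.restrict_apply hB
  have hρ {f : Euc n → X} {W : Set (Euc n)} (h : ParamOn f W) (hi : W.InjOn f) {A : Set X}
      (hA : MeasurableSet A) (hAW : A ⊆ f '' W) : ρ A = paramVolume g f W A := by
    rw [hρ_apply A hA, hsplit _ A hA]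
    refine tsum_congr fun i => ?_
    refine paramVolume_eq (paramOn_symm (chart_mem_atlas _ (c i)))
      (chartAt (Euc n) (c i)).symm.injOn h hi g (hA.inter (hDm i)) ?_
      (Set.inter_subset_left.trans hAW)
    rw [(chartAt (Euc n) (c i)).symm_image_target_eq_source]
    exact Set.inter_subset_right.trans (hDU i)
  have hle : volumeMeasure g ≤ ρ := by
    refine iSup₂_le fun e he => Measure.le_iff.2 fun B hB => ?_
    have h1 := paramVolume_inter (paramOn_symm he) g hB
    change paramVolume g e.symm e.target B ≤ _
    rw [← h1, ← hρ (paramOn_symm he) e.symm.injOn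
      (hB.inter (paramOn_symm he).isOpen_image.measurableSet) Set.inter_subset_right]
    exact measure_mono Set.inter_subset_left
  -- One bound holds because ρ dominates every chart volume; for the other, the chart volume used on
  -- each piece of the partition lies below the supremum.
  refine le_antisymm ((hle A).trans_eq (hρ h hi hA hAW)) ?_
  rw [← hρ h hi hA hAW, hρ_apply A hA, hsplit _ A hA]
  refine ENNReal.tsum_le_tsum fun i => ?_
  have : chartVolume g (chartAt (Euc n) (c i)) ≤ volumeMeasure g :=
    le_iSup₂ (f := fun e (_ : e ∈ atlas (Euc n) X) => chartVolume g e) _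
      (chart_mem_atlas _ (c i))
  exact this _

lemma volumeMeasure_restrict {f : Euc n → X} {W : Set (Euc n)} (h : ParamOn f W) (hi : W.InjOn f)
    (g : TwoTensor n X) : (volumeMeasure g).restrict (f '' W) = paramVolume g f W := by
  ext A hA
  rw [Measure.restrict_apply hA, ← paramVolume_inter h g hA]
  exact volumeMeasure_apply h hi g (hA.inter h.isOpen_image.measurableSet) Set.inter_subset_right

/-- The volume measures of two tensors differ by the ratio of their densities. -/
lemma volumeMeasure_eq_withDensity {g k : TwoTensor n X} (hg : IsRiemannian g) (hk : SmoothSym k) :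
    volumeMeasure k = (volumeMeasure g).withDensity fun x => ENNReal.ofReal (volRatio g k x) := by
  have hmeas : Measurable fun x => ENNReal.ofReal (volRatio g k x) :=
    (hg.continuous_volRatio hk).measurable.ennreal_ofReal
  -- Measures that agree on the members of a countable open cover are equal, so a chart around each
  -- point suffices.
  have hloc : ∀ x : X, ∃ U ∈ 𝓝 x, (volumeMeasure k).restrict U
      = ((volumeMeasure g).withDensity fun x => ENNReal.ofReal (volRatio g k x)).restrict U := by
    intro x
    set e := chartAt (Euc n) x
    have he : e ∈ atlas (Euc n) X := chart_mem_atlas _ x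
    have hp := paramOn_symm he
    refine ⟨e.symm '' e.target, ?_, ?_⟩
    · rw [e.symm_image_target_eq_source]
      exact e.open_source.mem_nhds (mem_chart_source _ x)
    · rw [restrict_withDensity hp.isOpen_image.measurableSet,
        volumeMeasure_restrict hp e.symm.injOn, volumeMeasure_restrict hp e.symm.injOn]
      ext A hA
      rw [withDensity_apply _ hA, paramVolume_apply hp k hA, paramVolume,
        ← lintegral_indicator hA, lintegral_map' (hmeas.indicator hA).aemeasurable
          (hp.aemeasurable _),
        lintegral_withDensity_eq_lintegral_mul_non_measurable₀ _
          ((hp.continuousOn_density hg.toSmoothSym).aemeasurable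
            e.open_target.measurableSet).ennreal_ofReal
          (Filter.Eventually.of_forall fun _ => ENNReal.ofReal_lt_top),
        ← lintegral_indicator (hp.measurableSet_inter_preimage hA),
        ← lintegral_indicator e.open_target.measurableSet]
      refine lintegral_congr fun y => ?_
      by_cases hy : y ∈ e.target
      · by_cases hyA : e.symm y ∈ A
        · rw [Set.indicator_of_mem (show y ∈ e.target ∩ e.symm ⁻¹' A from ⟨hy, hyA⟩),
            Set.indicator_of_mem hy, Pi.mul_apply, Set.indicator_of_mem hyA,
            volRatio_param (hp.param y hy), ← ENNReal.ofReal_mul (Real.sqrt_nonneg _),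
            mul_div_cancel₀ _ (Real.sqrt_pos.2 (hg.metricAt (hp.param y hy)).det_pos).ne']
        · rw [Set.indicator_of_notMem fun h => hyA h.2, Set.indicator_of_mem hy, Pi.mul_apply,
            Set.indicator_of_notMem hyA, mul_zero]
      · rw [Set.indicator_of_notMem fun h => hy h.1, Set.indicator_of_notMem hy]
  obtain ⟨s, hsc, hs⟩ := TopologicalSpace.countable_cover_nhds
    (f := fun x : X => (hloc x).choose) fun x => (hloc x).choose_spec.1
  exact (Measure.ext_iff_of_biUnion_eq_univ hsc hs).2 fun x _ => (hloc x).choose_spec.2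

end Volume

/-! ### Orbifold charts -/

section OrbifoldCharts

variable {n : ℕ} {M : Type*} [TopologicalSpace M] {O : IsolatedOrbifold n M}

lemma isParam_unifReg {p : O.sing} {y : Euc n} (hy : y ∈ Metric.ball (0 : Euc n) (O.radius p))
    (h0 : y ≠ 0) : IsParam (O.unifReg p) y := O.unifReg_diffeo p ⟨y, hy, h0⟩

lemma paramOn_unifReg (p : O.sing) {r : ℝ} (hr : r ≤ O.radius p) :
    ParamOn (O.unifReg p) (Metric.ball 0 r \ {0}) where
  isOpen := Metric.isOpen_ball.sdiff isClosed_singleton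
  param _ hy := isParam_unifReg (Metric.ball_subset_ball hr hy.1) hy.2

lemma unifReg_eq_iff {p : O.sing} {y z : Euc n} (hy : y ∈ Metric.ball (0 : Euc n) (O.radius p))
    (hy0 : y ≠ 0) (hz : z ∈ Metric.ball (0 : Euc n) (O.radius p)) (hz0 : z ≠ 0) :
    O.unifReg p y = O.unifReg p z ↔ ∃ γ ∈ O.grp p, γ y = z := by
  rw [← O.unif_eq_iff p y hy z hz, ← O.unifReg_coe p y hy hy0, ← O.unifReg_coe p z hz hz0,
    Subtype.coe_inj]

lemma unifReg_smul {p : O.sing} {γ : Euc n ≃ₗᵢ[ℝ] Euc n} (hγ : γ ∈ O.grp p) {y : Euc n}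
    (hy : y ∈ Metric.ball (0 : Euc n) (O.radius p)) (hy0 : y ≠ 0) :
    O.unifReg p (γ y) = O.unifReg p y := by
  refine ((unifReg_eq_iff hy hy0 ?_ ?_).2 ⟨γ, hγ, rfl⟩).symm
  · simpa using hy
  · simpa using hy0

lemma unif_eq_coe {p : O.sing} {z : Euc n} (hz : z ∈ Metric.ball (0 : Euc n) (O.radius p))
    {x : O.Reg} (h : O.unif p z = x) : z ≠ 0 ∧ O.unifReg p z = x := by
  have h0 : z ≠ 0 := by
    rintro rfl
    rw [O.unif_zero] at h
    exact x.2 (h ▸ p.2)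
  exact ⟨h0, Subtype.ext ((O.unifReg_coe p z hz h0).trans h)⟩

/-- The values of `f` at the points of `D` near `y` fill the regular part of a neighbourhood
of `m`. -/
def Covers (f : Euc n → O.Reg) (D : Set (Euc n)) (y : Euc n) (m : M) : Prop :=
  ∀ U ∈ 𝓝 y, ∃ N ∈ 𝓝 m, ∀ x : O.Reg, (x : M) ∈ N → ∃ z ∈ U, z ∈ D ∧ f z = x

/-- Openness of the map from the ball to M makes images of small balls neighbourhoods of p; a
preimage of a regular point is never the origin. -/
lemma covers_unifReg (p : O.sing) : Covers (O.unifReg p) (Metric.ball 0 (O.radius p) \ {0}) 0 (p : M) := by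
  intro U hU
  obtain ⟨V, hVU, hVo, hV0⟩ := mem_nhds_iff.1
    (Filter.inter_mem hU (Metric.ball_mem_nhds (0 : Euc n) (O.radius_pos p)))
  refine ⟨O.unif p '' V, (O.unif_open p V (fun z hz => (hVU hz).2) hVo).mem_nhds
    ⟨0, hV0, O.unif_zero p⟩, ?_⟩
  rintro x ⟨z, hz, hzx⟩
  obtain ⟨h0, h1⟩ := unif_eq_coe (hVU hz).2 hzx
  exact ⟨z, (hVU hz).1, ⟨(hVU hz).2, h0⟩, h1⟩

lemma isOpen_regular [T2Space M] : IsOpen {x : M | x ∉ O.sing} :=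
  (Finset.finite_toSet O.sing).isClosed.isOpen_compl

lemma covers_chart [T2Space M] (x : O.Reg) :
    Covers (chartAt (Euc n) x).symm (chartAt (Euc n) x).target (chartAt (Euc n) x x) (x : M) := by
  intro U hU
  set e := chartAt (Euc n) x
  have h1 : e.source ∩ e ⁻¹' U ∈ 𝓝 x := Filter.inter_mem
    (e.open_source.mem_nhds (mem_chart_source _ x))
    ((e.continuousAt (mem_chart_source _ x)).preimage_mem_nhds hU)
  refine ⟨Subtype.val '' (e.source ∩ e ⁻¹' U),
    (isOpen_regular.isOpenEmbedding_subtypeVal.isOpenMap).image_mem_nhds h1, ?_⟩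
  rintro x' ⟨x'', ⟨h2, h3⟩, h4⟩
  obtain rfl := Subtype.ext h4
  exact ⟨e x'', h3, e.map_source h2, e.left_inv h2⟩

/-- `H` extends the coordinate matrix of `h` in the parametrization `f` near `y`. -/
def LiftsAt (f : Euc n → O.Reg) (D : Set (Euc n)) (h : TwoTensor n O.Reg) (y : Euc n)
    (H : Euc n → Matrix (Fin n) (Fin n) ℝ) : Prop :=
  ∀ᶠ z in 𝓝 y, z ∈ D → paramMatrix f h z = H z

lemma smoothSym_of_mem {h : TwoTensor n O.Reg} (hh : h ∈ O.symTensors) : SmoothSym h :=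
  ⟨(smoothTensor_iff h).1 hh.1, hh.2.1⟩

lemma isRiemannian_of_mem {g : TwoTensor n O.Reg} (hg : g ∈ O.metrics) : IsRiemannian g where
  smooth := (smoothTensor_iff g).1 hg.1
  symm := hg.2.1
  pos := hg.2.2.1

/-- The coordinate matrices of an orbifold tensor extend smoothly to the uniformizing ball. -/
lemma exists_lift {h : TwoTensor n O.Reg} (hh : h ∈ O.symTensors) (p : O.sing) :
    ∃ H : Euc n → Matrix (Fin n) (Fin n) ℝ,
      (∀ y ∈ Metric.ball (0 : Euc n) (O.radius p), SymAt H y) ∧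
      ∀ y ∈ Metric.ball (0 : Euc n) (O.radius p), y ≠ 0 → paramMatrix (O.unifReg p) h y = H y := by
  obtain ⟨h', ⟨h1, -, h3⟩, h4⟩ := hh.2.2 p
  have ho (y : Euc n) (hy : y ∈ Metric.ball (0 : Euc n) (O.radius p)) :
      ∀ᶠ z in 𝓝 y, z ∈ Metric.ball (0 : Euc n) (O.radius p) := Metric.isOpen_ball.mem_nhds hy
  refine ⟨fun z => Matrix.of fun i j => h' z (stdVec i) (stdVec j), fun y hy => ⟨?_, ?_⟩, ?_⟩
  · filter_upwards [ho y hy] with z hz i j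
    have := (h1.contDiffAt (Metric.isOpen_ball.mem_nhds hz))
    exact (this.clm_apply contDiffAt_const).clm_apply contDiffAt_const
  · filter_upwards [ho y hy] with z hz
    exact Matrix.IsSymm.ext fun i j => h4 z hz _ _
  · intro y hy h0
    ext i j
    exact h3 y hy h0 _ _

lemma exists_lift_metric {g : TwoTensor n O.Reg} (hg : g ∈ O.metrics) (p : O.sing) :
    ∃ G : Euc n → Matrix (Fin n) (Fin n) ℝ,
      (∀ y ∈ Metric.ball (0 : Euc n) (O.radius p), MetricAt G y) ∧
      ∀ y ∈ Metric.ball (0 : Euc n) (O.radius p), y ≠ 0 → paramMatrix (O.unifReg p) g y = G y := by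
  obtain ⟨h', ⟨h1, -, h3⟩, h4⟩ := hg.2.2.2 p
  have ho (y : Euc n) (hy : y ∈ Metric.ball (0 : Euc n) (O.radius p)) :
      ∀ᶠ z in 𝓝 y, z ∈ Metric.ball (0 : Euc n) (O.radius p) := Metric.isOpen_ball.mem_nhds hy
  refine ⟨fun z => Matrix.of fun i j => h' z (stdVec i) (stdVec j), fun y hy => ⟨?_, ?_, ?_⟩, ?_⟩
  · filter_upwards [ho y hy] with z hz i j
    have := (h1.contDiffAt (Metric.isOpen_ball.mem_nhds hz))
    exact (this.clm_apply contDiffAt_const).clm_apply contDiffAt_const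
  · filter_upwards [ho y hy] with z hz
    exact Matrix.IsSymm.ext fun i j => (h4 z hz).1 _ _
  · exact (posDef_ofBilin (h4 y hy).1 (h4 y hy).2).det_pos
  · intro y hy h0
    ext i j
    exact h3 y hy h0 _ _

/-- Around every point of the orbifold there is a chart in which metrics and symmetric tensors have
smooth coordinate matrices. -/
lemma exists_orbifold_chart [T2Space M] (m : M) : ∃ (f : Euc n → O.Reg) (D : Set (Euc n)) (y : Euc n),
    ParamOn f D ∧ Covers f D y m ∧
    (∀ h ∈ O.symTensors, ∃ H, SymAt H y ∧ LiftsAt f D h y H) ∧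
    ∀ g ∈ O.metrics, ∃ G, MetricAt G y ∧ LiftsAt f D g y G := by
  by_cases hm : m ∈ O.sing
  · have hb := Metric.mem_ball_self (x := (0 : Euc n)) (O.radius_pos ⟨m, hm⟩)
    refine ⟨O.unifReg ⟨m, hm⟩, _, 0, paramOn_unifReg ⟨m, hm⟩ le_rfl, covers_unifReg ⟨m, hm⟩, fun h hh => ?_, fun g hg => ?_⟩
    · obtain ⟨H, h1, h2⟩ := exists_lift hh ⟨m, hm⟩
      exact ⟨H, h1 0 hb, Filter.Eventually.of_forall fun z hz => h2 z hz.1 hz.2⟩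
    · obtain ⟨G, h1, h2⟩ := exists_lift_metric hg ⟨m, hm⟩
      exact ⟨G, h1 0 hb, Filter.Eventually.of_forall fun z hz => h2 z hz.1 hz.2⟩
  · have hp := isParam_chart (n := n) (⟨m, hm⟩ : O.Reg)
    exact ⟨_, _, _, paramOn_symm (chart_mem_atlas _ _), covers_chart ⟨m, hm⟩,
      fun h hh => ⟨_, (smoothSym_of_mem hh).symAt hp, Filter.Eventually.of_forall fun _ _ => rfl⟩,
      fun g hg => ⟨_, (isRiemannian_of_mem hg).metricAt hp,
        Filter.Eventually.of_forall fun _ _ => rfl⟩⟩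

end OrbifoldCharts

/-! ### Topology of the regular part -/

section RegularPart

variable {n : ℕ} {M : Type*} [TopologicalSpace M] {O : IsolatedOrbifold n M}

/-- Finitely many orbifold charts cover the compact M, and the image of a subset of ℝⁿ under a
continuous map is Lindelöf. The resulting second countability is needed for the volume measure and
for partitions of unity. -/
lemma exists_countable_charts [CompactSpace M] [T2Space M] (O : IsolatedOrbifold n M) :
    ∃ t : Set O.Reg, t.Countable ∧ ∀ x : O.Reg, x ∈ ⋃ y ∈ t, (chartAt (Euc n) y).source := by
  have key : ∃ t : Set O.Reg, t.Countable ∧ ∀ x : O.Reg, (x : M) ∈ (Set.univ : Set M) →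
      x ∈ ⋃ y ∈ t, (chartAt (Euc n) y).source := by
    refine isCompact_univ.induction_on (p := fun s : Set M => ∃ t : Set O.Reg, t.Countable ∧
      ∀ x : O.Reg, (x : M) ∈ s → x ∈ ⋃ y ∈ t, (chartAt (Euc n) y).source)
      ⟨∅, Set.countable_empty, fun x hx => hx.elim⟩ ?_ ?_ ?_
    · rintro s s' hs ⟨t, h1, h2⟩
      exact ⟨t, h1, fun x hx => h2 x (hs hx)⟩
    · rintro s s' ⟨t, h1, h2⟩ ⟨t', h1', h2'⟩
      refine ⟨t ∪ t', h1.union h1', fun x hx => ?_⟩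
      rw [Set.biUnion_union]
      exact hx.imp (h2 x) (h2' x)
    · intro m _
      obtain ⟨f, D, y, h1, h2, -⟩ := exists_orbifold_chart (O := O) m
      obtain ⟨N, hN, h3⟩ := h2 Set.univ Filter.univ_mem
      have h4 : IsLindelof (f '' D) :=
        (HereditarilyLindelofSpace.isLindelof D).image_of_continuousOn h1.continuousOn
      obtain ⟨t, ht, -, h5⟩ := h4.elim_nhds_subcover (fun x => (chartAt (Euc n) x).source)
        fun x _ => (chartAt (Euc n) x).open_source.mem_nhds (mem_chart_source _ x)
      refine ⟨N, mem_nhdsWithin_of_mem_nhds hN, t, ht, fun x hx => ?_⟩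
      obtain ⟨z, -, hz, rfl⟩ := h3 x hx
      exact h5 ⟨z, hz, rfl⟩
  obtain ⟨t, h1, h2⟩ := key
  exact ⟨t, h1, fun x => h2 x trivial⟩

instance secondCountable_reg [CompactSpace M] [T2Space M] : SecondCountableTopology O.Reg := by
  obtain ⟨t, h1, h2⟩ := exists_countable_charts O
  exact ChartedSpace.secondCountable_of_countable_cover (Euc n) (Set.eq_univ_of_forall h2) h1

instance locallyCompact_reg : LocallyCompactSpace O.Reg :=
  ChartedSpace.locallyCompactSpace (Euc n) O.Reg

/-- A property of subsets of the orbifold that holds locally in orbifold charts holds globally. -/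
lemma orbifold_induction [CompactSpace M] {p : Set O.Reg → Prop} (h0 : p ∅)
    (hmono : ∀ s t, s ⊆ t → p t → p s) (hunion : ∀ s t, p s → p t → p (s ∪ t))
    (hloc : ∀ m : M, ∃ N ∈ 𝓝 m, p (Subtype.val ⁻¹' N)) : p Set.univ := by
  refine isCompact_univ.induction_on (p := fun s : Set M => p (Subtype.val ⁻¹' s)) h0
    (fun s t hs ht => hmono _ _ (Set.preimage_mono hs) ht) (fun s t hs ht => hunion _ _ hs ht)
    fun m _ => ?_
  obtain ⟨N, h1, h2⟩ := hloc m
  exact ⟨N, mem_nhdsWithin_of_mem_nhds h1, h2⟩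

/-- Compactly supported tensors on the regular part are orbifold tensors. -/
lemma mem_symTensors_of_compact [T2Space M] {h : TwoTensor n O.Reg} (hh : SmoothSym h)
    {K : Set O.Reg} (hK : IsCompact K) (hz : ∀ x ∉ K, h x = 0) : h ∈ O.symTensors := by
  refine ⟨(smoothTensor_iff h).2 hh.smooth, hh.symm, fun p => ?_⟩
  set f := O.unifReg p with hf
  set B := Metric.ball (0 : Euc n) (O.radius p) with hB
  -- K is compact in M and misses p, so the tensor vanishes on a punctured neighbourhood of the
  -- origin and its lift extends by zero.
  have hzero : ∀ᶠ z in 𝓝 (0 : Euc n), z ≠ 0 → paramMatrix f h z = 0 := by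
    have hc : IsClosed (Subtype.val '' K : Set M) := (hK.image continuous_subtype_val).isClosed
    have hp : O.unif p 0 ∈ (Subtype.val '' K : Set M)ᶜ := by
      rintro ⟨x, -, hx⟩
      rw [O.unif_zero] at hx
      exact x.2 (hx ▸ p.2)
    have hb : B ∈ 𝓝 (0 : Euc n) := Metric.ball_mem_nhds _ (O.radius_pos p)
    have hcont := (O.unif_continuousOn p).continuousAt hb
    filter_upwards [hcont.eventually (hc.isOpen_compl.mem_nhds hp), hb] with z hz1 hzB h0
    have : f z ∉ K := fun hk => hz1 ⟨f z, hk, O.unifReg_coe p z hzB h0⟩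
    ext i j
    simp only [paramMatrix, Matrix.of_apply, pullback]
    rw [hz _ this]
    rfl
  let h' : Euc n → Euc n →L[ℝ] Euc n →L[ℝ] ℝ := fun z =>
    bilinOfMatrix (if z = 0 then 0 else paramMatrix f h z)
  have h'0 : ∀ u v : Euc n, h' 0 u v = 0 := fun u v => by simp [h', bilinOfMatrix_apply]
  have h'1 (z : Euc n) (h0 : z ≠ 0) (u v : Euc n) : h' z u v = pullback f h z u v := by
    simp only [h', if_neg h0, bilin_eq_ofMatrix]
  refine ⟨h', ⟨fun z hzB => ContDiffAt.contDiffWithinAt ?_, fun γ hγ x hx u v => ?_,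
    fun x _ h0 u v => (h'1 x h0 u v).symm⟩, fun x hx u v => ?_⟩
  · refine contDiffAt_bilinOfMatrix ?_
    rcases eq_or_ne z 0 with rfl | h0
    · refine (MatSmoothAt.const (0 : Matrix (Fin n) (Fin n) ℝ)).congr ?_
      filter_upwards [hzero] with w hw
      split_ifs with hw0
      · rfl
      · exact hw hw0
    · refine ((hh.smooth (f z)).param (isParam_unifReg hzB h0)).congr ?_
      filter_upwards [isOpen_compl_singleton.mem_nhds h0] with w hw
      exact if_neg hw
  · rcases eq_or_ne x 0 with rfl | h0
    · rw [map_zero, h'0, h'0]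
    · have h0' : γ x ≠ 0 := by simpa using h0
      have hxB : γ x ∈ B := by simpa [hB] using hx
      rw [h'1 _ h0', h'1 _ h0]
      -- Invariance of the lift under Γ_p comes from f ∘ γ = f near x, by functoriality of the
      -- pullback.
      have hev : f ∘ γ =ᶠ[𝓝 x] f := by
        filter_upwards [Metric.isOpen_ball.mem_nhds hx, isOpen_compl_singleton.mem_nhds h0]
          with w hw hw0 using unifReg_smul hγ hw hw0
      rw [← pullback_congr hev, pullback_comp (isParam_unifReg hxB h0').mdiff
        γ.toContinuousLinearEquiv.differentiableAt]
      have : fderiv ℝ γ x = (γ.toContinuousLinearEquiv : Euc n →L[ℝ] Euc n) :=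
        γ.toContinuousLinearEquiv.fderiv
      rw [this]
      rfl
  · rcases eq_or_ne x 0 with rfl | h0
    · rw [h'0, h'0]
    · rw [h'1 _ h0, h'1 _ h0]
      exact hh.symm _ _ _

end RegularPart

/-! ### The volume measure in orbifold charts -/

section OrbitCount

variable {n : ℕ} {X : Type*} [TopologicalSpace X] [ChartedSpace (Euc n) X]

/-- The fibres of `f` on the invariant open set `W` are the orbits of the finite group `Γ`,
which acts freely on `W`. -/
structure IsOrbitMap (Γ : Subgroup (Euc n ≃ₗᵢ[ℝ] Euc n)) (f : Euc n → X) (W : Set (Euc n)) :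
    Prop extends ParamOn f W where
  smul_mem : ∀ γ ∈ Γ, ∀ y ∈ W, γ y ∈ W
  eq_iff : ∀ y ∈ W, ∀ z ∈ W, f y = f z ↔ ∃ γ ∈ Γ, γ y = z
  free : ∀ γ ∈ Γ, ∀ y ∈ W, γ y = y → γ = 1

variable [MeasurableSpace X] [BorelSpace X] [IsManifold 𝓘(ℝ, Euc n) ∞ X]
  [SecondCountableTopology X] {Γ : Subgroup (Euc n ≃ₗᵢ[ℝ] Euc n)} [Finite Γ] {f : Euc n → X}
  {W : Set (Euc n)}

/-- The preimage of A is the disjoint union of its parts in the translates γV, disjoint because the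
action is free. On each translate f is an injective parametrization, which contributes one copy of
the volume of A. -/
lemma IsOrbitMap.paramVolume_of_injOn (h : IsOrbitMap Γ f W) (g : TwoTensor n X)
    {V : Set (Euc n)} (hV : IsOpen V) (hVW : V ⊆ W) (hi : V.InjOn f) {A : Set X}
    (hA : MeasurableSet A) (hAV : A ⊆ f '' V) :
    paramVolume g f W A = Nat.card Γ * volumeMeasure g A := by
  have : Fintype Γ := Fintype.ofFinite Γ
  let V' : Γ → Set (Euc n) := fun γ => γ.1 '' V
  have hfγ (γ : Γ) (y : Euc n) (hy : y ∈ W) : f (γ.1 y) = f y :=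
    ((h.eq_iff y hy _ (h.smul_mem _ γ.2 y hy)).2 ⟨γ, γ.2, rfl⟩).symm
  have hV'o (γ : Γ) : IsOpen (V' γ) := γ.1.toHomeomorph.isOpenMap V hV
  have hV'W (γ : Γ) : V' γ ⊆ W := by
    rintro _ ⟨y, hy, rfl⟩
    exact h.smul_mem _ γ.2 y (hVW hy)
  have hV'p (γ : Γ) : ParamOn f (V' γ) := h.toParamOn.mono (hV'W γ) (hV'o γ)
  have hV'i (γ : Γ) : (V' γ).InjOn f := by
    rintro _ ⟨y, hy, rfl⟩ _ ⟨z, hz, rfl⟩ hyz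
    rw [hfγ γ y (hVW hy), hfγ γ z (hVW hz)] at hyz
    rw [hi hy hz hyz]
  have hAV' (γ : Γ) : A ⊆ f '' V' γ := by
    intro x hx
    obtain ⟨y, hy, rfl⟩ := hAV hx
    exact ⟨γ.1 y, ⟨y, hy, rfl⟩, hfγ γ y (hVW hy)⟩
  have hsplit : W ∩ f ⁻¹' A = ⋃ γ : Γ, V' γ ∩ f ⁻¹' A := by
    ext z
    simp only [Set.mem_iUnion]
    constructor
    · rintro ⟨hz, hzA⟩
      obtain ⟨y, hy, hyz⟩ := hAV hzA
      obtain ⟨γ, hγ, rfl⟩ := (h.eq_iff y (hVW hy) z hz).1 hyz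
      exact ⟨⟨γ, hγ⟩, ⟨y, hy, rfl⟩, hzA⟩
    · rintro ⟨γ, hz, hzA⟩
      exact ⟨hV'W γ hz, hzA⟩
  have hdisj : Pairwise (Function.onFun Disjoint fun γ : Γ => V' γ ∩ f ⁻¹' A) := by
    intro γ γ' hne
    refine Set.disjoint_left.2 ?_
    rintro _ ⟨⟨y, hy, rfl⟩, -⟩ ⟨⟨z, hz, hzy⟩, -⟩
    have h1 : f z = f y := by rw [← hfγ γ' z (hVW hz), hzy, hfγ γ y (hVW hy)]
    obtain rfl := hi hz hy h1
    refine hne (Subtype.ext ?_)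
    have h2 : (γ'.1⁻¹ * γ.1) z = z := by
      change γ'.1.symm (γ.1 z) = z
      rw [← hzy]
      exact γ'.1.symm_apply_apply z
    exact (inv_mul_eq_one.1 (h.free _ (Γ.mul_mem (Γ.inv_mem γ'.2) γ.2) z (hVW hz) h2)).symm
  rw [paramVolume_apply h.toParamOn g hA, hsplit,
    lintegral_iUnion (fun γ => (hV'p γ).measurableSet_inter_preimage hA) hdisj, tsum_fintype]
  have hterm (γ : Γ) : ∫⁻ y in V' γ ∩ f ⁻¹' A, ENNReal.ofReal (√(paramMatrix f g y).det)
      = volumeMeasure g A := by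
    rw [volumeMeasure_apply (hV'p γ) (hV'i γ) g hA (hAV' γ), paramVolume_apply (hV'p γ) g hA]
  simp [hterm]

/-- The volume measure in a quotient chart. -/
lemma IsOrbitMap.paramVolume_eq (h : IsOrbitMap Γ f W) (g : TwoTensor n X) :
    paramVolume g f W = (Nat.card Γ : ENNReal) • (volumeMeasure g).restrict (f '' W) := by
  have hV (y : Euc n) : ∃ V, y ∈ W → IsOpen V ∧ y ∈ V ∧ V ⊆ W ∧ V.InjOn f := by
    by_cases hy : y ∈ W
    · obtain ⟨Φ, h1, h2⟩ := h.param y hy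
      refine ⟨W ∩ Φ.source, fun _ => ⟨h.isOpen.inter Φ.open_source, ⟨hy, h1⟩,
        Set.inter_subset_left, ?_⟩⟩
      intro a ha b hb hab
      rw [h2 ha.2, h2 hb.2] at hab
      exact Φ.injOn ha.2 hb.2 hab
    · exact ⟨∅, fun h => absurd h hy⟩
  choose V hV using hV
  -- Countably many open sets on which f is injective cover W, so the count can be made on each of
  -- their images.
  obtain ⟨t, ht, htW, hcov⟩ := (HereditarilyLindelofSpace.isLindelof W).elim_nhds_subcover V
    fun y hy => (hV y hy).1.mem_nhds (hV y hy).2.1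
  have hU : f '' W = ⋃ y ∈ t, f '' V y := by
    rw [← Set.image_iUnion₂]
    exact (Set.image_mono hcov).antisymm
      (Set.image_mono (Set.iUnion₂_subset fun y hy => (hV y (htW y hy)).2.2.1))
  have h1 : (paramVolume g f W).restrict (f '' W)
      = ((Nat.card Γ : ENNReal) • volumeMeasure g).restrict (f '' W) := by
    rw [hU, Measure.restrict_biUnion_congr ht]
    intro y hy
    obtain ⟨h1, -, h2, h3⟩ := hV y (htW y hy)
    have hm : MeasurableSet (f '' V y) := (h.toParamOn.mono h2 h1).isOpen_image.measurableSet
    ext A hA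
    rw [Measure.restrict_apply hA, Measure.restrict_apply hA,
      h.paramVolume_of_injOn g h1 h2 h3 (hA.inter hm) Set.inter_subset_right]
    simp
  rw [← Measure.restrict_smul, ← h1]
  ext A hA
  rw [Measure.restrict_apply hA, paramVolume_inter h.toParamOn g hA]

end OrbitCount

/-! ### Finiteness of the total volume. -/

section OrbifoldVolume

variable {n : ℕ} {M : Type*} [TopologicalSpace M] {O : IsolatedOrbifold n M}

lemma isOrbitMap_unifReg (p : O.sing) {r : ℝ} (hr : r ≤ O.radius p) :
    IsOrbitMap (O.grp p) (O.unifReg p) (Metric.ball 0 r \ {0}) where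
  toParamOn := paramOn_unifReg p hr
  smul_mem γ _ y hy := by simpa using hy
  eq_iff y hy z hz := unifReg_eq_iff (Metric.ball_subset_ball hr hy.1) hy.2
    (Metric.ball_subset_ball hr hz.1) hz.2
  free γ hγ y hy h := O.grp_free p γ hγ y hy.2 h

variable [MeasurableSpace M] [BorelSpace M]

/-- An inequality is all that is assumed, since a uniformizing ball counts the volume of its image
|Γ_p| times. -/
lemma lt_top_of_le_paramVolume {g : TwoTensor n O.Reg} {f : Euc n → O.Reg} {D : Set (Euc n)}
    (hD : ParamOn f D) {y : Euc n} {r C : ℝ} (hr : D ⊆ Metric.ball y r)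
    (hC : ∀ z ∈ D, √(paramMatrix f g z).det ≤ C)
    (hle : volumeMeasure g (f '' D) ≤ paramVolume g f D Set.univ) :
    volumeMeasure g (f '' D) < ⊤ := by
  refine hle.trans_lt ?_
  rw [paramVolume_apply hD g MeasurableSet.univ, Set.preimage_univ, Set.inter_univ]
  calc _ ≤ ∫⁻ z in D, ENNReal.ofReal C :=
        setLIntegral_mono' hD.isOpen.measurableSet fun z hz => ENNReal.ofReal_le_ofReal (hC z hz)
    _ = ENNReal.ofReal C * volume D := by simp
    _ < ⊤ := ENNReal.mul_lt_top ENNReal.ofReal_lt_top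
        ((measure_mono hr).trans_lt measure_ball_lt_top)

/-- By compactness it suffices to find a neighbourhood of finite volume around each point. At a
singular point, the lift of g to the uniformizing ball is smooth at the origin, so its density is
bounded nearby. -/
lemma volumeMeasure_univ_lt_top [CompactSpace M] [T2Space M] {g : TwoTensor n O.Reg} (hg : g ∈ O.metrics) :
    volumeMeasure g Set.univ < ⊤ := by
  refine orbifold_induction (p := fun s => volumeMeasure g s < ⊤) (by simp)
    (fun s t hs ht => (measure_mono hs).trans_lt ht)
    (fun s t hs ht => measure_union_lt_top hs ht) fun m => ?_
  by_cases hm : m ∈ O.sing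
  · set p : O.sing := ⟨m, hm⟩
    obtain ⟨G, h1, h2⟩ := exists_lift_metric hg p
    have h0 := h1 0 (Metric.mem_ball_self (O.radius_pos p))
    have hc : ∀ᶠ z in 𝓝 (0 : Euc n), √(G z).det < √(G 0).det + 1 :=
      (h0.smoothAt.sqrt_det h0.det_ne).continuousAt.eventually_lt_const (lt_add_one _)
    obtain ⟨r', hr', hr'2⟩ := Metric.eventually_nhds_iff_ball.1 hc
    set r := min r' (O.radius p)
    have hr : 0 < r := lt_min hr' (O.radius_pos p)
    have hrp : r ≤ O.radius p := min_le_right _ _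
    obtain ⟨N, hN, hN2⟩ := covers_unifReg p _ (Metric.ball_mem_nhds (0 : Euc n) hr)
    refine ⟨N, hN, (measure_mono (t := O.unifReg p '' (Metric.ball 0 r \ {0})) ?_).trans_lt ?_⟩
    · intro x hx
      obtain ⟨z, hz, hzD, rfl⟩ := hN2 x hx
      exact ⟨z, ⟨hz, hzD.2⟩, rfl⟩
    · have ho := isOrbitMap_unifReg p hrp
      have := O.grp_finite p
      refine lt_top_of_le_paramVolume ho.toParamOn Set.sdiff_subset (C := √(G 0).det + 1)
        (fun z hz => ?_) ?_
      · rw [h2 z (Metric.ball_subset_ball hrp hz.1) hz.2]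
        exact (hr'2 z (Metric.ball_subset_ball (min_le_left _ _) hz.1)).le
      · rw [ho.paramVolume_eq, Measure.smul_apply, Measure.restrict_apply MeasurableSet.univ,
          Set.univ_inter, smul_eq_mul]
        refine le_mul_of_one_le_left zero_le ?_
        exact_mod_cast Nat.one_le_iff_ne_zero.2 Nat.card_pos.ne'
  · set x : O.Reg := ⟨m, hm⟩
    set e := chartAt (Euc n) x
    have h0 := (isRiemannian_of_mem hg).metricAt (isParam_chart (n := n) x)
    have hc : ∀ᶠ z in 𝓝 (e x), √(paramMatrix e.symm g z).det
        < √(paramMatrix e.symm g (e x)).det + 1 :=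
      (h0.smoothAt.sqrt_det h0.det_ne).continuousAt.eventually_lt_const (lt_add_one _)
    obtain ⟨r, hr, hr2⟩ := Metric.eventually_nhds_iff_ball.1 hc
    have hD : ParamOn e.symm (e.target ∩ Metric.ball (e x) r) :=
      (paramOn_symm (chart_mem_atlas _ x)).mono Set.inter_subset_left
        (e.open_target.inter Metric.isOpen_ball)
    obtain ⟨N, hN, hN2⟩ := covers_chart x _ (Metric.ball_mem_nhds (e x) hr)
    refine ⟨N, hN, (measure_mono (t := e.symm '' (e.target ∩ Metric.ball (e x) r)) ?_).trans_lt ?_⟩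
    · intro x hx
      obtain ⟨z, hz, hzD, rfl⟩ := hN2 x hx
      exact ⟨z, ⟨hzD, hz⟩, rfl⟩
    · refine lt_top_of_le_paramVolume hD Set.inter_subset_right (fun z hz => (hr2 z hz.2).le) ?_
      rw [volumeMeasure_apply hD (e.symm.injOn.mono Set.inter_subset_left) g
        hD.isOpen_image.measurableSet subset_rfl]
      exact measure_mono (Set.subset_univ _)

end OrbifoldVolume

/-! ### Pointwise variation of the scalar curvature density -/

section PointwiseVariation

variable {n : ℕ} {X : Type*} [TopologicalSpace X] [ChartedSpace (Euc n) X]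

/-- The scalar curvature density of `g + t h` relative to the volume of `g`. -/
def curvDensity (g h : TwoTensor n X) (t : ℝ) (x : X) : ℝ :=
  scalarCurvature (g + t • h) x * volRatio g (g + t • h) x

/-- The exact part of the first variation of the scalar curvature density. -/
def divTerm (g h : TwoTensor n X) (x : X) : ℝ :=
  deriv (fun t => curvDensity g h t x) 0
    + (tensorPair g (ricTensor g) h x - 1 / 2 * scalarCurvature g x * trPair g h x)

lemma paramMatrix_fam (f : Euc n → X) (g h : TwoTensor n X) (t : ℝ) :
    paramMatrix f (g + t • h) = fun w => fam (paramMatrix f g) (paramMatrix f h) (t, w) := by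
  ext1 w
  rw [paramMatrix_add, paramMatrix_smul]
  rfl

lemma lagrangian_congr {G K : Euc n → Matrix (Fin n) (Fin n) ℝ} {y : Euc n} (h : G =ᶠ[𝓝 y] K) :
    lagrangian G y = lagrangian K y := by
  rw [lagrangian, lagrangian, coordScalar_congr h, h.self_of_nhds]

/-- Multiplication of a tensor field by a function. -/
def mulTensor (φ : X → ℝ) (h : TwoTensor n X) : TwoTensor n X := fun x => φ x • h x

lemma paramMatrix_mulTensor (f : Euc n → X) (φ : X → ℝ) (h : TwoTensor n X) (y : Euc n) :
    paramMatrix f (mulTensor φ h) y = φ (f y) • paramMatrix f h y := by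
  ext i j; rfl

/-- The pointwise derivative of the scalar curvature density. -/
def curvVar (g h : TwoTensor n X) (x : X) : ℝ :=
  divTerm g h x - (tensorPair g (ricTensor g) h x - 1 / 2 * scalarCurvature g x * trPair g h x)

lemma tensor_ext {h k : TwoTensor n X} {x : X} (hx : ∀ u v, h x u v = k x u v) : h x = k x :=
  ContinuousLinearMap.ext fun u => ContinuousLinearMap.ext fun v => hx u v

lemma mulTensor_eq_zero_left {φ : X → ℝ} {h : TwoTensor n X} {x : X} (hx : φ x = 0) :
    mulTensor φ h x = 0 :=
  tensor_ext (k := 0) fun u v => show φ x * h x u v = 0 by rw [hx, zero_mul]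

lemma mulTensor_eq_zero_right {φ : X → ℝ} {h : TwoTensor n X} {x : X} (hx : h x = 0) :
    mulTensor φ h x = 0 :=
  tensor_ext (k := 0) fun u v => show φ x * h x u v = 0 by
    rw [hx]; exact mul_zero (φ x)

lemma mulTensor_of_eq_one {φ : X → ℝ} {h : TwoTensor n X} {x : X} (hx : φ x = 1) :
    mulTensor φ h x = h x :=
  tensor_ext fun u v => show φ x * h x u v = h x u v by rw [hx, one_mul]

lemma add_mulTensor (φ ψ : X → ℝ) (h : TwoTensor n X) :
    mulTensor φ h + mulTensor ψ h = mulTensor (fun x => φ x + ψ x) h :=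
  funext fun x => tensor_ext fun u v => (add_mul (φ x) (ψ x) (h x u v)).symm

lemma sum_mulTensor {ι : Type*} (J : Finset ι) (φ : ι → X → ℝ) (h : TwoTensor n X) :
    ∑ i ∈ J, mulTensor (φ i) h = mulTensor (fun x => ∑ i ∈ J, φ i x) h := by
  classical
  induction J using Finset.induction_on with
  | empty => exact funext fun x => (mulTensor_eq_zero_left (by simp)).symm
  | insert i J hi ih =>
    rw [Finset.sum_insert hi, ih, add_mulTensor]
    congr 1
    ext1 x
    rw [Finset.sum_insert hi]

variable [IsManifold 𝓘(ℝ, Euc n) ∞ X] {f : Euc n → X} {y : Euc n} {g h k : TwoTensor n X}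

lemma SmoothSym.add (hh : SmoothSym h) (hk : SmoothSym k) : SmoothSym (h + k) where
  smooth x := by
    have h1 := (smoothTensorAt_iff _ _).1 (hh.smooth x)
    have h2 := (smoothTensorAt_iff _ _).1 (hk.smooth x)
    refine (smoothTensorAt_iff _ _).2 ((h1.add h2).congr ?_)
    exact Filter.Eventually.of_forall fun z => paramMatrix_add _ _ _ _
  symm x u v := by
    change h x u v + k x u v = h x v u + k x v u
    rw [hh.symm, hk.symm]

lemma smoothSym_mulTensor {φ : X → ℝ} (hh : SmoothSym h)
    (hφ : ∀ x, ContDiffAt ℝ ∞ (φ ∘ (chartAt (Euc n) x).symm) (chartAt (Euc n) x x)) :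
    SmoothSym (mulTensor φ h) where
  smooth x := by
    have h1 := (smoothTensorAt_iff _ _).1 (hh.smooth x)
    refine (smoothTensorAt_iff _ _).2 ((MatSmoothAt.smul (hφ x) h1).congr ?_)
    exact Filter.Eventually.of_forall fun z => paramMatrix_mulTensor _ _ _ _
  symm x u v := by
    change φ x * h x u v = φ x * h x v u
    rw [hh.symm]

lemma SmoothSym.smul (hh : SmoothSym h) (c : ℝ) : SmoothSym (c • h) :=
  smoothSym_mulTensor (φ := fun _ => c) hh fun _ => contDiffAt_const

lemma smoothSym_zero : SmoothSym (0 : TwoTensor n X) where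
  smooth x := by
    refine (smoothTensorAt_iff _ _).2 ((MatSmoothAt.const (0 : Matrix (Fin n) (Fin n) ℝ)).congr ?_)
    exact Filter.Eventually.of_forall fun z => by ext i j; rfl
  symm x u v := rfl

lemma curvDensity_param (hf : IsParam f y) (hg : SmoothSym g) (hh : SmoothSym h) {t : ℝ}
    (hd : 0 < (fam (paramMatrix f g) (paramMatrix f h) (t, y)).det) :
    curvDensity g h t (f y) = lagrangian (fun w => fam (paramMatrix f g) (paramMatrix f h) (t, w)) y
      / √(paramMatrix f g y).det := by
  have hs := (hg.add (hh.smul t)).symAt hf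
  have hm : MetricAt (paramMatrix f (g + t • h)) y := ⟨hs.smooth, hs.symm, by
    rw [paramMatrix_fam]; exact hd⟩
  rw [curvDensity, scalarCurvature_param hf hm, volRatio_param hf, paramMatrix_fam, lagrangian,
    mul_div_assoc]

lemma volRatio_add_param (hf : IsParam f y) (t : ℝ) :
    volRatio g (g + t • h) (f y) = √(fam (paramMatrix f g) (paramMatrix f h) (t, y)).det
      / √(paramMatrix f g y).det := by
  rw [volRatio_param hf, paramMatrix_fam]

lemma eventually_det_fam_pos {G H : Euc n → Matrix (Fin n) (Fin n) ℝ} (hG : MetricAt G y)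
    (hH : MatSmoothAt H y) : ∀ᶠ p in 𝓝 ((0 : ℝ), y), 0 < (fam G H p).det := by
  have h1 : MatSmoothAt (fam G H) ((0 : ℝ), y) := smooth_fam hG.smoothAt hH
  refine h1.det.continuousAt.eventually_const_lt ?_
  simpa [fam] using hG.det_pos

lemma hasDerivAt_curvDensity (hf : IsParam f y) (hg : IsRiemannian g) (hh : SmoothSym h) :
    HasDerivAt (fun t => curvDensity g h t (f y))
      (varDiv (paramMatrix f g) (paramMatrix f h) y / √(paramMatrix f g y).det
        - gradPairing (paramMatrix f g) (paramMatrix f h) y) 0 := by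
  have hG := hg.metricAt hf
  have hH := hh.symAt hf
  have hs : √(paramMatrix f g y).det ≠ 0 := (Real.sqrt_pos.2 hG.det_pos).ne'
  have h1 := (hasDerivAt_lagrangian hG hH).div_const (√(paramMatrix f g y).det)
  rw [sub_div, mul_div_cancel_left₀ _ hs] at h1
  refine h1.congr_of_eventuallyEq ?_
  have h2 : Filter.Tendsto (fun t : ℝ => (t, y)) (𝓝 0) (𝓝 ((0 : ℝ), y)) :=
    (Continuous.prodMk_left y).tendsto 0
  filter_upwards [h2.eventually (eventually_det_fam_pos hG hH.smoothAt)] with t ht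
    using curvDensity_param hf hg.toSmoothSym hh ht

/-- `divTerm` is defined without coordinates, as the derivative of the curvature density plus the
gradient pairing. It is therefore a global function, while in every parametrization it is a
coordinate divergence over √det. -/
lemma divTerm_param (hf : IsParam f y) (hg : IsRiemannian g) (hh : SmoothSym h) :
    divTerm g h (f y) = varDiv (paramMatrix f g) (paramMatrix f h) y / √(paramMatrix f g y).det := by
  rw [divTerm, (hasDerivAt_curvDensity hf hg hh).deriv, tensorPair_param _ hf, trPair_param hf,
    scalarCurvature_param hf (hg.metricAt hf), paramMatrix_ricTensor hf (hg.metricAt hf), gradPairing]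
  ring

lemma hasDerivAt_volRatio (hg : IsRiemannian g) (x : X) :
    HasDerivAt (fun t : ℝ => volRatio g (g + t • h) x) (1 / 2 * trPair g h x) 0 := by
  have hp := isParam_chart (n := n) x
  have hx : (chartAt (Euc n) x).symm (chartAt (Euc n) x x) = x :=
    (chartAt (Euc n) x).left_inv (mem_chart_source _ x)
  have hG := hg.metricAt hp
  have hs := (Real.sqrt_pos.2 hG.det_pos).ne'
  have h0 : fam (paramMatrix (chartAt (Euc n) x).symm g) (paramMatrix (chartAt (Euc n) x).symm h)
    (0, chartAt (Euc n) x x) = paramMatrix (chartAt (Euc n) x).symm g (chartAt (Euc n) x x) := by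
    simp [fam]
  have h1 := (hasDerivAt_sqrt_det (hasDerivAt_fam (G := paramMatrix (chartAt (Euc n) x).symm g)
    (H := paramMatrix (chartAt (Euc n) x).symm h) (chartAt (Euc n) x x) 0)
    (by rw [h0]; exact hG.det_pos)).div_const
      (√(paramMatrix (chartAt (Euc n) x).symm g (chartAt (Euc n) x x)).det)
  rw [← hx]
  simp only [volRatio_add_param hp, trPair_param hp]
  refine h1.congr_deriv ?_
  rw [h0]
  field_simp

lemma hasDerivAt_curvDensity' (hg : IsRiemannian g) (hh : SmoothSym h) (x : X) :
    HasDerivAt (fun t => curvDensity g h t x) (curvVar g h x) 0 := by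
  have hp := isParam_chart (n := n) x
  have hx : (chartAt (Euc n) x).symm (chartAt (Euc n) x x) = x :=
    (chartAt (Euc n) x).left_inv (mem_chart_source _ x)
  have h1 := hasDerivAt_curvDensity hp hg hh
  rw [hx] at h1
  rw [curvVar, divTerm, add_sub_cancel_right]
  exact h1.differentiableAt.hasDerivAt

lemma continuous_divTerm (hg : IsRiemannian g) (hh : SmoothSym h) : Continuous (divTerm g h) := by
  refine continuous_of_param (n := n) fun x => ?_
  have hp := isParam_chart (n := n) x
  have hG := hg.metricAt hp
  have h1 := (contDiffAt_varDiv hG (hh.symAt hp)).continuousAt.div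
    (hG.smoothAt.sqrt_det hG.det_ne).continuousAt (Real.sqrt_pos.2 hG.det_pos).ne'
  refine h1.congr ?_
  filter_upwards [hp.eventually] with z hz using (divTerm_param hz hg hh).symm

lemma continuous_curvVar (hg : IsRiemannian g) (hh : SmoothSym h) : Continuous (curvVar g h) :=
  (continuous_divTerm hg hh).sub ((hg.continuous_tensorPair hg.smoothSym_ricTensor hh).sub
    ((continuous_const.mul hg.continuous_scalarCurvature).mul (hg.continuous_trPair hh)))

lemma divTerm_add (hg : IsRiemannian g) (hh : SmoothSym h) (hk : SmoothSym k) (x : X) :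
    divTerm g (h + k) x = divTerm g h x + divTerm g k x := by
  have hp := isParam_chart (n := n) x
  have hx : (chartAt (Euc n) x).symm (chartAt (Euc n) x x) = x :=
    (chartAt (Euc n) x).left_inv (mem_chart_source _ x)
  rw [← hx, divTerm_param hp hg (hh.add hk), divTerm_param hp hg hh, divTerm_param hp hg hk,
    ← add_div, ← varDiv_add (hg.metricAt hp) (hh.symAt hp) (hk.symAt hp)]
  congr 2

end PointwiseVariation

/-! ### Uniform estimates for the variation -/

section UniformEstimates

/-- `C` bounds `u` and its derivative at `t`. -/
structure BoundedC1 (u : ℝ → ℝ) (t C : ℝ) : Prop where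
  bound : |u t| ≤ C
  diff : DifferentiableAt ℝ u t
  deriv_bound : |deriv u t| ≤ C

lemma BoundedC1.mono {u : ℝ → ℝ} {t C C' : ℝ} (h : BoundedC1 u t C) (hC : C ≤ C') :
    BoundedC1 u t C' := ⟨h.bound.trans hC, h.diff, h.deriv_bound.trans hC⟩

lemma BoundedC1.congr {u v : ℝ → ℝ} {t C : ℝ} (h : BoundedC1 u t C) (huv : v =ᶠ[𝓝 t] u) :
    BoundedC1 v t C :=
  ⟨huv.self_of_nhds ▸ h.bound, h.diff.congr_of_eventuallyEq huv, huv.deriv_eq ▸ h.deriv_bound⟩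

/-- A product neighbourhood provides a time interval that works for all nearby points. -/
lemma eventually_abs_lt_and {E : Type*} [TopologicalSpace E] {y : E} {p : ℝ × E → Prop}
    (h : ∀ᶠ q in 𝓝 ((0 : ℝ), y), p q) : ∃ δ > 0, ∀ᶠ z in 𝓝 y, ∀ t, |t| < δ → p (t, z) := by
  obtain ⟨u, hu, v, hv, huv⟩ := mem_nhds_prod_iff.1 h
  obtain ⟨δ, h1, h2⟩ := Metric.mem_nhds_iff.1 hu
  refine ⟨δ, h1, ?_⟩
  filter_upwards [hv] with z hz t ht
  exact huv ⟨h2 (by simpa using ht), hz⟩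

lemma exists_boundedC1 {n : ℕ} {N : ℝ × Euc n → ℝ} {y : Euc n} (h : ContDiffAt ℝ ∞ N (0, y)) :
    ∃ δ > 0, ∃ C, ∀ᶠ z in 𝓝 y, ∀ t, |t| < δ → BoundedC1 (fun s => N (s, z)) t C := by
  have h1 : ∀ᶠ q in 𝓝 ((0 : ℝ), y), |N q| < |N (0, y)| + 1 :=
    h.continuousAt.abs.eventually_lt_const (lt_add_one _)
  have h2 : ∀ᶠ q in 𝓝 ((0 : ℝ), y), DifferentiableAt ℝ N q :=
    ContDiffAt.eventually_differentiableAt h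
  have h3 : ∀ᶠ q in 𝓝 ((0 : ℝ), y), ‖fderiv ℝ N q‖ < ‖fderiv ℝ N (0, y)‖ + 1 :=
    ((h.fderiv_right (m := 0) (by simp)).continuousAt.norm).eventually_lt_const (lt_add_one _)
  obtain ⟨δ, hδ, hz⟩ := eventually_abs_lt_and (h1.and (h2.and h3))
  refine ⟨δ, hδ, max (|N (0, y)| + 1) (‖fderiv ℝ N (0, y)‖ + 1), ?_⟩
  filter_upwards [hz] with z hz t ht
  obtain ⟨h1, h2, h3⟩ := hz t ht
  have hd := hasDerivAt_slice h2
  refine ⟨h1.le.trans (le_max_left _ _), hd.differentiableAt, ?_⟩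
  rw [hd.deriv]
  refine le_trans ?_ (le_max_right _ _)
  refine (((fderiv ℝ N (t, z)).le_opNorm _).trans ?_).trans h3.le
  simp

/-- Uniform control of the volume and curvature densities of `g + t h` on `s`. -/
def UniformlyVaries {n : ℕ} {X : Type*} [TopologicalSpace X] [ChartedSpace (Euc n) X]
    (g h : TwoTensor n X) (s : Set X) : Prop :=
  ∃ δ > 0, ∃ C, ∀ x ∈ s, ∀ t, |t| < δ → 0 < (matAt (g + t • h) x).det ∧
    BoundedC1 (fun t => curvDensity g h t x) t C ∧
    BoundedC1 (fun t => volRatio g (g + t • h) x) t C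

lemma UniformlyVaries.union {n : ℕ} {X : Type*} [TopologicalSpace X] [ChartedSpace (Euc n) X]
    {g h : TwoTensor n X} {s s' : Set X} (hs : UniformlyVaries g h s)
    (hs' : UniformlyVaries g h s') : UniformlyVaries g h (s ∪ s') := by
  obtain ⟨δ, hδ, C, hC⟩ := hs
  obtain ⟨δ', hδ', C', hC'⟩ := hs'
  refine ⟨min δ δ', lt_min hδ hδ', max C C', fun x hx t ht => ?_⟩
  rcases hx with hx | hx
  · obtain ⟨h1, h2, h3⟩ := hC x hx t (ht.trans_le (min_le_left _ _))
    exact ⟨h1, h2.mono (le_max_left _ _), h3.mono (le_max_left _ _)⟩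
  · obtain ⟨h1, h2, h3⟩ := hC' x hx t (ht.trans_le (min_le_right _ _))
    exact ⟨h1, h2.mono (le_max_right _ _), h3.mono (le_max_right _ _)⟩

variable {n : ℕ} {M : Type*} [TopologicalSpace M] {O : IsolatedOrbifold n M}

/-- In an orbifold chart the densities of g + th are expressed through the lifts, which are smooth
also at the centre of a uniformizing ball. The bounds therefore hold up to the singular points, and
compactness of M gives a common δ and C. -/
lemma uniformlyVaries_univ [CompactSpace M] [T2Space M] {g h : TwoTensor n O.Reg}
    (hg : g ∈ O.metrics) (hh : h ∈ O.symTensors) : UniformlyVaries g h Set.univ := by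
  refine orbifold_induction (p := UniformlyVaries g h)
    ⟨1, one_pos, 0, fun x hx => hx.elim⟩ ?_ (fun s t => UniformlyVaries.union) fun m => ?_
  · rintro s t hst ⟨δ, hδ, C, hC⟩
    exact ⟨δ, hδ, C, fun x hx => hC x (hst hx)⟩
  obtain ⟨f, D, y, hD, hcov, hsym, hmet⟩ := exists_orbifold_chart (O := O) m
  obtain ⟨G, hG, hgG⟩ := hmet g hg
  obtain ⟨H, hH, hhH⟩ := hsym h hh
  have hf0 : fam G H (0, y) = G y := by simp [fam]
  have hfs : MatSmoothAt (fam G H) ((0 : ℝ), y) := smooth_fam hG.smoothAt hH.smoothAt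
  have hfd : (fam G H ((0 : ℝ), y)).det ≠ 0 := by rw [hf0]; exact hG.det_ne
  have hsq : ContDiffAt ℝ ∞ (fun q : ℝ × Euc n => √(G q.2).det) ((0 : ℝ), y) :=
    ContDiffAt.comp (g := fun z => √(G z).det) (f := Prod.snd) ((0 : ℝ), y)
      (hG.smoothAt.sqrt_det hG.det_ne) contDiffAt_snd
  have hsq0 : √(G y).det ≠ 0 := (Real.sqrt_pos.2 hG.det_pos).ne'
  obtain ⟨δ₁, hδ₁, C₁, hC₁⟩ := exists_boundedC1 ((joint_lagrangian hfs hfd).div hsq hsq0)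
  obtain ⟨δ₂, hδ₂, C₂, hC₂⟩ := exists_boundedC1 ((hfs.sqrt_det hfd).div hsq hsq0)
  obtain ⟨δ₃, hδ₃, hdet⟩ := eventually_abs_lt_and (eventually_det_fam_pos hG hH.smoothAt)
  obtain ⟨N, hN, hcovN⟩ := hcov _ (hC₁.and (hC₂.and (hdet.and
    (hgG.eventually_nhds.and hhH.eventually_nhds))))
  refine ⟨N, hN, min δ₁ (min δ₂ δ₃), lt_min hδ₁ (lt_min hδ₂ hδ₃), max C₁ C₂, fun x hx t ht => ?_⟩
  obtain ⟨z, ⟨z1, z2, z3, z4, z5⟩, hzD, rfl⟩ := hcovN x hx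
  have hp := hD.param z hzD
  -- The lifts agree with the true coordinate matrices on D only. D is open, so the agreement holds
  -- near z, as curvature requires; at the centre itself it is not needed.
  have hDn : ∀ᶠ w in 𝓝 z, w ∈ D := hD.isOpen.mem_nhds hzD
  have eG : paramMatrix f g =ᶠ[𝓝 z] G := by
    filter_upwards [z4, hDn] with w h1 h2 using h1 h2
  have eH : paramMatrix f h =ᶠ[𝓝 z] H := by
    filter_upwards [z5, hDn] with w h1 h2 using h1 h2
  have efam (s : ℝ) : (fun w => fam (paramMatrix f g) (paramMatrix f h) (s, w))
      =ᶠ[𝓝 z] fun w => fam G H (s, w) := by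
    filter_upwards [eG, eH] with w h1 h2
    simp only [fam, h1, h2]
  have efam0 (s : ℝ) : fam (paramMatrix f g) (paramMatrix f h) (s, z) = fam G H (s, z) :=
    (efam s).self_of_nhds
  have hpos (s : ℝ) (hs : |s| < δ₃) :
      0 < (fam (paramMatrix f g) (paramMatrix f h) (s, z)).det := by
    rw [efam0]
    exact z3 s hs
  have ht1 : |t| < δ₁ := ht.trans_le (min_le_left _ _)
  have ht2 : |t| < δ₂ := ht.trans_le ((min_le_right _ _).trans (min_le_left _ _))
  have ht3 : |t| < δ₃ := ht.trans_le ((min_le_right _ _).trans (min_le_right _ _))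
  refine ⟨det_matAt_pos hp (by rw [paramMatrix_fam]; exact hpos t ht3),
    ((z1 t ht1).congr ?_).mono (le_max_left _ _), ((z2 t ht2).congr ?_).mono (le_max_right _ _)⟩
  · have : ∀ᶠ s in 𝓝 t, |s| < δ₃ := continuous_abs.continuousAt.eventually_lt_const ht3
    filter_upwards [this] with s hs
    rw [curvDensity_param hp (isRiemannian_of_mem hg).toSmoothSym (smoothSym_of_mem hh) (hpos s hs),
      lagrangian_congr (efam s), eG.self_of_nhds]
    rfl
  · refine Filter.Eventually.of_forall fun s => ?_
    simp only
    rw [volRatio_add_param hp, efam0, eG.self_of_nhds]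
    rfl

end UniformEstimates

/-! ### The total scalar curvature and the volume of `g + t h` -/

section Functional

lemma integrable_of_continuous_of_bound {X : Type*} [TopologicalSpace X] [MeasurableSpace X]
    [OpensMeasurableSpace X] {μ : Measure X} [IsFiniteMeasure μ] {ψ : X → ℝ} (hψ : Continuous ψ)
    {C : ℝ} (hC : ∀ x, |ψ x| ≤ C) : Integrable ψ μ :=
  ⟨hψ.aestronglyMeasurable, HasFiniteIntegral.of_bounded (Filter.Eventually.of_forall hC)⟩

/-- Differentiation under the integral for uniformly bounded families on a finite measure space. -/
lemma hasDerivAt_integral_of_boundedC1 {X : Type*} [TopologicalSpace X] [MeasurableSpace X]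
    [OpensMeasurableSpace X] {μ : Measure X} [IsFiniteMeasure μ] {u : ℝ → X → ℝ} {u' : X → ℝ}
    {δ C : ℝ} (hδ : 0 < δ) (hb : ∀ x t, |t| < δ → BoundedC1 (fun s => u s x) t C)
    (hc : ∀ t, |t| < δ → Continuous (u t)) (hc' : Continuous u')
    (hd : ∀ x, HasDerivAt (fun s => u s x) (u' x) 0) :
    HasDerivAt (fun t => ∫ x, u t x ∂μ) (∫ x, u' x ∂μ) 0 := by
  have h0 : |(0 : ℝ)| < δ := by simpa using hδ
  have hnhds : {t : ℝ | |t| < δ} ∈ 𝓝 (0 : ℝ) := continuous_abs.continuousAt.eventually_lt_const h0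
  have hu' : u' = fun x => deriv (fun s => u s x) 0 := funext fun x => (hd x).deriv.symm
  have := (hasDerivAt_integral_of_dominated_loc_of_deriv_le (μ := μ) (F := u)
    (F' := fun t x => deriv (fun s => u s x) t) (bound := fun _ => C) hnhds
    (Filter.mem_of_superset hnhds fun t ht => (hc t ht).aestronglyMeasurable)
    (integrable_of_continuous_of_bound (hc 0 h0) fun x => (hb x 0 h0).bound)
    (by rw [← hu']; exact hc'.aestronglyMeasurable)
    (Filter.Eventually.of_forall fun x t ht => (hb x t ht).deriv_bound) (integrable_const C)
    (Filter.Eventually.of_forall fun x t ht => (hb x t ht).diff.hasDerivAt)).2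
  rwa [hu']

variable {n : ℕ} {M : Type*} [TopologicalSpace M] [CompactSpace M] [T2Space M]
  [MeasurableSpace M] [BorelSpace M] {O : IsolatedOrbifold n M} {g h : TwoTensor n O.Reg}

/-- Writing the integral against the fixed measure of g moves all dependence on t into the
integrand. -/
lemma integral_scalarCurvature_eq (hg : IsRiemannian g) (hh : SmoothSym h) (t : ℝ) :
    ∫ x, scalarCurvature (g + t • h) x ∂(volumeMeasure (g + t • h))
      = ∫ x, curvDensity g h t x ∂(volumeMeasure g) := by
  have hk := hg.toSmoothSym.add (hh.smul t)
  rw [volumeMeasure_eq_withDensity hg hk, integral_withDensity_eq_integral_toReal_smul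
    (hg.continuous_volRatio hk).measurable.ennreal_ofReal
    (Filter.Eventually.of_forall fun _ => ENNReal.ofReal_lt_top)]
  refine integral_congr_ae (Filter.Eventually.of_forall fun x => ?_)
  have h0 : 0 ≤ volRatio g (g + t • h) x := div_nonneg (Real.sqrt_nonneg _) (Real.sqrt_nonneg _)
  simp only [ENNReal.toReal_ofReal h0, smul_eq_mul, curvDensity, mul_comm]

lemma volume_real_eq (hg : IsRiemannian g) (hh : SmoothSym h) (t : ℝ) :
    (volumeMeasure (g + t • h)).real Set.univ
      = ∫ x, volRatio g (g + t • h) x ∂(volumeMeasure g) := by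
  have hk := hg.toSmoothSym.add (hh.smul t)
  have h0 (x) : 0 ≤ volRatio g (g + t • h) x := div_nonneg (Real.sqrt_nonneg _) (Real.sqrt_nonneg _)
  rw [Measure.real, volumeMeasure_eq_withDensity hg hk, withDensity_apply _ MeasurableSet.univ,
    Measure.restrict_univ, integral_eq_lintegral_of_nonneg_ae (Filter.Eventually.of_forall h0)
    (hg.continuous_volRatio hk).aestronglyMeasurable]

lemma isFiniteMeasure_volume (hg : g ∈ O.metrics) : IsFiniteMeasure (volumeMeasure g) :=
  ⟨volumeMeasure_univ_lt_top hg⟩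

lemma hasDerivAt_totalCurvature (hg : g ∈ O.metrics) (hh : h ∈ O.symTensors) :
    HasDerivAt (fun t : ℝ => ∫ x, scalarCurvature (g + t • h) x ∂(volumeMeasure (g + t • h)))
      (∫ x, curvVar g h x ∂(volumeMeasure g)) 0 := by
  have hg' := isRiemannian_of_mem hg
  have hh' := smoothSym_of_mem hh
  have := isFiniteMeasure_volume hg
  obtain ⟨δ, hδ, C, hC⟩ := uniformlyVaries_univ hg hh
  simp only [integral_scalarCurvature_eq hg' hh']
  refine hasDerivAt_integral_of_boundedC1 hδ (fun x t ht => (hC x trivial t ht).2.1)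
    (fun t ht => ?_) (continuous_curvVar hg' hh') fun x => hasDerivAt_curvDensity' hg' hh' x
  have hk := hg'.toSmoothSym.add (hh'.smul t)
  exact (hk.continuous_scalarCurvature fun x => (hC x trivial t ht).1).mul
    (hg'.continuous_volRatio hk)

lemma hasDerivAt_volume (hg : g ∈ O.metrics) (hh : h ∈ O.symTensors) :
    HasDerivAt (fun t : ℝ => (volumeMeasure (g + t • h)).real Set.univ)
      (∫ x, 1 / 2 * trPair g h x ∂(volumeMeasure g)) 0 := by
  have hg' := isRiemannian_of_mem hg
  have hh' := smoothSym_of_mem hh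
  have := isFiniteMeasure_volume hg
  obtain ⟨δ, hδ, C, hC⟩ := uniformlyVaries_univ hg hh
  simp only [volume_real_eq hg' hh']
  exact hasDerivAt_integral_of_boundedC1 hδ (fun x t ht => (hC x trivial t ht).2.2)
    (fun t ht => hg'.continuous_volRatio (hg'.toSmoothSym.add (hh'.smul t)))
    (continuous_const.mul (hg'.continuous_trPair hh')) fun x => hasDerivAt_volRatio hg' x

end Functional

/-! ### The divergence theorem for compactly supported fields -/

section Divergence

variable {n : ℕ}

/-- Integration by parts against the constant function 1. -/
lemma integral_pd_eq_zero {w : Euc n → ℝ} (hw : ContDiff ℝ ∞ w) (hc : HasCompactSupport w)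
    (k : Fin n) : Integrable (pd k w) ∧ ∫ y, pd k w y = 0 := by
  have h1 : Continuous (pd k w) := (hw.continuous_fderiv (by simp)).clm_apply continuous_const
  have h2 : HasCompactSupport (pd k w) := hc.fderiv_apply ℝ (stdVec k)
  have hi := h1.integrable_of_hasCompactSupport (μ := volume) h2
  refine ⟨hi, ?_⟩
  have := integral_mul_fderiv_eq_neg_fderiv_mul_of_integrable (μ := (volume : Measure (Euc n)))
    (𝕜 := ℝ) (f := fun _ => 1) (g := w) (v := stdVec k) (by simp) (by simp only [one_mul]; exact hi)
    (by simpa using hw.continuous.integrable_of_hasCompactSupport (μ := volume) hc)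
    (fun _ _ => differentiableAt_const _) (fun x _ => hw.differentiable (by simp) x)
  simp only [one_mul, fderiv_const_apply, zero_apply, zero_mul, integral_zero, neg_zero] at this
  exact this

lemma varDiv_eq_zero {G H : Euc n → Matrix (Fin n) (Fin n) ℝ} {y : Euc n} (h : H =ᶠ[𝓝 y] 0) :
    varDiv G H y = 0 := by
  refine Finset.sum_eq_zero fun k _ => ?_
  rw [pd_congr (g := fun _ => 0) (h.eventuallyEq_nhds.mono fun z hz => varField_eq_zero hz k) k,
    pd_const]

/-- The exact part of the first variation integrates to zero for compactly supported variations. -/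
lemma integral_varDiv_eq_zero {G H : Euc n → Matrix (Fin n) (Fin n) ℝ} {Ω K : Set (Euc n)}
    (hΩ : IsOpen Ω) (hK : IsCompact K) (hKΩ : K ⊆ Ω) (hG : ∀ y ∈ Ω, MetricAt G y)
    (hH : ∀ y ∈ Ω, SymAt H y) (h0 : ∀ y ∈ Ω, y ∉ K → H y = 0) :
    ∫ y in Ω, varDiv G H y = 0 := by
  -- The field vanishes on Ω∖K, so its extension by zero is smooth on all of ℝⁿ and has compact
  -- support.
  let w (k : Fin n) : Euc n → ℝ := Ω.indicator (varField G H k)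
  have hH0 (y : Euc n) (hy : y ∈ Ω) (hyK : y ∉ K) : H =ᶠ[𝓝 y] 0 := by
    filter_upwards [hΩ.mem_nhds hy, hK.isClosed.isOpen_compl.mem_nhds hyK] with z h1 h2
      using h0 z h1 h2
  have hw0 (k : Fin n) (y : Euc n) (hy : y ∉ K) : w k y = 0 := by
    by_cases hyΩ : y ∈ Ω
    · exact (Set.indicator_of_mem hyΩ _).trans (varField_eq_zero (hH0 y hyΩ hy) k)
    · exact Set.indicator_of_notMem hyΩ _
  have hw0' (k : Fin n) (y : Euc n) (hy : y ∉ K) : w k =ᶠ[𝓝 y] fun _ => 0 := by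
    filter_upwards [hK.isClosed.isOpen_compl.mem_nhds hy] with z hz using hw0 k z hz
  have hw1 (k : Fin n) (y : Euc n) (hy : y ∈ Ω) : w k =ᶠ[𝓝 y] varField G H k := by
    filter_upwards [hΩ.mem_nhds hy] with z hz using Set.indicator_of_mem hz _
  have hws (k : Fin n) : ContDiff ℝ ∞ (w k) := by
    rw [contDiff_iff_contDiffAt]
    intro y
    by_cases hy : y ∈ Ω
    · exact (contDiffAt_varField (hG y hy) (hH y hy).smoothAt k).congr_of_eventuallyEq (hw1 k y hy)
    · exact contDiffAt_const.congr_of_eventuallyEq (hw0' k y fun h => hy (hKΩ h))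
  have hwc (k : Fin n) : HasCompactSupport (w k) := HasCompactSupport.intro hK fun y => hw0 k y
  have h1 : ∫ y in Ω, varDiv G H y = ∫ y in Ω, ∑ k, pd k (w k) y :=
    setIntegral_congr_fun hΩ.measurableSet fun y hy =>
      Finset.sum_congr rfl fun k _ => (pd_congr (hw1 k y hy) k).symm
  rw [h1, setIntegral_eq_integral_of_forall_compl_eq_zero,
    integral_finsetSum _ fun k _ => (integral_pd_eq_zero (hws k) (hwc k) k).1]
  · exact Finset.sum_eq_zero fun k _ => (integral_pd_eq_zero (hws k) (hwc k) k).2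
  · intro y hy
    refine Finset.sum_eq_zero fun k _ => ?_
    rw [pd_congr (hw0' k y fun h => hy (hKΩ h)) k, pd_const]

variable {X : Type*} [TopologicalSpace X] [ChartedSpace (Euc n) X]

lemma eventually_eq_zero_of_notMem {h : TwoTensor n X} {K : Set X} (hK : IsClosed K) (h0 : ∀ x ∉ K, h x = 0) {x : X}
    (hx : x ∉ K) : ∀ᶠ z in 𝓝 x, h z = 0 := by
  filter_upwards [hK.isOpen_compl.mem_nhds hx] with z hz using h0 z hz

variable [IsManifold 𝓘(ℝ, Euc n) ∞ X] {g h : TwoTensor n X}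

lemma divTerm_eq_zero (hg : IsRiemannian g) (hh : SmoothSym h) {x : X} (h0 : ∀ᶠ z in 𝓝 x, h z = 0) :
    divTerm g h x = 0 := by
  have hp := isParam_chart (n := n) x
  have hx : (chartAt (Euc n) x).symm (chartAt (Euc n) x x) = x :=
    (chartAt (Euc n) x).left_inv (mem_chart_source _ x)
  rw [← hx, divTerm_param hp hg hh, varDiv_eq_zero, zero_div]
  have h1 : Filter.Tendsto (chartAt (Euc n) x).symm (𝓝 (chartAt (Euc n) x x)) (𝓝 x) := by
    have := hp.contMDiffAt.continuousAt.tendsto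
    rwa [hx] at this
  filter_upwards [h1.eventually h0] with z hz
  ext i j
  simp only [paramMatrix, Matrix.of_apply, pullback]
  rw [hz]
  rfl

/-- Functions that are smooth in the preferred charts. -/
def SmoothFun (φ : X → ℝ) : Prop :=
  ∀ x, ContDiffAt ℝ ∞ (φ ∘ (chartAt (Euc n) x).symm) (chartAt (Euc n) x x)

lemma smoothFun_of_contMDiff {φ : X → ℝ} (hφ : ContMDiff 𝓘(ℝ, Euc n) 𝓘(ℝ, ℝ) ∞ φ) :
    SmoothFun (n := n) φ := fun x =>
  contMDiffAt_iff_contDiffAt.1 ((hφ _).comp _ (isParam_chart x).contMDiffAt)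

variable [MeasurableSpace X]

lemma integral_divTerm_sum (hg : IsRiemannian g) {ι : Type*} (J : Finset ι)
    {k : ι → TwoTensor n X} (hk : ∀ i, SmoothSym (k i))
    (hi : ∀ i, Integrable (divTerm g (k i)) (volumeMeasure g))
    (h0 : ∀ i, ∫ x, divTerm g (k i) x ∂(volumeMeasure g) = 0) :
    SmoothSym (∑ i ∈ J, k i) ∧ Integrable (divTerm g (∑ i ∈ J, k i)) (volumeMeasure g) ∧
      ∫ x, divTerm g (∑ i ∈ J, k i) x ∂(volumeMeasure g) = 0 := by
  classical
  induction J using Finset.induction_on with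
  | empty =>
    have : divTerm g 0 = 0 :=
      funext fun x => divTerm_eq_zero hg smoothSym_zero (Filter.Eventually.of_forall fun _ => rfl)
    rw [Finset.sum_empty, this]
    exact ⟨smoothSym_zero, integrable_zero _ _ _, by simp⟩
  | insert i J hiJ ih =>
    rw [Finset.sum_insert hiJ]
    have hadd : divTerm g (k i + ∑ i ∈ J, k i)
        = fun x => divTerm g (k i) x + divTerm g (∑ i ∈ J, k i) x :=
      funext fun x => divTerm_add hg (hk i) ih.1 x
    rw [hadd]
    refine ⟨(hk i).add ih.1, (hi i).add ih.2.1, ?_⟩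
    rw [integral_add (hi i) ih.2.1, ih.2.2, add_zero, h0 i]

variable [T2Space X] [BorelSpace X]

lemma integrable_divTerm_of_compact [IsFiniteMeasure (volumeMeasure g)] (hg : IsRiemannian g)
    (hh : SmoothSym h) {K : Set X} (hK : IsCompact K) (h0 : ∀ x ∉ K, h x = 0) :
    Integrable (divTerm g h) (volumeMeasure g) :=
  (continuous_divTerm hg hh).integrable_of_hasCompactSupport <|
    HasCompactSupport.intro hK fun _ hx =>
      divTerm_eq_zero hg hh (eventually_eq_zero_of_notMem hK.isClosed h0 hx)

variable [SecondCountableTopology X]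

/-- The volume density cancels the denominator in `divTerm_param`, leaving the integral of a
coordinate divergence with compact support. -/
lemma integral_divTerm_of_chart (hg : IsRiemannian g) (hh : SmoothSym h) {K : Set X}
    (hK : IsCompact K) (x : X) (hKx : K ⊆ (chartAt (Euc n) x).source) (h0 : ∀ x ∉ K, h x = 0) :
    ∫ x, divTerm g h x ∂(volumeMeasure g) = 0 := by
  set e := chartAt (Euc n) x
  have hp := paramOn_symm (chart_mem_atlas (Euc n) x)
  have hz (z : X) (hz : z ∉ e.symm '' e.target) : divTerm g h z = 0 := by
    refine divTerm_eq_zero hg hh (eventually_eq_zero_of_notMem hK.isClosed h0 fun hzK => hz ?_)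
    rw [e.symm_image_target_eq_source]
    exact hKx hzK
  rw [← setIntegral_eq_integral_of_forall_compl_eq_zero hz, volumeMeasure_restrict hp e.symm.injOn,
    integral_paramVolume hp hg.toSmoothSym (continuous_divTerm hg hh)]
  have h1 : ∫ y in e.target, √(paramMatrix e.symm g y).det * divTerm g h (e.symm y)
      = ∫ y in e.target, varDiv (paramMatrix e.symm g) (paramMatrix e.symm h) y := by
    refine setIntegral_congr_fun e.open_target.measurableSet fun y hy => ?_
    rw [divTerm_param (hp.param y hy) hg hh,
      mul_div_cancel₀ _ (Real.sqrt_pos.2 (hg.metricAt (hp.param y hy)).det_pos).ne']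
  rw [h1]
  refine integral_varDiv_eq_zero e.open_target (hK.image_of_continuousOn (e.continuousOn.mono hKx))
    ?_ (fun y hy => hg.metricAt (hp.param y hy)) (fun y hy => hh.symAt (hp.param y hy)) ?_
  · rintro _ ⟨z, hz, rfl⟩
    exact e.map_source (hKx hz)
  · intro y hy hyK
    have : e.symm y ∉ K := fun hk => hyK ⟨_, hk, e.right_inv hy⟩
    ext i j
    simp only [paramMatrix, Matrix.of_apply, pullback]
    rw [h0 _ this]
    rfl

/-- A smooth partition of unity subordinate to the chart domains reduces to supports inside one
chart; local finiteness leaves finitely many pieces over K. -/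
lemma integral_divTerm_of_compact [LocallyCompactSpace X] [IsFiniteMeasure (volumeMeasure g)]
    (hg : IsRiemannian g) (hh : SmoothSym h) {K : Set X} (hK : IsCompact K)
    (h0 : ∀ x ∉ K, h x = 0) : ∫ x, divTerm g h x ∂(volumeMeasure g) = 0 := by
  obtain ⟨ρ, hρ⟩ := SmoothPartitionOfUnity.exists_isSubordinate_chartAt_source 𝓘(ℝ, Euc n) X
  have hfin : {i | (Function.support (ρ i) ∩ K).Nonempty}.Finite :=
    ρ.locallyFinite.finite_nonempty_inter_compact hK
  have hs (i : X) : SmoothSym (mulTensor (ρ i) h) :=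
    smoothSym_mulTensor hh (smoothFun_of_contMDiff (ρ i).contMDiff)
  have hc (i : X) : ∀ x ∉ K ∩ tsupport (ρ i), mulTensor (ρ i) h x = 0 := by
    intro x hx
    by_cases hxK : x ∈ K
    · have : ρ i x = 0 := image_eq_zero_of_notMem_tsupport fun h => hx ⟨hxK, h⟩
      exact mulTensor_eq_zero_left this
    · exact mulTensor_eq_zero_right (h0 x hxK)
  have hKi (i : X) : IsCompact (K ∩ tsupport (ρ i)) := hK.inter_right (isClosed_tsupport _)
  have hsum : h = ∑ i ∈ hfin.toFinset, mulTensor (ρ i) h := by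
    rw [sum_mulTensor]
    ext1 x
    by_cases hxK : x ∈ K
    · have h1 : ∑ᶠ i, ρ i x = 1 := ρ.sum_eq_one (Set.mem_univ x)
      rw [finsum_eq_sum_of_support_subset (s := hfin.toFinset)] at h1
      · exact (mulTensor_of_eq_one (φ := fun x => ∑ i ∈ hfin.toFinset, ρ i x) h1).symm
      · intro i hi
        simpa using ⟨x, hi, hxK⟩
    · exact (h0 x hxK).trans (mulTensor_eq_zero_right (h0 x hxK)).symm
  rw [hsum]
  exact (integral_divTerm_sum hg hfin.toFinset hs
    (fun i => integrable_divTerm_of_compact hg (hs i) (hKi i) (hc i)) fun i =>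
      integral_divTerm_of_chart hg (hs i) (hKi i) i (Set.inter_subset_right.trans (hρ i)) (hc i)).2.2

end Divergence

/-! ### The divergence theorem on the orbifold -/

section OrbifoldDivergence

lemma exists_radial_cutoff {n : ℕ} {r : ℝ} (hr : 0 < r) : ∃ c : Euc n → ℝ, ContDiff ℝ ∞ c ∧
    (∀ y z, ‖y‖ = ‖z‖ → c y = c z) ∧ (∀ᶠ z in 𝓝 0, c z = 1) ∧ ∀ z, 3 / 4 * r ≤ ‖z‖ → c z = 0 := by
  -- The argument is at least 1 for ‖z‖ ≤ r/2 and at most 0 for ‖z‖ ≥ r/√2, and 1/√2 < 3/4. The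
  -- squared norm keeps the function smooth at the origin.
  refine ⟨fun z => Real.smoothTransition (2 - 4 * ‖z‖ ^ 2 / r ^ 2),
    Real.smoothTransition.contDiff.comp (contDiff_const.sub
      ((contDiff_const.mul (contDiff_norm_sq ℝ)).div_const _)), ?_, ?_, ?_⟩
  · intro y z h
    simp only [h]
  · filter_upwards [Metric.ball_mem_nhds (0 : Euc n) (half_pos hr)] with z hz
    rw [mem_ball_zero_iff] at hz
    refine Real.smoothTransition.one_of_one_le ?_
    have : 4 * ‖z‖ ^ 2 / r ^ 2 ≤ 1 := by
      rw [div_le_one (by positivity)]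
      nlinarith [norm_nonneg z]
    linarith
  · intro z hz
    refine Real.smoothTransition.zero_of_nonpos ?_
    have : 2 ≤ 4 * ‖z‖ ^ 2 / r ^ 2 := by
      rw [le_div_iff₀ (by positivity)]
      nlinarith [norm_nonneg z]
    linarith

variable {n : ℕ} {M : Type*} [TopologicalSpace M] {O : IsolatedOrbifold n M}

/-- `χ` is a smooth cutoff function at the singular point `p`, given by the compactly supported
function `c` in the uniformizing ball. -/
structure IsCutoff (p : O.sing) (χ : O.Reg → ℝ) (c : Euc n → ℝ) : Prop where
  smooth : SmoothFun (n := n) χ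
  contDiff : ContDiff ℝ ∞ c
  eq_zero : ∀ z, 3 / 4 * O.radius p ≤ ‖z‖ → c z = 0
  eq_unifReg : ∀ z ∈ Metric.ball (0 : Euc n) (O.radius p) \ {0}, χ (O.unifReg p z) = c z
  eventually_zero : ∀ x ∉ O.unifReg p '' (Metric.ball (0 : Euc n) (O.radius p) \ {0}),
    ∀ᶠ x' in 𝓝 x, χ x' = 0
  near_other : ∀ q : O.sing, q ≠ p → ∀ᶠ m in 𝓝 (q : M), ∀ x : O.Reg, (x : M) = m → χ x = 0
  near_self : ∀ᶠ m in 𝓝 (p : M), ∀ x : O.Reg, (x : M) = m → χ x = 1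

/-- A radial function is invariant under Γ_p < O(n), so it descends to the image of the ball;
extension by zero is smooth because the support is compact in M. -/
lemma exists_isCutoff [T2Space M] (p : O.sing) : ∃ χ c, IsCutoff p χ c := by
  classical
  set f := O.unifReg p
  set r := O.radius p
  have hr : 0 < r := O.radius_pos p
  set D := Metric.ball (0 : Euc n) r \ {0} with hD
  have hDp : ParamOn f D := paramOn_unifReg p le_rfl
  obtain ⟨c, hc, hrad, hone, hzero⟩ := exists_radial_cutoff (n := n) hr
  let χ : O.Reg → ℝ := fun x => if hx : ∃ z ∈ D, f z = x then c hx.choose else 0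
  have h1 (z : Euc n) (hz : z ∈ D) : χ (f z) = c z := by
    have hx : ∃ w ∈ D, f w = f z := ⟨z, hz, rfl⟩
    have e : χ (f z) = c hx.choose := dif_pos hx
    obtain ⟨hw, hwz⟩ := hx.choose_spec
    obtain ⟨γ, -, hγ⟩ := (unifReg_eq_iff hw.1 hw.2 hz.1 hz.2).1 hwz
    rw [e]
    exact hrad _ _ ((γ.norm_map _).symm.trans (congrArg norm hγ))
  -- The compact set carrying χ. Being closed in M, it yields vanishing near every point outside it,
  -- including the other singular points.
  let K : Set M := O.unif p '' Metric.closedBall 0 (3 / 4 * r)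
  have hsub : Metric.closedBall (0 : Euc n) (3 / 4 * r) ⊆ Metric.ball 0 r :=
    Metric.closedBall_subset_ball (by linarith)
  have hK : IsClosed K := ((isCompact_closedBall _ _).image_of_continuousOn
    ((O.unif_continuousOn p).mono hsub)).isClosed
  have h2 (x : O.Reg) (hx : (x : M) ∉ K) : χ x = 0 := by
    by_cases hz : ∃ z ∈ D, f z = x
    · obtain ⟨z, hz, rfl⟩ := hz
      rw [h1 z hz]
      refine hzero z (le_of_not_ge fun hle => hx ⟨z, by simpa using hle, ?_⟩)
      exact (O.unifReg_coe p z hz.1 hz.2).symm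
    · exact dif_neg hz
  have h3 (x : O.Reg) (hx : (x : M) ∉ K) : ∀ᶠ x' in 𝓝 x, χ x' = 0 := by
    filter_upwards [(hK.isOpen_compl.preimage continuous_subtype_val).mem_nhds hx] with x' hx'
      using h2 x' hx'
  have h4 (x : O.Reg) (hx : x ∉ f '' D) : (x : M) ∉ K := by
    rintro ⟨z, hz, hzx⟩
    obtain ⟨h0, hfz⟩ := unif_eq_coe (hsub hz) hzx
    exact hx ⟨z, ⟨hsub hz, h0⟩, hfz⟩
  refine ⟨χ, c, fun x => ?_, hc, hzero, h1, fun x hx => h3 x (h4 x hx), fun q hq => ?_, ?_⟩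
  · have hp := isParam_chart (n := n) x
    have hx : (chartAt (Euc n) x).symm (chartAt (Euc n) x x) = x :=
      (chartAt (Euc n) x).left_inv (mem_chart_source _ x)
    by_cases hxD : x ∈ f '' D
    · obtain ⟨z, hz, hzx⟩ := hxD
      obtain ⟨τ, t1, t2, t3⟩ := hp.exists_coordChange (hDp.param z hz) (hx.trans hzx.symm)
      refine (hc.contDiffAt.comp _ t1.smoothAt).congr_of_eventuallyEq ?_
      filter_upwards [t3, t1.tendsto.eventually (hDp.isOpen.mem_nhds (by rwa [t2]))] with w hw hwD
      simp only [Function.comp_apply] at hw ⊢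
      rw [hw, h1 _ hwD]
    · have ht : Filter.Tendsto (chartAt (Euc n) x).symm (𝓝 (chartAt (Euc n) x x)) (𝓝 x) := by
        have := hp.contMDiffAt.continuousAt.tendsto
        rwa [hx] at this
      exact (contDiffAt_const (c := (0 : ℝ))).congr_of_eventuallyEq
        (ht.eventually (h3 x (h4 x hxD)))
  · have hqK : (q : M) ∉ K := by
      rintro ⟨z, hz, hzq⟩
      rcases eq_or_ne z 0 with rfl | h0
      · rw [O.unif_zero] at hzq
        exact hq (Subtype.ext hzq.symm)
      · rw [← O.unifReg_coe p z (hsub hz) h0] at hzq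
        exact (f z).2 (hzq ▸ q.2)
    filter_upwards [hK.isOpen_compl.mem_nhds hqK] with m hm x hx
    exact h2 x (by rwa [hx])
  · obtain ⟨N, hN, hN2⟩ := covers_unifReg p _ hone
    filter_upwards [hN] with m hm x hx
    obtain ⟨z, hz, hzD, rfl⟩ := hN2 x (by rwa [hx])
    rw [h1 z hzD, hz]

/-- A nontrivial group cannot act on a zero-dimensional space; hence n > 0 at a singular point, and
the origin removed from the ball is a null set. -/
lemma nontrivial_of_sing (p : O.sing) : Nontrivial (Euc n) := by
  by_contra hE
  rw [not_nontrivial_iff_subsingleton] at hE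
  have := O.grp_nontrivial p
  obtain ⟨γ, hγ⟩ := exists_ne (1 : O.grp p)
  exact hγ (Subtype.ext (LinearIsometryEquiv.ext fun x => Subsingleton.elim _ _))

variable [CompactSpace M] [T2Space M] [MeasurableSpace M] [BorelSpace M] {g h : TwoTensor n O.Reg}

/-- The integral is |Γ_p|⁻¹ times one over the punctured ball. Filling in the origin, a null set,
gives the divergence of a smooth field with compact support in the whole ball, so there is no
residue at the singular point. -/
lemma integral_divTerm_cutoff (hg : g ∈ O.metrics) (hh : h ∈ O.symTensors) {p : O.sing}
    {χ : O.Reg → ℝ} {c : Euc n → ℝ} (hχ : IsCutoff p χ c) :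
    Integrable (divTerm g (mulTensor χ h)) (volumeMeasure g) ∧
      ∫ x, divTerm g (mulTensor χ h) x ∂(volumeMeasure g) = 0 := by
  have hgR := isRiemannian_of_mem hg
  have hs : SmoothSym (mulTensor χ h) := smoothSym_mulTensor (smoothSym_of_mem hh) hχ.smooth
  have := isFiniteMeasure_volume hg
  obtain ⟨G, hG, hgG⟩ := exists_lift_metric hg p
  obtain ⟨H, hH, hhH⟩ := exists_lift hh p
  have hb := hχ.eq_unifReg
  have hev := hχ.eventually_zero
  set f := O.unifReg p
  set r := O.radius p
  have hr : 0 < r := O.radius_pos p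
  set B := Metric.ball (0 : Euc n) r with hB
  have hO : IsOrbitMap (O.grp p) f (B \ {0}) := isOrbitMap_unifReg p le_rfl
  let H' : Euc n → Matrix (Fin n) (Fin n) ℝ := fun z => c z • H z
  have hH' (z : Euc n) (hz : z ∈ B) : SymAt H' z := by
    constructor
    · filter_upwards [(hH z hz).smooth] with w hw using
        MatSmoothAt.smul hχ.contDiff.contDiffAt hw
    · filter_upwards [(hH z hz).symm] with w hw using hw.smul _
  have hH'0 (z : Euc n) (hz : 3 / 4 * r ≤ ‖z‖) : H' z = 0 := by
    simp only [H', hχ.eq_zero z hz, zero_smul]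
  have eG (z : Euc n) (hz : z ∈ B \ {0}) : paramMatrix f g =ᶠ[𝓝 z] G := by
    filter_upwards [hO.isOpen.mem_nhds hz] with w hw using hgG w hw.1 hw.2
  have eH (z : Euc n) (hz : z ∈ B \ {0}) : paramMatrix f (mulTensor χ h) =ᶠ[𝓝 z] H' := by
    filter_upwards [hO.isOpen.mem_nhds hz] with w hw
    rw [paramMatrix_mulTensor, hb w hw, hhH w hw.1 hw.2]
  have hval (z : Euc n) (hz : z ∈ B \ {0}) :
      divTerm g (mulTensor χ h) (f z) = varDiv G H' z / √(G z).det := by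
    rw [divTerm_param (hO.param z hz) hgR hs, varDiv_congr (eG z hz) (eH z hz),
      (eG z hz).self_of_nhds]
  have hout (x : O.Reg) (hx : x ∉ f '' (B \ {0})) : divTerm g (mulTensor χ h) x = 0 :=
    divTerm_eq_zero hgR hs ((hev x hx).mono fun z hz => mulTensor_eq_zero_left hz)
  have hsub : Metric.closedBall (0 : Euc n) (3 / 4 * r) ⊆ B :=
    Metric.closedBall_subset_ball (by linarith)
  constructor
  · have hN : ContinuousOn (fun z => varDiv G H' z / √(G z).det)
        (Metric.closedBall 0 (3 / 4 * r)) := fun z hz =>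
      ((contDiffAt_varDiv (hG z (hsub hz)) (hH' z (hsub hz))).continuousAt.div
        ((hG z (hsub hz)).smoothAt.sqrt_det (hG z (hsub hz)).det_ne).continuousAt
        (Real.sqrt_pos.2 (hG z (hsub hz)).det_pos).ne').continuousWithinAt
    obtain ⟨C, hC⟩ := (isCompact_closedBall (0 : Euc n) (3 / 4 * r)).exists_bound_of_continuousOn hN
    refine integrable_of_continuous_of_bound (continuous_divTerm hgR hs) (C := max C 0) fun x => ?_
    by_cases hx : x ∈ f '' (B \ {0})
    · obtain ⟨z, hz, rfl⟩ := hx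
      by_cases hzr : z ∈ Metric.closedBall (0 : Euc n) (3 / 4 * r)
      · rw [hval z hz]
        exact (hC z hzr).trans (le_max_left _ _)
      · have h0 : H' =ᶠ[𝓝 z] 0 := by
          filter_upwards [Metric.isClosed_closedBall.isOpen_compl.mem_nhds hzr] with w hw
          refine hH'0 w (le_of_lt ?_)
          simpa using hw
        rw [hval z hz, varDiv_eq_zero h0]
        simp
    · rw [hout x hx]
      simp
  · have := O.grp_finite p
    have hnt := nontrivial_of_sing p
    rw [← setIntegral_eq_integral_of_forall_compl_eq_zero hout]
    have h1 := congrArg (fun μ => ∫ x, divTerm g (mulTensor χ h) x ∂μ) (hO.paramVolume_eq g)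
    simp only [integral_smul_measure, integral_paramVolume hO.toParamOn hgR.toSmoothSym
      (continuous_divTerm hgR hs)] at h1
    have h2 : ∫ y in B \ {0}, √(paramMatrix f g y).det * divTerm g (mulTensor χ h) (f y)
        = ∫ y in B, varDiv G H' y := by
      rw [setIntegral_congr_fun (g := varDiv G H') hO.isOpen.measurableSet fun y hy => ?_]
      · exact setIntegral_congr_set (sdiff_null_ae_eq_self (by simp))
      · rw [hval y hy, (eG y hy).self_of_nhds,
          mul_div_cancel₀ _ (Real.sqrt_pos.2 (hG y hy.1).det_pos).ne']
    rw [h2, integral_varDiv_eq_zero Metric.isOpen_ball (isCompact_closedBall _ _) hsub hG hH'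
      fun y _ hy => hH'0 y (le_of_lt (by simpa using hy))] at h1
    have hcard : ((Nat.card (O.grp p) : ENNReal)).toReal ≠ 0 := by
      simpa using Nat.card_pos.ne'
    exact (smul_eq_zero.1 h1.symm).resolve_left hcard

/-- The exact part of the first variation integrates to zero over the orbifold. -/
lemma integral_divTerm_eq_zero (hg : g ∈ O.metrics) (hh : h ∈ O.symTensors) :
    Integrable (divTerm g h) (volumeMeasure g) ∧ ∫ x, divTerm g h x ∂(volumeMeasure g) = 0 := by
  have hgR := isRiemannian_of_mem hg
  have hhS := smoothSym_of_mem hh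
  have := isFiniteMeasure_volume hg
  choose χ c hχ using fun p : O.sing => exists_isCutoff p
  -- The part of h away from Σ. Near p only the cutoff at p is nonzero, and it equals 1, so θ
  -- vanishes near every singular point.
  let θ : O.Reg → ℝ := fun x => 1 - ∑ p, χ p x
  have hθ : SmoothFun (n := n) θ := fun x =>
    contDiffAt_const.sub (ContDiffAt.sum fun p _ => (hχ p).smooth x)
  have hsing : ∀ p : O.sing, ∀ᶠ m in 𝓝 (p : M), ∀ x : O.Reg, (x : M) = m → θ x = 0 := by
    intro p
    have h1 : ∀ᶠ m in 𝓝 (p : M), ∀ q : O.sing, q ≠ p → ∀ x : O.Reg, (x : M) = m → χ q x = 0 := by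
      rw [Filter.eventually_all]
      intro q
      by_cases hq : q = p
      · exact Filter.Eventually.of_forall fun m h => absurd hq h
      · filter_upwards [(hχ q).near_other p (Ne.symm hq)] with m hm _ using hm
    filter_upwards [h1, (hχ p).near_self] with m h1 h2 x hx
    simp only [θ]
    rw [Finset.sum_eq_single p (fun q _ hq => h1 q hq x hx) (by simp), h2 x hx, sub_self]
  -- The complement in M of neighbourhoods of the singular points is compact and lies in the regular
  -- part.
  have hKex : ∃ K : Set O.Reg, IsCompact K ∧ ∀ x ∉ K, θ x = 0 := by
    choose N hN hN2 hN3 using fun p => mem_nhds_iff.1 (hsing p)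
    have hc : IsCompact (⋃ p, N p)ᶜ := (isOpen_iUnion hN2).isClosed_compl.isCompact
    refine ⟨Subtype.val ⁻¹' (⋃ p, N p)ᶜ, ?_, fun x hx => ?_⟩
    · have hind : Topology.IsInducing (Subtype.val : O.Reg → M) := Topology.IsInducing.subtypeVal
      refine hind.isCompact_iff.2 ?_
      rw [Set.image_preimage_eq_inter_range, Set.inter_eq_left.2]
      · exact hc
      · intro m hm
        refine ⟨⟨m, fun hms => hm (Set.mem_iUnion.2 ⟨⟨m, hms⟩, hN3 ⟨m, hms⟩⟩)⟩, rfl⟩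
    · simp only [Set.mem_preimage, Set.mem_compl_iff, not_not, Set.mem_iUnion] at hx
      obtain ⟨p, hp⟩ := hx
      exact hN p hp x rfl
  obtain ⟨K, hK, hK0⟩ := hKex
  have hθS : SmoothSym (mulTensor θ h) := smoothSym_mulTensor hhS hθ
  have hθ0 (x) (hx : x ∉ K) : mulTensor θ h x = 0 := mulTensor_eq_zero_left (hK0 x hx)
  obtain ⟨s1, s2, s3⟩ := integral_divTerm_sum hgR Finset.univ
    (fun p => smoothSym_mulTensor hhS (hχ p).smooth)
    (fun p => (integral_divTerm_cutoff hg hh (hχ p)).1)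
    fun p => (integral_divTerm_cutoff hg hh (hχ p)).2
  have hdec : h = ∑ p, mulTensor (χ p) h + mulTensor θ h := by
    rw [sum_mulTensor, add_mulTensor]
    exact funext fun x => (mulTensor_of_eq_one (by simp [θ])).symm
  have hadd : divTerm g h = fun x => divTerm g (∑ p, mulTensor (χ p) h) x
      + divTerm g (mulTensor θ h) x := by
    conv_lhs => rw [hdec]
    exact funext fun x => divTerm_add hgR s1 hθS x
  have hi := integrable_divTerm_of_compact hgR hθS hK hθ0
  rw [hadd]
  refine ⟨s2.add hi, ?_⟩
  rw [integral_add s2 hi, s3, zero_add, integral_divTerm_of_compact hgR hθS hK hθ0]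

end OrbifoldDivergence

/-! ### The gradient of the normalized functional -/

section Gradient

-- With A⁻¹ = B*B, cyclicity of the trace makes the pairing of S with itself the squared Frobenius
-- norm of BSB*, and B is invertible.
open scoped MatrixOrder in
lemma eq_zero_of_trace_pairing_self {n : ℕ} {A S : Matrix (Fin n) (Fin n) ℝ} (hA : A.PosDef)
    (hS : S.IsSymm) (h : (A⁻¹ * S * (A⁻¹ * S)).trace = 0) : S = 0 := by
  have hdet : IsUnit A⁻¹.det := (Matrix.isUnit_iff_isUnit_det _).1 hA.inv.isUnit
  obtain ⟨B, hB⟩ := CStarAlgebra.nonneg_iff_eq_star_mul_self.1 hA.inv.posSemidef.nonneg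
  rw [Matrix.star_eq_conjTranspose] at hB
  rw [hB, Matrix.det_mul] at hdet
  have hBu : IsUnit B.det := isUnit_of_mul_isUnit_right hdet
  have hBu' : IsUnit B.conjTranspose.det := isUnit_of_mul_isUnit_left hdet
  have hM : (B * S * B.conjTranspose).conjTranspose = B * S * B.conjTranspose := by
    have hS' : S.conjTranspose = S := by
      rw [Matrix.conjTranspose_eq_transpose_of_trivial]; exact hS
    simp only [Matrix.conjTranspose_mul, Matrix.conjTranspose_conjTranspose, hS', Matrix.mul_assoc]
  have h1 : (B * S * B.conjTranspose * (B * S * B.conjTranspose).conjTranspose).trace = 0 := by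
    rw [hM, ← h, hB]
    calc _ = ((B * S * B.conjTranspose * B * S) * B.conjTranspose).trace := by
          simp only [Matrix.mul_assoc]
      _ = _ := by
          rw [Matrix.trace_mul_comm]
          simp only [Matrix.mul_assoc]
  have h2 := Matrix.trace_mul_conjTranspose_self_eq_zero_iff.1 h1
  have h3 : B * S = 0 := by
    have := congrArg (· * B.conjTranspose⁻¹) h2
    simpa only [Matrix.mul_nonsing_inv_cancel_right _ _ hBu', Matrix.zero_mul] using this
  have := congrArg (B⁻¹ * ·) h3
  simpa only [Matrix.nonsing_inv_mul_cancel_left _ _ hBu, Matrix.mul_zero] using this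

variable {n : ℕ} {X : Type*} [TopologicalSpace X] [ChartedSpace (Euc n) X]

/-- The tensor `Ric + (c - R / 2) g`. -/
def gradTensor (g : TwoTensor n X) (c : ℝ) : TwoTensor n X :=
  ricTensor g + mulTensor (fun x => c - 1 / 2 * scalarCurvature g x) g

lemma matAt_gradTensor (g : TwoTensor n X) (c : ℝ) (x : X) :
    matAt (gradTensor g c) x
      = matAt (ricTensor g) x + (c - 1 / 2 * scalarCurvature g x) • matAt g x := by
  have hx : (chartAt (Euc n) x).symm (chartAt (Euc n) x x) = x :=
    (chartAt (Euc n) x).left_inv (mem_chart_source _ x)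
  rw [matAt, gradTensor, paramMatrix_add, paramMatrix_mulTensor, hx]
  rfl

lemma matAt_mulTensor (φ : X → ℝ) (h : TwoTensor n X) (x : X) :
    matAt (mulTensor φ h) x = φ x • matAt h x := by
  have hx : (chartAt (Euc n) x).symm (chartAt (Euc n) x x) = x :=
    (chartAt (Euc n) x).left_inv (mem_chart_source _ x)
  rw [matAt, paramMatrix_mulTensor, hx]
  rfl

lemma tensorPair_mulTensor (g s h : TwoTensor n X) (φ : X → ℝ) (x : X) :
    tensorPair g s (mulTensor φ h) x = φ x * tensorPair g s h x := by
  simp [tensorPair, matAt_mulTensor]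

lemma gradTensor_apply (g : TwoTensor n X) (c : ℝ) (x : X)
    (u v : TangentSpace 𝓘(ℝ, Euc n) x) : gradTensor g c x u v
      = ricci g x u v + (c - 1 / 2 * scalarCurvature g x) * g x u v := by
  rw [← ricTensor_apply]
  rfl

variable [IsManifold 𝓘(ℝ, Euc n) ∞ X] {g h : TwoTensor n X}

lemma IsRiemannian.posDef_matAt (hg : IsRiemannian g) (x : X) : (matAt g x).PosDef :=
  hg.posDef (isParam_chart x)

lemma IsRiemannian.inv_matAt_mul (hg : IsRiemannian g) (x : X) : (matAt g x)⁻¹ * matAt g x = 1 :=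
  Matrix.nonsing_inv_mul _ (isUnit_iff_ne_zero.2 (hg.posDef_matAt x).det_pos.ne')

lemma tensorPair_gradTensor (hg : IsRiemannian g) (c : ℝ) (x : X) :
    tensorPair g (gradTensor g c) h x = (tensorPair g (ricTensor g) h x
      - 1 / 2 * scalarCurvature g x * trPair g h x) + c * trPair g h x := by
  simp only [tensorPair, trPair, matAt_gradTensor, mul_add, add_mul, Matrix.trace_add,
    Matrix.mul_smul, Matrix.smul_mul, hg.inv_matAt_mul, one_mul, Matrix.trace_smul, smul_eq_mul]
  ring

lemma scalarCurvature_eq_trPair (hg : IsRiemannian g) (x : X) :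
    scalarCurvature g x = trPair g (ricTensor g) x := by
  have hp := isParam_chart (n := n) x
  have hm := hg.metricAt hp
  rw [trPair, matAt, matAt, paramMatrix_ricTensor hp hm]
  exact hm.coordScalar_eq_trace

lemma IsRiemannian.smoothFun_scalarCurvature (hg : IsRiemannian g) :
    SmoothFun (n := n) (scalarCurvature g) := fun x => by
  have hp := isParam_chart (n := n) x
  refine (hg.metricAt hp).contDiffAt_coordScalar.congr_of_eventuallyEq ?_
  filter_upwards [hp.eventually] with z hz using scalarCurvature_param hz (hg.metricAt hz)

lemma IsRiemannian.smoothSym_gradTensor (hg : IsRiemannian g) (c : ℝ) :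
    SmoothSym (gradTensor g c) :=
  hg.smoothSym_ricTensor.add (smoothSym_mulTensor hg.toSmoothSym fun x =>
    contDiffAt_const.sub (contDiffAt_const.mul (hg.smoothFun_scalarCurvature x)))

/-- A tensor with vanishing coordinate matrix vanishes. -/
lemma eq_zero_of_matAt {x : X} (h0 : matAt h x = 0) (u v : TangentSpace 𝓘(ℝ, Euc n) x) :
    h x u v = 0 := by
  have hp := isParam_chart (n := n) x
  have hx : (chartAt (Euc n) x).symm (chartAt (Euc n) x x) = x :=
    (chartAt (Euc n) x).left_inv (mem_chart_source _ x)
  obtain ⟨u', hu⟩ := (hp.mfderivToContinuousLinearEquiv infty_ne_zero).surjective u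
  obtain ⟨v', hv⟩ := (hp.mfderivToContinuousLinearEquiv infty_ne_zero).surjective v
  have h1 := pullback_eq_sum (chartAt (Euc n) x).symm h (chartAt (Euc n) x x) u' v'
  rw [show paramMatrix (chartAt (Euc n) x).symm h (chartAt (Euc n) x x) = 0 from h0] at h1
  simp only [Matrix.zero_apply, mul_zero, Finset.sum_const_zero] at h1
  rw [← h1, ← hu, ← hv]
  exact (tensor_congr h hx _ _).symm

/-- A pointwise trace: c may depend on x, which is how it is used for critical metrics. -/
lemma scalarCurvature_of_ricTensor_eq (hg : IsRiemannian g) {x : X} {c : ℝ}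
    (h : ∀ u v, ricTensor g x u v = c * g x u v) : scalarCurvature g x = n * c := by
  have h1 : matAt (ricTensor g) x = c • matAt g x := by
    rw [← matAt_mulTensor (fun _ => c)]
    have : ricTensor g x = mulTensor (fun _ => c) g x := tensor_ext h
    have hx : (chartAt (Euc n) x).symm (chartAt (Euc n) x x) = x :=
      (chartAt (Euc n) x).left_inv (mem_chart_source _ x)
    ext i j
    simp only [matAt, paramMatrix, Matrix.of_apply, pullback]
    rw [hx, this]
  rw [scalarCurvature_eq_trPair hg, trPair, h1, Matrix.mul_smul, Matrix.trace_smul,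
    hg.inv_matAt_mul, Matrix.trace_one, Fintype.card_fin, smul_eq_mul, mul_comm]

variable [MeasurableSpace X] [BorelSpace X] [SecondCountableTopology X]

/-- Needed for a continuous function that vanishes almost everywhere to vanish identically, and for
the total volume to be positive. -/
lemma IsRiemannian.isOpenPosMeasure (hg : IsRiemannian g) :
    (volumeMeasure g).IsOpenPosMeasure := by
  refine ⟨fun U hU hne => ?_⟩
  obtain ⟨x, hx⟩ := hne
  set e := chartAt (Euc n) x
  have hp := (paramOn_symm (chart_mem_atlas (Euc n) x)).mono (V := e.target ∩ e.symm ⁻¹' U)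
    Set.inter_subset_left (e.isOpen_inter_preimage_symm hU)
  have hi := e.symm.injOn.mono (Set.inter_subset_left : e.target ∩ e.symm ⁻¹' U ⊆ e.target)
  have hsub : e.symm '' (e.target ∩ e.symm ⁻¹' U) ⊆ U := by
    rintro _ ⟨z, hz, rfl⟩
    exact hz.2
  have hxm : e x ∈ e.target ∩ e.symm ⁻¹' U :=
    ⟨mem_chart_target _ x, by simpa [e, (chartAt (Euc n) x).left_inv (mem_chart_source _ x)] using hx⟩
  intro h0
  have h1 := measure_mono_null hsub h0
  rw [volumeMeasure_apply hp hi g hp.isOpen_image.measurableSet subset_rfl,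
    paramVolume_apply hp g hp.isOpen_image.measurableSet,
    Set.inter_eq_left.2 (Set.subset_preimage_image _ _), lintegral_eq_zero_iff'
      ((hp.continuousOn_density hg.toSmoothSym).aemeasurable
        hp.isOpen.measurableSet).ennreal_ofReal, Filter.EventuallyEq,
    ae_restrict_iff' hp.isOpen.measurableSet] at h1
  refine hp.isOpen.measure_ne_zero volume ⟨_, hxm⟩ (measure_mono_null (fun z hz => ?_) h1)
  simp only [Set.mem_compl_iff, Set.mem_ofPred_eq, Pi.zero_apply, ENNReal.ofReal_eq_zero, not_forall,
    not_le]
  exact ⟨hz, Real.sqrt_pos.2 (hg.metricAt (hp.param z hz)).det_pos⟩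

end Gradient

/-! ### Critical points of the normalized Einstein–Hilbert functional -/

section CriticalPoints

variable {n : ℕ} {M : Type*} [TopologicalSpace M] [MeasurableSpace M]
  {O : IsolatedOrbifold n M} {g h : TwoTensor n O.Reg}

/-- If M = Σ there is a single tensor field and the functional is constant. The case is set apart
because dividing by the volume needs M∖Σ nonempty. -/
lemma mem_of_isEmpty [IsEmpty O.Reg] (hg : g ∈ O.metrics) :
    g ∈ O.criticalPoints ∧ g ∈ O.einsteinMetrics := by
  refine ⟨⟨hg, fun h _ => ?_⟩, hg, 0, fun x => isEmptyElim x⟩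
  have : (fun t : ℝ => O.einsteinHilbert (g + t • h)) = fun _ => O.einsteinHilbert g :=
    funext fun t => congrArg _ (Subsingleton.elim _ _)
  rw [this]
  exact hasDerivAt_const _ _

variable [CompactSpace M] [T2Space M] [BorelSpace M]

/-- The average of the scalar curvature. -/
def meanCurvature (g : TwoTensor n O.Reg) : ℝ :=
  (∫ x, scalarCurvature g x ∂(volumeMeasure g)) / (volumeMeasure g).real Set.univ

lemma volume_real_pos [Nonempty O.Reg] (hg : g ∈ O.metrics) :
    0 < (volumeMeasure g).real Set.univ := by
  have := (isRiemannian_of_mem hg).isOpenPosMeasure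
  exact ENNReal.toReal_pos (isOpen_univ.measure_ne_zero _ Set.univ_nonempty)
    (volumeMeasure_univ_lt_top hg).ne

lemma integrable_trPair (hg : g ∈ O.metrics) (hh : h ∈ O.symTensors) :
    Integrable (trPair g h) (volumeMeasure g) := by
  have hgR := isRiemannian_of_mem hg
  have := isFiniteMeasure_volume hg
  obtain ⟨δ, hδ, C, hC⟩ := uniformlyVaries_univ hg hh
  -- The derivative of the volume ratio at t = 0 is half the trace, whence the factor 2.
  refine integrable_of_continuous_of_bound (hgR.continuous_trPair (smoothSym_of_mem hh))
    (C := 2 * C) fun x => ?_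
  have h1 := (hC x trivial 0 (by simpa using hδ)).2.2.deriv_bound
  rw [(hasDerivAt_volRatio hgR x).deriv, abs_mul] at h1
  norm_num at h1
  linarith

lemma integrable_curvVar (hg : g ∈ O.metrics) (hh : h ∈ O.symTensors) :
    Integrable (curvVar g h) (volumeMeasure g) := by
  have hgR := isRiemannian_of_mem hg
  have hhS := smoothSym_of_mem hh
  have := isFiniteMeasure_volume hg
  obtain ⟨δ, hδ, C, hC⟩ := uniformlyVaries_univ hg hh
  refine integrable_of_continuous_of_bound (continuous_curvVar hgR hhS) (C := C) fun x => ?_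
  have h1 := (hC x trivial 0 (by simpa using hδ)).2.1.deriv_bound
  rwa [(hasDerivAt_curvDensity' hgR hhS x).deriv] at h1

lemma integral_tensorPair_gradTensor (hg : g ∈ O.metrics) (hh : h ∈ O.symTensors) (c : ℝ) :
    ∫ x, tensorPair g (gradTensor g c) h x ∂(volumeMeasure g)
      = -(∫ x, curvVar g h x ∂(volumeMeasure g)) + c * ∫ x, trPair g h x ∂(volumeMeasure g) := by
  have hgR := isRiemannian_of_mem hg
  obtain ⟨h1, h2⟩ := integral_divTerm_eq_zero hg hh
  have h3 := integrable_curvVar hg hh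
  have h4 : (fun x => tensorPair g (gradTensor g c) h x)
      = fun x => (divTerm g h x - curvVar g h x) + c * trPair g h x := by
    ext1 x
    rw [tensorPair_gradTensor hgR, curvVar]
    ring
  have h5 : Integrable (fun x => divTerm g h x - curvVar g h x) (volumeMeasure g) := h1.sub h3
  rw [h4, integral_add h5 ((integrable_trPair hg hh).const_mul c), integral_sub h1 h3, h2,
    integral_const_mul, zero_sub]

/-- The first variation of the normalized Einstein–Hilbert functional. -/
lemma hasDerivAt_einsteinHilbert [Nonempty O.Reg] (hg : g ∈ O.metrics) (hh : h ∈ O.symTensors) :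
    HasDerivAt (fun t : ℝ => O.einsteinHilbert (g + t • h))
      (-((volumeMeasure g).real Set.univ ^ (((n : ℝ) - 2) / n))⁻¹
        * ∫ x, tensorPair g (gradTensor g (((n : ℝ) - 2) / n * meanCurvature g / 2)) h x
          ∂(volumeMeasure g)) 0 := by
  have hV := volume_real_pos hg
  have h0 : g + (0 : ℝ) • h = g := funext fun x => tensor_ext fun u v =>
    show g x u v + 0 * h x u v = g x u v by ring
  have h1 := hasDerivAt_totalCurvature hg hh
  have h2 := hasDerivAt_volume hg hh
  have hVa := Real.rpow_pos_of_pos hV (((n : ℝ) - 2) / n)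
  have h3 := h1.div (h2.rpow_const (p := ((n : ℝ) - 2) / n) (Or.inl (by rw [h0]; exact hV.ne')))
    (by rw [h0]; exact hVa.ne')
  refine h3.congr_deriv ?_
  -- The quotient rule contributes ((n−2)/n) r times the derivative of the volume, and that
  -- derivative is half the integral of tr h; hence the constant ((n−2)/n) r/2 in the gradient.
  rw [h0, integral_tensorPair_gradTensor hg hh, integral_const_mul, Real.rpow_sub_one hV.ne',
    meanCurvature]
  field_simp
  ring

/-- A critical metric annihilates the gradient. -/
lemma gradTensor_eq_zero [Nonempty O.Reg] (hg : g ∈ O.criticalPoints) (x : O.Reg)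
    (u v : TangentSpace 𝓘(ℝ, Euc n) x) :
    gradTensor g (((n : ℝ) - 2) / n * meanCurvature g / 2) x u v = 0 := by
  obtain ⟨hg, hcrit⟩ := hg
  have hgR := isRiemannian_of_mem hg
  have := isFiniteMeasure_volume hg
  have := hgR.isOpenPosMeasure
  have hVa := Real.rpow_pos_of_pos (volume_real_pos hg) (((n : ℝ) - 2) / n)
  set T := gradTensor g (((n : ℝ) - 2) / n * meanCurvature g / 2)
  have hT : SmoothSym T := hgR.smoothSym_gradTensor _
  have hcont : Continuous (tensorPair g T T) := hgR.continuous_tensorPair hT hT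
  -- Fundamental lemma of the calculus of variations with h = φT. Compact support of φ makes φT an
  -- orbifold tensor without any knowledge of T near Σ.
  have hae : ∀ᵐ x ∂(volumeMeasure g), tensorPair g T T x = 0 := by
    refine ae_eq_zero_of_integral_contMDiff_smul_eq_zero 𝓘(ℝ, Euc n) hcont.locallyIntegrable
      fun φ hφ hc => ?_
    have hφT : mulTensor φ T ∈ O.symTensors :=
      mem_symTensors_of_compact (smoothSym_mulTensor hT (smoothFun_of_contMDiff hφ)) hc
        fun x hx => mulTensor_eq_zero_left (image_eq_zero_of_notMem_tsupport hx)
    have h1 := (hasDerivAt_einsteinHilbert hg hφT).unique (hcrit _ hφT)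
    have h2 := (mul_eq_zero.1 h1).resolve_left (neg_ne_zero.2 (inv_ne_zero hVa.ne'))
    rw [← h2]
    exact integral_congr_ae (Filter.Eventually.of_forall fun x =>
      (tensorPair_mulTensor g T T φ x).symm)
  have h0 : tensorPair g T T = fun _ => 0 := (hcont.ae_eq_iff_eq _ continuous_const).1 hae
  refine eq_zero_of_matAt (eq_zero_of_trace_pairing_self (hgR.posDef_matAt x)
    (hT.symAt (isParam_chart x)).symm.self_of_nhds (congrFun h0 x)) u v

/-- Vanishing of the gradient makes Ric pointwise proportional to g, with a factor involving R only;
the trace then forces R to equal its mean. -/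
lemma mem_einsteinMetrics_of_mem_criticalPoints (hn : 3 ≤ n) (hg : g ∈ O.criticalPoints) :
    g ∈ O.einsteinMetrics := by
  rcases isEmpty_or_nonempty O.Reg with hE | hE
  · exact (mem_of_isEmpty hg.1).2
  have hgR := isRiemannian_of_mem hg.1
  have hn' : (3 : ℝ) ≤ n := by exact_mod_cast hn
  have hT := gradTensor_eq_zero hg
  set r := meanCurvature g
  have hric (x : O.Reg) (u v : TangentSpace 𝓘(ℝ, Euc n) x) : ricci g x u v
      = (1 / 2 * scalarCurvature g x - ((n : ℝ) - 2) / n * r / 2) * g x u v := by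
    have := hT x u v
    rw [gradTensor_apply] at this
    linear_combination this
  have hR (x : O.Reg) : scalarCurvature g x = r := by
    have h1 := scalarCurvature_of_ricTensor_eq hgR fun u v => (ricTensor_apply g x u v).trans (hric x u v)
    have hn0 : (n : ℝ) ≠ 0 := by linarith
    field_simp at h1
    -- The trace reads R = n(R/2 − (n−2)r/(2n)), that is (n−2)(R − r) = 0; this is where n ≥ 3
    -- enters.
    have h2 : ((n : ℝ) - 2) * (scalarCurvature g x - r) = 0 := by linear_combination -h1
    have h3 := (mul_eq_zero.1 h2).resolve_left (by linarith)
    linarith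
  refine ⟨hg.1, 1 / 2 * r - ((n : ℝ) - 2) / n * r / 2, fun x u v => ?_⟩
  rw [hric, hR]

/-- Here R = r = nc, so the coefficient of g in the gradient is c + (n−2)c/2 − nc/2 = 0. -/
lemma mem_criticalPoints_of_mem_einsteinMetrics (hn : n ≠ 0) (hg : g ∈ O.einsteinMetrics) :
    g ∈ O.criticalPoints := by
  rcases isEmpty_or_nonempty O.Reg with hE | hE
  · exact (mem_of_isEmpty hg.1).1
  obtain ⟨hg, c, hc⟩ := hg
  have hgR := isRiemannian_of_mem hg
  have hV := volume_real_pos hg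
  have hn0 : (n : ℝ) ≠ 0 := by exact_mod_cast hn
  have hR (x : O.Reg) : scalarCurvature g x = n * c :=
    scalarCurvature_of_ricTensor_eq hgR fun u v => (ricTensor_apply g x u v).trans (hc x u v)
  have hr : meanCurvature g = n * c := by
    rw [meanCurvature]
    simp only [hR, integral_const, smul_eq_mul]
    field_simp
  refine ⟨hg, fun h hh => (hasDerivAt_einsteinHilbert hg hh).congr_deriv ?_⟩
  have hT : ∀ x, gradTensor g (((n : ℝ) - 2) / n * meanCurvature g / 2) x = 0 := by
    refine fun x => tensor_ext (k := 0) fun u v => ?_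
    rw [gradTensor_apply, hc, hR, hr]
    change _ = (0 : ℝ)
    field_simp
    ring
  have h0 : ∀ x, tensorPair g (gradTensor g (((n : ℝ) - 2) / n * meanCurvature g / 2)) h x = 0 := by
    intro x
    have : matAt (gradTensor g (((n : ℝ) - 2) / n * meanCurvature g / 2)) x = 0 := by
      ext i j
      simp only [matAt, paramMatrix, Matrix.of_apply, pullback]
      rw [hT]
      rfl
    rw [tensorPair, this]
    simp
  simp only [h0, integral_zero, mul_zero]

end CriticalPoints

end EHOrbifold

end

theorem proposition2p1 {n : ℕ} (hn : 3 ≤ n) {M : Type*} [TopologicalSpace M] [CompactSpace M]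
    [T2Space M] [MeasurableSpace M] [BorelSpace M] (O : EHOrbifold.IsolatedOrbifold n M) :
    O.criticalPoints = O.einsteinMetrics := by
  ext g
  exact ⟨EHOrbifold.mem_einsteinMetrics_of_mem_criticalPoints hn,
    EHOrbifold.mem_criticalPoints_of_mem_einsteinMetrics (by omega)⟩
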